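/- Fix $m>0$. On $\mathbb{R}^4\cong\mathbb{C}^2$ with coordinates $(z_1,z_2)$, let $r^2=|z_1|^2+|z_2|^2$, let $\mathbf{e}$ be the euclidean metric, and let $I_1(z_1,z_2)=(iz_1,iz_2)$, $I_2(z_1,z_2)=(-\overline{z_2},\overline{z_1})$, $I_3=I_1I_2$ be the standard complex structures. Let $u,v\ge 0$ be the functions determined by $|z_1|=e^{m(u^2-v^2)}u$, $|z_2|=e^{m(v^2-u^2)}v$, and put $y_1=\tfrac12(u^2-v^2)$, $y_2+iy_3=-iz_1z_2$, $R=\tfrac12(u^2+v^2)=(y_1^2+y_2^2+y_3^2)^{1/2}$, $V=\frac{1+4mR}{2R}$, $\eta=V\,I_1dy_1$. The Taub-NUT metric is $\mathbf{f}=V(dy_1^2+dy_2^2+dy_3^2)+V^{-1}\eta^2$. A field of endomorphisms $J$ acts on 1-forms by $J\alpha=-\alpha(J\,\cdot)$, and $dd^c_J\psi:=d(J\,d\psi)$. Let $\theta_j=\frac14 dd^c_{I_j}(r^{-2})$ for $j=2,3$. Let $k\ge2$, let $\mathcal{D}_k\subset \mathrm{SU}(2)$ be the binary dihedral group of order $4k$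 generated by $\mathrm{diag}(e^{i\pi/k},e^{-i\pi/k})$ and $\begin{pmatrix}0&-1\\1&0\end{pmatrix}$, and let $(Y,g_Y,I_1^Y,I_2^Y,I_3^Y)$ be an ALE gravitational instanton modelled on $\mathbb{R}^4/\mathcal{D}_k$: a hyperkähler 4-manifold with a diffeomorphism $\Phi_Y$ from the complement of a compact subset of $Y$ onto $(\mathbb{R}^4\setminus B)/\mathcal{D}_k$, with $B$ a ball centred at the origin, such that $|(\nabla^{\mathbf{e}})^\ell(\Phi_{Y*}g_Y-\mathbf{e})|_{\mathbf{e}}$ and $|(\nabla^{\mathbf{e}})^\ell(\Phi_{Y*}I_j^Y-I_j)|_{\mathbf{e}}$ ($j=1,2,3$) are $O(r^{-4-\ell})$ for all $\ell\ge0$. Write again $I_1^Y$ for $\Phi_{Y*}I_1^Y$, lifted to $\mathbb{R}^4\setminus B$. Consider the complex valued function $$\psi_c:=-\frac14\,\frac{(y_2+iy_3)\sinh(4my_1)}{r^2R}\qquad\text{on }\mathbb{R}^4\setminus\{0\}.$$ Then near infinity: 1. $|(\nabla^{\mathbf{f}})^\ell\psi_c|_{\mathbf{f}}=O(R^{-1})$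 for $\ell=0,\dots,4$; 2. $|(\nabla^{\mathbf{f}})^\ell(dd^c_{I_1}\psi_c-(\theta_2+i\theta_3))|_{\mathbf{f}}=O(R^{-2})$ for $\ell=0,1,2$, and likewise $|(\nabla^{\mathbf{f}})^\ell(dd^c_{I_1^Y}\psi_c-(\theta_2+i\theta_3))|_{\mathbf{f}}=O(R^{-2})$ for $\ell=0,1,2$. -/

import Mathlib

open scoped Manifold ContDiff

noncomputable section

namespace TaubNUT

/-- `ℂ² = ℝ⁴` with its euclidean norm `r = ‖z‖`; `z 0` and `z 1` are the complex coordinates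
`z₁` and `z₂`. -/
abbrev C2 : Type := EuclideanSpace ℂ (Fin 2)

/-! ### The standard complex structures of `ℝ⁴ = ℍ` -/

/-- `I₁ (z₁, z₂) = (i z₁, i z₂)`. -/
def stdI₁ : C2 →L[ℝ] C2 :=
  LinearMap.toContinuousLinearMap
    { toFun := fun z => !₂[Complex.I * z 0, Complex.I * z 1]
      map_add' := by
        intro x y; ext i; fin_cases i <;> simp [mul_add]
      map_smul' := by
        intro c x; ext i; fin_cases i <;> (simp; ring) }

/-- `I₂ (z₁, z₂) = (-conj z₂, conj z₁)`. -/
def stdI₂ : C2 →L[ℝ] C2 :=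
  LinearMap.toContinuousLinearMap
    { toFun := fun z => !₂[-(starRingEnd ℂ (z 1)), starRingEnd ℂ (z 0)]
      map_add' := by
        intro x y; ext i; fin_cases i <;> simp <;> ring
      map_smul' := by
        intro c x; ext i; fin_cases i <;> simp }

/-- The standard triple `I₁`, `I₂`, `I₃ = I₁ I₂`, indexed by `0, 1, 2`. -/
def stdI : Fin 3 → C2 →L[ℝ] C2 := ![stdI₁, stdI₂, stdI₁.comp stdI₂]

/-- The euclidean metric of `ℂ² = ℝ⁴`. -/
def euclid : C2 →L[ℝ] C2 →L[ℝ] ℝ := innerSL ℝ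

theorem euclid_apply (X Z : C2) : euclid X Z = inner ℝ X Z := rfl

/-! ### Tensor calculus for a metric on `ℝ⁴` -/

/-- Complex valued covariant `k`-tensor fields on `ℝ⁴`. -/
abbrev CTensor (k : ℕ) : Type := C2 → (Fin k → C2) → ℂ

/-- A function seen as a `0`-tensor. -/
def scalar (ψ : C2 → ℂ) : CTensor 0 := fun z _ => ψ z

/-- `e` is an orthonormal frame for the bilinear form `b`. -/
def IsOrthonormalFrame (b : C2 → C2 → ℝ) (e : Fin 4 → C2) : Prop :=
  ∀ i j, b (e i) (e j) = if i = j then 1 else 0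

/-- A choice of orthonormal frame; the notions defined through it below do not depend on this
choice. -/
def orthoFrame (b : C2 → C2 → ℝ) : Fin 4 → C2 :=
  Classical.epsilon (IsOrthonormalFrame b)

/-- The Christoffel term `Γ_z(X, Y) = ∇_X Y - D_X Y` (for `Y` constant) of the Levi-Civita
connection of `g`, given by the Koszul formula
`2 g(Γ(X, Y), Z) = D_X g(Y, Z) + D_Y g(X, Z) - D_Z g(X, Y)`. -/
def christoffel (g : C2 → C2 → C2 → ℝ) (z X Y : C2) : C2 :=
  ∑ a : Fin 4,
    ((fderiv ℝ (fun w => g w Y (orthoFrame (g z) a)) z X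
      + fderiv ℝ (fun w => g w X (orthoFrame (g z) a)) z Y
      - fderiv ℝ (fun w => g w X Y) z (orthoFrame (g z) a)) / 2) • orthoFrame (g z) a

/-- Levi-Civita covariant derivative of a covariant tensor field; the new slot comes first. -/
def covDeriv (g : C2 → C2 → C2 → ℝ) {k : ℕ} (T : CTensor k) : CTensor (k + 1) :=
  fun z X =>
    fderiv ℝ (fun w => T w (Fin.tail X)) z (X 0)
      - ∑ i : Fin k,
          T z (Function.update (Fin.tail X) i (christoffel g z (X 0) (X i.succ)))

/-- The iterated covariant derivative `∇^ℓ T`. -/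
def iterCovDeriv (g : C2 → C2 → C2 → ℝ) {k : ℕ} : (ℓ : ℕ) → CTensor k → CTensor (k + ℓ)
  | 0, T => T
  | ℓ + 1, T => covDeriv g (iterCovDeriv g ℓ T)

/-- The pointwise norm `|T|_g` of a covariant tensor field. -/
def tensorNorm (g : C2 → C2 → C2 → ℝ) {k : ℕ} (T : CTensor k) (z : C2) : ℝ :=
  Real.sqrt (∑ i : Fin k → Fin 4, ‖T z (fun a => orthoFrame (g z) (i a))‖ ^ 2)

/-- The `J`-complex Hessian `d d^c_J ψ = d (J dψ)`, a 2-form, where `J` acts on 1-forms by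
`J α = -α(J ·)`. -/
def ddc (J : C2 → C2 →L[ℝ] C2) (ψ : C2 → ℂ) : CTensor 2 :=
  fun z X =>
    fderiv ℝ (fun w => -(fderiv ℝ ψ w (J w (X 1)))) z (X 0)
      - fderiv ℝ (fun w => -(fderiv ℝ ψ w (J w (X 0)))) z (X 1)

/-- `θ_j = (1/4) d d^c_{I_j} (r⁻²)`. -/
def theta (j : Fin 3) : CTensor 2 :=
  fun z X => (1 / 4 : ℂ) * ddc (fun _ => stdI j) (fun w => (((‖w‖ ^ 2)⁻¹ : ℝ) : ℂ)) z X

/-- The complex 2-form `θ₂ + i θ₃`. -/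
def thetaC : CTensor 2 := fun z X => theta 1 z X + Complex.I * theta 2 z X

/-! ### The Taub-NUT metric -/

/-- The equations `|z₁| = e^{m(u²-v²)} u`, `|z₂| = e^{m(v²-u²)} v` with `u, v ≥ 0`. -/
def IsUV (m : ℝ) (z : C2) (p : ℝ × ℝ) : Prop :=
  0 ≤ p.1 ∧ 0 ≤ p.2 ∧
    ‖z 0‖ = Real.exp (m * (p.1 ^ 2 - p.2 ^ 2)) * p.1 ∧
    ‖z 1‖ = Real.exp (m * (p.2 ^ 2 - p.1 ^ 2)) * p.2

theorem existsUnique_isUV {m : ℝ} (hm : 0 < m) (z : C2) : ∃! p : ℝ × ℝ, IsUV m z p := by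
  set a := ‖z 0‖ with ha
  set b := ‖z 1‖ with hb
  have ha0 : 0 ≤ a := norm_nonneg _
  have hb0 : 0 ≤ b := norm_nonneg _
  let F : ℝ → ℝ := fun t => t - (a * Real.exp (-(m * t))) ^ 2 + (b * Real.exp (m * t)) ^ 2
  have hF : StrictMono F := by
    intro s t hst
    have h1 : Real.exp (-(m * t)) ≤ Real.exp (-(m * s)) := Real.exp_le_exp.2 (by nlinarith)
    have h2 : Real.exp (m * s) ≤ Real.exp (m * t) := Real.exp_le_exp.2 (by nlinarith)
    have h3 : (a * Real.exp (-(m * t))) ^ 2 ≤ (a * Real.exp (-(m * s))) ^ 2 := by gcongr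
    have h4 : (b * Real.exp (m * s)) ^ 2 ≤ (b * Real.exp (m * t)) ^ 2 := by gcongr
    simp only [F]; linarith
  have hFc : Continuous F := by fun_prop
  have hlo : F (-b ^ 2) ≤ 0 := by
    have h2 : Real.exp (m * -b ^ 2) ≤ 1 := Real.exp_le_one_iff.2 (by nlinarith [sq_nonneg b])
    have h4 : (b * Real.exp (m * -b ^ 2)) ^ 2 ≤ (b * 1) ^ 2 := by gcongr
    simp only [F]; nlinarith [sq_nonneg (a * Real.exp (-(m * -b ^ 2)))]
  have hhi : 0 ≤ F (a ^ 2) := by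
    have h2 : Real.exp (-(m * a ^ 2)) ≤ 1 := Real.exp_le_one_iff.2 (by nlinarith [sq_nonneg a])
    have h4 : (a * Real.exp (-(m * a ^ 2))) ^ 2 ≤ (a * 1) ^ 2 := by gcongr
    simp only [F]; nlinarith [sq_nonneg (b * Real.exp (m * a ^ 2))]
  have hle : -b ^ 2 ≤ a ^ 2 := by nlinarith [sq_nonneg a, sq_nonneg b]
  obtain ⟨t, -, ht⟩ := intermediate_value_Icc hle hFc.continuousOn ⟨hlo, hhi⟩
  have key : (a * Real.exp (-(m * t))) ^ 2 - (b * Real.exp (m * t)) ^ 2 = t := by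
    simp only [F] at ht; linarith
  refine ⟨(a * Real.exp (-(m * t)), b * Real.exp (m * t)), ?_, ?_⟩
  · refine ⟨by positivity, by positivity, ?_, ?_⟩
    · simp only
      rw [key, ← ha, mul_comm a, ← mul_assoc, ← Real.exp_add]; simp
    · simp only
      rw [← neg_sub, key, ← hb, mul_comm b, ← mul_assoc, ← Real.exp_add]; simp
  · rintro ⟨u, v⟩ ⟨-, -, h1, h2⟩
    simp only at h1 h2
    rw [← ha] at h1
    rw [← hb] at h2
    have hu : u = a * Real.exp (-(m * (u ^ 2 - v ^ 2))) := by
      rw [h1, mul_comm (Real.exp _) u, mul_assoc, ← Real.exp_add]; simp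
    have hv : v = b * Real.exp (m * (u ^ 2 - v ^ 2)) := by
      rw [h2, mul_comm (Real.exp _) v, mul_assoc, ← Real.exp_add]
      rw [show m * (v ^ 2 - u ^ 2) + m * (u ^ 2 - v ^ 2) = 0 by ring]; simp
    have hFt : F (u ^ 2 - v ^ 2) = F t := by
      rw [ht]; simp only [F]; rw [← hu, ← hv]; ring
    have htt := hF.injective hFt
    rw [htt] at hu hv
    rw [← hu, ← hv]

/-- The pair `(u, v)` of functions on `ℂ²` (see `existsUnique_isUV`). -/
def uv (m : ℝ) (z : C2) : ℝ × ℝ := Classical.epsilon (IsUV m z)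

theorem isUV_uv {m : ℝ} (hm : 0 < m) (z : C2) : IsUV m z (uv m z) :=
  Classical.epsilon_spec (existsUnique_isUV hm z).exists

/-- `y₁ = (u² - v²) / 2`. -/
def y₁ (m : ℝ) (z : C2) : ℝ := ((uv m z).1 ^ 2 - (uv m z).2 ^ 2) / 2

/-- `y₂ + i y₃ = -i z₁ z₂`. -/
def yC (z : C2) : ℂ := -Complex.I * (z 0 * z 1)

/-- The three functions `y₁, y₂, y₃`, indexed by `0, 1, 2`. -/
def y (m : ℝ) : Fin 3 → C2 → ℝ := ![y₁ m, fun z => (yC z).re, fun z => (yC z).im]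

/-- `R = (u² + v²) / 2`. -/
def R (m : ℝ) (z : C2) : ℝ := ((uv m z).1 ^ 2 + (uv m z).2 ^ 2) / 2

/-- `V = (1 + 4mR) / (2R)`. -/
def V (m : ℝ) (z : C2) : ℝ := (1 + 4 * m * R m z) / (2 * R m z)

/-- The 1-form `η = V I₁ dy₁ = -V dy₁(I₁ ·)`. -/
def eta (m : ℝ) (z X : C2) : ℝ := -(V m z * fderiv ℝ (y₁ m) z (stdI 0 X))

/-- The Taub-NUT metric `f = V (dy₁² + dy₂² + dy₃²) + V⁻¹ η²` on `ℂ² ∖ {0}`. -/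
def metric (m : ℝ) (z X Y : C2) : ℝ :=
  V m z * ∑ j : Fin 3, fderiv ℝ (y m j) z X * fderiv ℝ (y m j) z Y
    + (V m z)⁻¹ * (eta m z X * eta m z Y)

/-- `ψ_c = -(1/4) (y₂ + i y₃) sinh(4 m y₁) / (r² R)`. -/
def psiC (m : ℝ) (z : C2) : ℂ :=
  -(1 / 4) * (yC z * (Real.sinh (4 * m * y₁ m z) : ℂ)) / ((‖z‖ ^ 2 * R m z : ℝ) : ℂ)

/-! ### ALE gravitational instantons of dihedral type -/

/-- The binary dihedral group of order `4k`, generated by `diag(e^{iπ/k}, e^{-iπ/k})` and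
`(0 -1; 1 0)`. Both generators have finite order, so the submonoid they generate is a group. -/
def binaryDihedral (k : ℕ) : Submonoid (Matrix (Fin 2) (Fin 2) ℂ) :=
  Submonoid.closure
    {!![Complex.exp (Complex.I * (Real.pi / k : ℝ)), 0;
        0, Complex.exp (-(Complex.I * (Real.pi / k : ℝ)))],
     !![0, -1; 1, 0]}

variable (Y : Type*) [TopologicalSpace Y] [ChartedSpace C2 Y] [IsManifold 𝓘(ℝ, C2) ∞ Y]

/-- `dω = 0` for a 2-form `ω` on `Y`, written in the charts of `Y`: with `ω` read in a chart,
`D_A ω(B, C) + D_B ω(C, A) + D_C ω(A, B) = 0` for all constant vectors. -/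
def IsClosedForm
    (form : (p : Y) → TangentSpace 𝓘(ℝ, C2) p → TangentSpace 𝓘(ℝ, C2) p → ℝ) : Prop :=
  ∀ p : Y, ∀ x ∈ (extChartAt 𝓘(ℝ, C2) p).target, ∀ A B C : C2,
    let c : C2 → Y := (extChartAt 𝓘(ℝ, C2) p).symm
    let ωc : C2 → C2 → C2 → ℝ := fun w A B =>
      form (c w) (mfderiv 𝓘(ℝ, C2) 𝓘(ℝ, C2) c w A) (mfderiv 𝓘(ℝ, C2) 𝓘(ℝ, C2) c w B)
    fderiv ℝ (fun w => ωc w B C) x A + fderiv ℝ (fun w => ωc w C A) x B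
      + fderiv ℝ (fun w => ωc w A B) x C = 0

/-- A smooth hyperkähler structure on a 4-manifold: a Riemannian metric `g` and three almost
complex structures which satisfy the quaternionic relations, are `g`-orthogonal, and whose
forms `ω_j = g(I_j ·, ·)` are closed (closedness of the three forms gives the integrability of
the `I_j`). -/
structure Hyperkahler where
  g : Bundle.ContMDiffRiemannianMetric 𝓘(ℝ, C2) ∞ C2 (fun p : Y => TangentSpace 𝓘(ℝ, C2) p)
  cs : Fin 3 → (p : Y) → TangentSpace 𝓘(ℝ, C2) p →L[ℝ] TangentSpace 𝓘(ℝ, C2) p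
  cs_smooth : ∀ j, ContMDiff 𝓘(ℝ, C2) (𝓘(ℝ, C2).prod 𝓘(ℝ, C2 →L[ℝ] C2)) ∞
    (fun p : Y => Bundle.TotalSpace.mk' (C2 →L[ℝ] C2)
      (E := fun p : Y => TangentSpace 𝓘(ℝ, C2) p →L[ℝ] TangentSpace 𝓘(ℝ, C2) p) p (cs j p))
  cs_sq : ∀ j p X, cs j p (cs j p X) = -X
  cs_mul : ∀ p X, cs 0 p (cs 1 p X) = cs 2 p X
  cs_orth : ∀ j p X Z, g.inner p (cs j p X) (cs j p Z) = g.inner p X Z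
  closed : ∀ j, IsClosedForm Y (fun p A B => g.inner p (cs j p A) B)

variable {Y}

/-- The pull-back `(dq)⁻¹ ∘ J ∘ dq` of a field of endomorphisms by a local diffeomorphism. -/
def pullEnd (q : C2 → Y)
    (J : (p : Y) → TangentSpace 𝓘(ℝ, C2) p →L[ℝ] TangentSpace 𝓘(ℝ, C2) p) (z : C2) :
    C2 →L[ℝ] C2 :=
  let D : C2 →L[ℝ] TangentSpace 𝓘(ℝ, C2) (q z) := mfderiv 𝓘(ℝ, C2) 𝓘(ℝ, C2) q z
  (D.inverse.comp (J (q z))).comp D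

/-- The pull-back of a field of bilinear forms. -/
def pullForm (q : C2 → Y)
    (h : (p : Y) → TangentSpace 𝓘(ℝ, C2) p →L[ℝ] TangentSpace 𝓘(ℝ, C2) p →L[ℝ] ℝ) (z : C2) :
    C2 →L[ℝ] C2 →L[ℝ] ℝ :=
  let D : C2 →L[ℝ] C2 := mfderiv 𝓘(ℝ, C2) 𝓘(ℝ, C2) q z
  let H : C2 →L[ℝ] C2 →L[ℝ] ℝ := h (q z)
  H.bilinearComp D D

/-- An ALE diffeomorphism `Φ` from the complement of a compact subset of `Y` onto
`(ℝ⁴ ∖ B) / 𝒟_k`, where `B` is the closed ball of radius `ρ`. It is given by the covering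
`q = Φ⁻¹ ∘ (ℝ⁴ ∖ B → (ℝ⁴ ∖ B) / 𝒟_k)`; the values of `q` on `B` play no role. Tensors of `Y`
are transported to `ℝ⁴ ∖ B` by `q`. -/
structure ALEEnd (k : ℕ) (S : Hyperkahler Y) where
  ρ : ℝ
  ρ_pos : 0 < ρ
  q : C2 → Y
  localDiffeo : IsLocalDiffeomorphOn 𝓘(ℝ, C2) 𝓘(ℝ, C2) ∞ q {z | ρ < ‖z‖}
  fibres : ∀ z w : C2, ρ < ‖z‖ → ρ < ‖w‖ →
    (q z = q w ↔ ∃ γ ∈ binaryDihedral k, w = WithLp.toLp 2 (γ.mulVec z))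
  compact : ∀ ρ', ρ ≤ ρ' → IsCompact (q '' {z | ρ' < ‖z‖})ᶜ
  metric_decay : ∀ ℓ : ℕ,
    (fun z => ‖iteratedFDeriv ℝ ℓ (fun w => pullForm q S.g.inner w - euclid) z‖)
      =O[Bornology.cobounded C2] fun z => (‖z‖ ^ (4 + ℓ))⁻¹
  cs_decay : ∀ (j : Fin 3) (ℓ : ℕ),
    (fun z => ‖iteratedFDeriv ℝ ℓ (fun w => pullEnd q (S.cs j) w - stdI j) z‖)
      =O[Bornology.cobounded C2] fun z => (‖z‖ ^ (4 + ℓ))⁻¹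

end TaubNUT

end

open scoped Manifold ContDiff

noncomputable section

namespace TaubNUT

open Asymptotics Bornology Filter Topology

universe u

/-! ### Symbol classes at infinity -/

/-! Let `N = (z₁, -z₂)` and let `X` be the horizontal lift of `∂/∂y₂`. The complex-linear forms `α =
V dy₁ + iη` and `β = dy₂ + i dy₃` are dual to `N, X`, and the metric is `V⁻¹|α|² + V|β|²`
(`metric_eq_sum`). Near infinity `V` is bounded above and below, so the frame `N, I₁N, X, I₁X` is
uniformly comparable with an orthonormal one, and derivatives along it measure everything. Call a
function a symbol of weight `w` if all its iterated frame derivatives are `O(w)`. The metric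
coefficients and the coefficients of `dα`, `dβ` are symbols of weight 1, hence so are the connection
coefficients. A tensor with symbol coefficients of weight `w` therefore has covariant derivatives
`O(w)` (`TensorSymbol.covDeriv_tensor`, `TensorSymbol.tensorNorm_isBigO`).

Symbols come from closed differential systems: frame derivatives of `1/R`, `y₁/R`, `(y₂ + iy₃)/R`
are polynomials in these functions and `V⁻¹` (`symbolOrder_invR_dirY_dirC`), and `tanh(4my₁)`,
`1/cosh(4my₁)` behave likewise (`symbolOrder_tanhY_sechY`). Since `r² = 2R cosh(4my₁)(1 + (y₁/R)
tanh(4my₁))` and the last factor is at least 1, with inverse `q`, one gets `ψ_c = -(1/8) tanh(4my₁)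
q (y₂ + iy₃)/R²`, a symbol of weight `1/R`. This is the first estimate.

For the Hessian, `θ₂ + iθ₃ = dζ` with `ζ = -½ r⁻⁴(z₁dz₂ - z₂dz₁) = i r⁻⁴(y₂ + iy₃) α + O(R⁻²)`. On
the other side `dψ_c = -r⁻⁴(y₂ + iy₃) Re α + O(R⁻²)`, because `4m/V = 2 - 1/(RV)`. Hence `I₁dψ_c - i
dψ_c`, which is `-2i∂ψ_c`, agrees with `ζ` up to `O(R⁻²)`. As `i dψ_c` is closed, applying `d` gives
the second estimate (`tensorSymbol_ddc_sub_thetaC`). Replacing `I₁` by `I₁^Y` changes the structure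
by `O(r⁻⁴)`. Frame and coframe have euclidean size `O(r)`, so the components of the change are
`O(r⁻²) = O(1/R)`, and they multiply `dψ_c = O(1/R)` (`symbol_fderiv_psiC_comp`). -/

theorem eventually_cobounded_eventually_nhds {E : Type*} [NormedAddCommGroup E]
    {p : E → Prop} (h : ∀ᶠ z in cobounded E, p z) :
    ∀ᶠ z in cobounded E, ∀ᶠ w in 𝓝 z, p w := by
  obtain ⟨r, -, hr⟩ := (hasBasis_cobounded_norm (E := E)).eventually_iff.1 h
  -- The basis sets `{r ≤ ‖z‖}` are closed; enlarging the radius by one leaves room for a whole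
  -- neighbourhood of each point.
  filter_upwards [(hasBasis_cobounded_norm (E := E)).mem_of_mem (i := r + 1) trivial] with z hz
  have hz' : r < ‖z‖ := (lt_add_one r).trans_le hz
  filter_upwards [(isOpen_lt continuous_const continuous_norm).mem_nhds hz'] with w hw
  exact hr hw.le

section Symbols

variable {ι E F G H : Type*} [NormedAddCommGroup E] [NormedSpace ℝ E]
  [NormedAddCommGroup F] [NormedSpace ℝ F] [NormedAddCommGroup G] [NormedSpace ℝ G]
  [NormedAddCommGroup H] [NormedSpace ℝ H]

/-- Smoothness on a neighbourhood of infinity. -/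
def SmoothAtInfinity (f : E → F) : Prop := ∀ᶠ z in cobounded E, ContDiffAt ℝ ∞ f z

theorem SmoothAtInfinity.congr {f g : E → F} (hf : SmoothAtInfinity f)
    (h : f =ᶠ[cobounded E] g) : SmoothAtInfinity g := by
  filter_upwards [hf, eventually_cobounded_eventually_nhds h] with z hz hfg
  exact hz.congr_of_eventuallyEq (hfg.mono fun _ hw => hw.symm)

theorem SmoothAtInfinity.differentiableAt {f : E → F} (hf : SmoothAtInfinity f) :
    ∀ᶠ z in cobounded E, DifferentiableAt ℝ f z :=
  hf.mono fun _ hz => hz.differentiableAt (by simp)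

theorem SmoothAtInfinity.fderiv {f : E → F} (hf : SmoothAtInfinity f) :
    SmoothAtInfinity (fderiv ℝ f) :=
  hf.mono fun _ hz => hz.fderiv_right (m := ∞) (by simp)

/-- The derivative of `f` along the vector field `X a`. -/
def frameDeriv (X : ι → E → E) (a : ι) (f : E → F) (z : E) : F := fderiv ℝ f z (X a z)

variable {X : ι → E → E}

theorem frameDeriv_congr {f g : E → F} (h : f =ᶠ[cobounded E] g) (a : ι) :
    frameDeriv X a f =ᶠ[cobounded E] frameDeriv X a g := by
  filter_upwards [eventually_cobounded_eventually_nhds h] with z hz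
  rw [frameDeriv, frameDeriv, EventuallyEq.fderiv_eq hz]

/-- `f` and its derivatives up to order `n` along the fields `X a` are smooth near infinity and
`O(w)`. -/
def SymbolOrder (X : ι → E → E) (w : E → ℝ) : ℕ → (E → F) → Prop
  | 0, f => SmoothAtInfinity f ∧ f =O[cobounded E] w
  | n + 1, f => (SmoothAtInfinity f ∧ f =O[cobounded E] w) ∧
      ∀ a, SymbolOrder X w n (frameDeriv X a f)

namespace SymbolOrder

variable {w w₁ w₂ : E → ℝ} {n : ℕ}

theorem smooth_isBigO {f : E → F} (hf : SymbolOrder X w n f) :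
    SmoothAtInfinity f ∧ f =O[cobounded E] w := by
  cases n with
  | zero => exact hf
  | succ n => exact hf.1

theorem smooth {f : E → F} (hf : SymbolOrder X w n f) : SmoothAtInfinity f :=
  hf.smooth_isBigO.1

theorem isBigO {f : E → F} (hf : SymbolOrder X w n f) : f =O[cobounded E] w :=
  hf.smooth_isBigO.2

theorem pred {f : E → F} (hf : SymbolOrder X w (n + 1) f) : SymbolOrder X w n f := by
  induction n generalizing f with
  | zero => exact hf.1
  | succ n ih => exact ⟨hf.1, fun a => ih (hf.2 a)⟩

theorem congr {f g : E → F} (hf : SymbolOrder X w n f) (h : f =ᶠ[cobounded E] g) :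
    SymbolOrder X w n g := by
  induction n generalizing f g with
  | zero => exact ⟨hf.1.congr h, hf.2.congr' h EventuallyEq.rfl⟩
  | succ n ih =>
    exact ⟨⟨hf.1.1.congr h, hf.1.2.congr' h EventuallyEq.rfl⟩,
      fun a => ih (hf.2 a) (frameDeriv_congr h a)⟩

/-- Entry point for inductions on the order: when the frame derivatives of `f` are known expressions
in functions already controlled to order `n`, the order of `f` rises by one. Systems closed under
differentiation are treated this way. -/
theorem of_frameDeriv {f : E → F} {g : ι → E → F} (hs : SmoothAtInfinity f)
    (hO : f =O[cobounded E] w) (hg : ∀ a, SymbolOrder X w n (g a))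
    (h : ∀ a, g a =ᶠ[cobounded E] frameDeriv X a f) : SymbolOrder X w (n + 1) f :=
  ⟨⟨hs, hO⟩, fun a => (hg a).congr (h a)⟩

theorem weight {f : E → F} (hf : SymbolOrder X w₁ n f) (h : w₁ =O[cobounded E] w₂) :
    SymbolOrder X w₂ n f := by
  induction n generalizing f with
  | zero => exact ⟨hf.1, hf.2.trans h⟩
  | succ n ih => exact ⟨⟨hf.1.1, hf.1.2.trans h⟩, fun a => ih (hf.2 a)⟩

theorem add {f g : E → F} (hf : SymbolOrder X w n f) (hg : SymbolOrder X w n g) :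
    SymbolOrder X w n (fun z => f z + g z) := by
  have h0 {f g : E → F} (hf : SmoothAtInfinity f ∧ f =O[cobounded E] w)
      (hg : SmoothAtInfinity g ∧ g =O[cobounded E] w) :
      SmoothAtInfinity (fun z => f z + g z) ∧ (fun z => f z + g z) =O[cobounded E] w :=
    ⟨by filter_upwards [hf.1, hg.1] with z h1 h2 using h1.add h2, hf.2.add hg.2⟩
  induction n generalizing f g with
  | zero => exact h0 hf hg
  | succ n ih =>
    refine ⟨h0 hf.1 hg.1, fun a => (ih (hf.2 a) (hg.2 a)).congr ?_⟩
    filter_upwards [hf.smooth.differentiableAt, hg.smooth.differentiableAt] with z h1 h2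
    simp only [frameDeriv]
    rw [fderiv_fun_add h1 h2, add_apply]

theorem clm_comp (L : F →L[ℝ] G) {f : E → F} (hf : SymbolOrder X w n f) :
    SymbolOrder X w n (fun z => L (f z)) := by
  have h0 {f : E → F} (hf : SmoothAtInfinity f ∧ f =O[cobounded E] w) :
      SmoothAtInfinity (fun z => L (f z)) ∧ (fun z => L (f z)) =O[cobounded E] w :=
    ⟨by filter_upwards [hf.1] with z h1 using L.contDiff.contDiffAt.comp z h1,
      (L.isBigO_comp _ _).trans hf.2⟩
  induction n generalizing f with
  | zero => exact h0 hf
  | succ n ih =>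
    refine ⟨h0 hf.1, fun a => (ih (hf.2 a)).congr ?_⟩
    filter_upwards [hf.smooth.differentiableAt] with z h1
    have h2 := (L.hasFDerivAt.comp z h1.hasFDerivAt).fderiv
    simp only [Function.comp_def] at h2
    simp only [frameDeriv, h2, ContinuousLinearMap.comp_apply]

theorem neg {f : E → F} (hf : SymbolOrder X w n f) : SymbolOrder X w n (fun z => -f z) := by
  simpa using hf.clm_comp (-ContinuousLinearMap.id ℝ F)

theorem sub {f g : E → F} (hf : SymbolOrder X w n f) (hg : SymbolOrder X w n g) :
    SymbolOrder X w n (fun z => f z - g z) := by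
  simpa only [sub_eq_add_neg] using hf.add hg.neg

theorem zero : SymbolOrder X w n (fun _ : E => (0 : F)) := by
  have h0 : SmoothAtInfinity (fun _ : E => (0 : F)) ∧
      (fun _ : E => (0 : F)) =O[cobounded E] w :=
    ⟨Eventually.of_forall fun _ => contDiffAt_const, isBigO_zero _ _⟩
  induction n with
  | zero => exact h0
  | succ n ih =>
    refine ⟨h0, fun a => ?_⟩
    have : frameDeriv X a (fun _ : E => (0 : F)) = fun _ => 0 := by
      ext z; simp [frameDeriv]
    rwa [this]

theorem const (c : F) : SymbolOrder X (fun _ => 1) n (fun _ : E => c) := by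
  have h0 : SmoothAtInfinity (fun _ : E => c) ∧
      (fun _ : E => c) =O[cobounded E] (fun _ => (1 : ℝ)) :=
    ⟨Eventually.of_forall fun _ => contDiffAt_const, isBigO_const_const _ one_ne_zero _⟩
  cases n with
  | zero => exact h0
  | succ n =>
    refine ⟨h0, fun a => ?_⟩
    have : frameDeriv X a (fun _ : E => c) = fun _ => 0 := by
      ext z; simp [frameDeriv]
    rw [this]
    exact zero

theorem sum {κ : Type*} (s : Finset κ) {f : κ → E → F} (hf : ∀ k ∈ s, SymbolOrder X w n (f k)) :
    SymbolOrder X w n (fun z => ∑ k ∈ s, f k z) := by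
  classical
  induction s using Finset.induction_on with
  | empty => simpa using zero
  | insert k s hk ih =>
    simp only [Finset.sum_insert hk]
    exact (hf k (Finset.mem_insert_self _ _)).add
      (ih fun j hj => hf j (Finset.mem_insert_of_mem hj))

theorem bilin (L : F →L[ℝ] G →L[ℝ] H) {f : E → F} {g : E → G} (hf : SymbolOrder X w₁ n f)
    (hg : SymbolOrder X w₂ n g) :
    SymbolOrder X (fun z => w₁ z * w₂ z) n (fun z => L (f z) (g z)) := by
  have h0 {f : E → F} {g : E → G} (hf : SmoothAtInfinity f ∧ f =O[cobounded E] w₁)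
      (hg : SmoothAtInfinity g ∧ g =O[cobounded E] w₂) :
      SmoothAtInfinity (fun z => L (f z) (g z)) ∧
        (fun z => L (f z) (g z)) =O[cobounded E] (fun z => w₁ z * w₂ z) := by
    refine ⟨?_, ?_⟩
    · filter_upwards [hf.1, hg.1] with z h1 h2
      exact (L.contDiff.contDiffAt.comp z h1).clm_apply h2
    · refine IsBigO.trans ?_ (hf.2.norm_left.mul hg.2.norm_left)
      refine IsBigO.of_bound ‖L‖ (Eventually.of_forall fun z => ?_)
      simpa [mul_assoc] using L.le_opNorm₂ (f z) (g z)
  induction n generalizing f g with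
  | zero => exact h0 hf hg
  | succ n ih =>
    refine ⟨h0 hf.1 hg.1, fun a => ((ih (hf.2 a) hg.pred).add (ih hf.pred (hg.2 a))).congr ?_⟩
    filter_upwards [hf.smooth.differentiableAt, hg.smooth.differentiableAt] with z h1 h2
    simp only [frameDeriv]
    rw [(L.hasFDerivAt_of_bilinear h1.hasFDerivAt h2.hasFDerivAt).fderiv]
    simp [add_comm]

theorem smul {f : E → ℝ} {g : E → F} (hf : SymbolOrder X w₁ n f) (hg : SymbolOrder X w₂ n g) :
    SymbolOrder X (fun z => w₁ z * w₂ z) n (fun z => f z • g z) := by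
  simpa using bilin (ContinuousLinearMap.lsmul ℝ ℝ) hf hg

theorem mul {A : Type*} [NormedRing A] [NormedAlgebra ℝ A] {f g : E → A}
    (hf : SymbolOrder X w₁ n f) (hg : SymbolOrder X w₂ n g) :
    SymbolOrder X (fun z => w₁ z * w₂ z) n (fun z => f z * g z) := by
  simpa using bilin (ContinuousLinearMap.mul ℝ A) hf hg

theorem smul_left {f : E → ℝ} {g : E → F} (hf : SymbolOrder X (fun _ => 1) n f)
    (hg : SymbolOrder X w n g) : SymbolOrder X w n (fun z => f z • g z) := by
  simpa using hf.smul hg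

theorem mul_left {A : Type*} [NormedRing A] [NormedAlgebra ℝ A] {f g : E → A}
    (hf : SymbolOrder X (fun _ => 1) n f) (hg : SymbolOrder X w n g) :
    SymbolOrder X w n (fun z => f z * g z) := by
  simpa using hf.mul hg

theorem const_mul {A : Type*} [NormedRing A] [NormedAlgebra ℝ A] (c : A) {f : E → A}
    (hf : SymbolOrder X w n f) : SymbolOrder X w n (fun z => c * f z) :=
  (const c).mul_left hf

/-- The derivative `-f⁻² df` involves `f⁻¹` only to the order already reached, so the induction
closes; the uniform lower bound keeps `f⁻¹` bounded. -/
theorem inv {f : E → ℝ} (hf : SymbolOrder X (fun _ => 1) n f) {c : ℝ} (hc : 0 < c)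
    (h : ∀ᶠ z in cobounded E, c ≤ f z) : SymbolOrder X (fun _ => 1) n (fun z => (f z)⁻¹) := by
  have hs : SmoothAtInfinity (fun z => (f z)⁻¹) := by
    filter_upwards [hf.smooth, h] with z h1 h2
    exact h1.inv (hc.trans_le h2).ne'
  have hO : (fun z => (f z)⁻¹) =O[cobounded E] (fun _ => (1 : ℝ)) := by
    refine IsBigO.of_bound c⁻¹ ?_
    filter_upwards [h] with z hz
    rw [norm_inv, Real.norm_of_nonneg (hc.le.trans hz)]
    simpa using inv_anti₀ hc hz
  induction n with
  | zero => exact ⟨hs, hO⟩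
  | succ n ih =>
    refine of_frameDeriv hs hO
      (fun a => ((ih hf.pred).mul_left ((ih hf.pred).mul_left (hf.2 a))).neg) fun a => ?_
    filter_upwards [hf.smooth.differentiableAt, h] with z h1 h2
    simp only [frameDeriv]
    have h0 := (hc.trans_le h2).ne'
    have h3 := ((hasDerivAt_inv h0).comp_hasFDerivAt z h1.hasFDerivAt).fderiv
    simp only [Function.comp_def] at h3
    rw [h3]
    simp only [smul_apply, smul_eq_mul]
    field_simp

end SymbolOrder

/-- Smooth functions all of whose iterated derivatives along the fields `X a` are `O(w)` at
infinity. -/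
def Symbol (X : ι → E → E) (w : E → ℝ) (f : E → F) : Prop := ∀ n, SymbolOrder X w n f

namespace Symbol

variable {w w₁ w₂ : E → ℝ}

theorem smooth {f : E → F} (hf : Symbol X w f) : SmoothAtInfinity f := (hf 0).smooth

theorem isBigO {f : E → F} (hf : Symbol X w f) : f =O[cobounded E] w := (hf 0).isBigO

theorem frameDeriv {f : E → F} (hf : Symbol X w f) (a : ι) :
    Symbol X w (frameDeriv X a f) := fun n => (hf (n + 1)).2 a

theorem congr {f g : E → F} (hf : Symbol X w f) (h : f =ᶠ[cobounded E] g) : Symbol X w g :=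
  fun n => (hf n).congr h

theorem weight {f : E → F} (hf : Symbol X w₁ f) (h : w₁ =O[cobounded E] w₂) :
    Symbol X w₂ f := fun n => (hf n).weight h

theorem zero : Symbol X w (fun _ : E => (0 : F)) := fun _ => SymbolOrder.zero

theorem const (c : F) : Symbol X (fun _ => 1) (fun _ : E => c) := fun _ => SymbolOrder.const c

theorem add {f g : E → F} (hf : Symbol X w f) (hg : Symbol X w g) :
    Symbol X w (fun z => f z + g z) := fun n => (hf n).add (hg n)

theorem neg {f : E → F} (hf : Symbol X w f) : Symbol X w (fun z => -f z) := fun n => (hf n).neg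

theorem sub {f g : E → F} (hf : Symbol X w f) (hg : Symbol X w g) :
    Symbol X w (fun z => f z - g z) := fun n => (hf n).sub (hg n)

theorem sum {κ : Type*} (s : Finset κ) {f : κ → E → F} (hf : ∀ k ∈ s, Symbol X w (f k)) :
    Symbol X w (fun z => ∑ k ∈ s, f k z) :=
  fun n => SymbolOrder.sum s fun k hk => hf k hk n

theorem clm_comp (L : F →L[ℝ] G) {f : E → F} (hf : Symbol X w f) :
    Symbol X w (fun z => L (f z)) := fun n => (hf n).clm_comp L

theorem bilin (L : F →L[ℝ] G →L[ℝ] H) {f : E → F} {g : E → G} (hf : Symbol X w₁ f)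
    (hg : Symbol X w₂ g) : Symbol X (fun z => w₁ z * w₂ z) (fun z => L (f z) (g z)) :=
  fun n => (hf n).bilin L (hg n)

theorem smul {f : E → ℝ} {g : E → F} (hf : Symbol X w₁ f) (hg : Symbol X w₂ g) :
    Symbol X (fun z => w₁ z * w₂ z) (fun z => f z • g z) := fun n => (hf n).smul (hg n)

theorem smul_left {f : E → ℝ} {g : E → F} (hf : Symbol X (fun _ => 1) f) (hg : Symbol X w g) :
    Symbol X w (fun z => f z • g z) := fun n => (hf n).smul_left (hg n)

theorem mul {A : Type*} [NormedRing A] [NormedAlgebra ℝ A] {f g : E → A} (hf : Symbol X w₁ f)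
    (hg : Symbol X w₂ g) : Symbol X (fun z => w₁ z * w₂ z) (fun z => f z * g z) :=
  fun n => (hf n).mul (hg n)

theorem mul_left {A : Type*} [NormedRing A] [NormedAlgebra ℝ A] {f g : E → A}
    (hf : Symbol X (fun _ => 1) f) (hg : Symbol X w g) : Symbol X w (fun z => f z * g z) :=
  fun n => (hf n).mul_left (hg n)

theorem const_mul {A : Type*} [NormedRing A] [NormedAlgebra ℝ A] (c : A) {f : E → A}
    (hf : Symbol X w f) : Symbol X w (fun z => c * f z) := (const c).mul_left hf

theorem inv {f : E → ℝ} (hf : Symbol X (fun _ => 1) f) {c : ℝ} (hc : 0 < c)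
    (h : ∀ᶠ z in cobounded E, c ≤ f z) : Symbol X (fun _ => 1) (fun z => (f z)⁻¹) :=
  fun n => (hf n).inv hc h

end Symbol

end Symbols

/-- A function whose euclidean derivatives gain a power of `r` each is a symbol for every frame
of size `O(r)`. -/
theorem Symbol.of_iteratedFDeriv {ι : Type*} {E F : Type u} [NormedAddCommGroup E]
    [NormedSpace ℝ E] [NormedAddCommGroup F] [NormedSpace ℝ F] {X : ι → E → E}
    (hX : ∀ a, Symbol X (fun z => ‖z‖) (X a)) {f : E → F} (k : ℕ)
    (hs : SmoothAtInfinity f)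
    (hd : ∀ l : ℕ, (fun z => ‖iteratedFDeriv ℝ l f z‖) =O[cobounded E]
      fun z => (‖z‖ ^ (k + l))⁻¹) :
    Symbol X (fun z => (‖z‖ ^ k)⁻¹) f := by
  have hO : ∀ {F : Type u} [NormedAddCommGroup F] [NormedSpace ℝ F] {f : E → F} (k : ℕ),
      (∀ l : ℕ, (fun z => ‖iteratedFDeriv ℝ l f z‖) =O[cobounded E]
        fun z => (‖z‖ ^ (k + l))⁻¹) → f =O[cobounded E] fun z => (‖z‖ ^ k)⁻¹ := by
    intro F _ _ f k hd
    simpa using hd 0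
  intro n
  -- The step replaces `f` by `fderiv ℝ f`, which takes values in `E →L[ℝ] F` and decays one power
  -- faster; both `F` and `k` must vary, and a common universe for `E` and `F` makes this possible.
  induction n generalizing F k with
  | zero => exact ⟨hs, hO k hd⟩
  | succ n ih =>
    refine ⟨⟨hs, hO k hd⟩, fun a => ?_⟩
    have h1 : SymbolOrder X (fun z => (‖z‖ ^ (k + 1))⁻¹) n (fderiv ℝ f) := by
      refine ih (k + 1) hs.fderiv fun l => ?_
      have := hd (l + 1)
      simpa only [norm_iteratedFDeriv_fderiv, show k + 1 + l = k + (l + 1) by ring] using this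
    -- The power of `r` gained by differentiating is spent on the size `O(r)` of the frame field, so
    -- the weight is unchanged.
    have h2 := h1.bilin (ContinuousLinearMap.id ℝ (E →L[ℝ] F)) (hX a n)
    refine h2.weight (IsBigO.of_bound 1 (Eventually.of_forall fun z => ?_))
    rcases eq_or_ne ‖z‖ 0 with h | h
    · simp [h]
    · rw [pow_succ, mul_inv, mul_assoc, inv_mul_cancel₀ h]
      simp

/-! ### The functions `y₁` and `R` -/

/-- The complex coordinates as real linear maps. -/
def coord (i : Fin 2) : C2 →L[ℝ] ℂ :=
  (EuclideanSpace.proj i : C2 →L[ℂ] ℂ).restrictScalars ℝ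

@[simp]
theorem coord_apply (i : Fin 2) (z : C2) : coord i z = z i := rfl

variable {m : ℝ}

theorem uv_fst_sq (hm : 0 < m) (z : C2) :
    (uv m z).1 ^ 2 = Real.exp (-(4 * m * y₁ m z)) * ‖z 0‖ ^ 2 := by
  rw [(isUV_uv hm z).2.2.1, mul_pow, ← mul_assoc, ← Real.exp_nat_mul, ← Real.exp_add, y₁]
  rw [show -(4 * m * (((uv m z).1 ^ 2 - (uv m z).2 ^ 2) / 2))
    + (2 : ℕ) * (m * ((uv m z).1 ^ 2 - (uv m z).2 ^ 2)) = 0 by push_cast; ring]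
  simp

theorem uv_snd_sq (hm : 0 < m) (z : C2) :
    (uv m z).2 ^ 2 = Real.exp (4 * m * y₁ m z) * ‖z 1‖ ^ 2 := by
  rw [(isUV_uv hm z).2.2.2, mul_pow, ← mul_assoc, ← Real.exp_nat_mul, ← Real.exp_add, y₁]
  rw [show 4 * m * (((uv m z).1 ^ 2 - (uv m z).2 ^ 2) / 2)
    + (2 : ℕ) * (m * ((uv m z).2 ^ 2 - (uv m z).1 ^ 2)) = 0 by push_cast; ring]
  simp

theorem two_mul_y₁ (hm : 0 < m) (z : C2) :
    2 * y₁ m z = Real.exp (-(4 * m * y₁ m z)) * ‖z 0‖ ^ 2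
      - Real.exp (4 * m * y₁ m z) * ‖z 1‖ ^ 2 := by
  rw [← uv_fst_sq hm, ← uv_snd_sq hm, y₁]; ring

theorem two_mul_R (hm : 0 < m) (z : C2) :
    2 * R m z = Real.exp (-(4 * m * y₁ m z)) * ‖z 0‖ ^ 2
      + Real.exp (4 * m * y₁ m z) * ‖z 1‖ ^ 2 := by
  rw [← uv_fst_sq hm, ← uv_snd_sq hm, R]; ring

/-- The left side is strictly increasing in `t`. This uniqueness identifies the implicit function
with `y₁` in `contDiff_y₁`. -/
theorem eq_y₁_of_eq (hm : 0 < m) {z : C2} {t : ℝ}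
    (ht : 2 * t - Real.exp (-(4 * m * t)) * ‖z 0‖ ^ 2 + Real.exp (4 * m * t) * ‖z 1‖ ^ 2 = 0) :
    t = y₁ m z := by
  have hF : StrictMono fun t : ℝ =>
      2 * t - Real.exp (-(4 * m * t)) * ‖z 0‖ ^ 2 + Real.exp (4 * m * t) * ‖z 1‖ ^ 2 := by
    intro s t hst
    have h0 : 4 * m * s ≤ 4 * m * t := by nlinarith
    have h1 : Real.exp (-(4 * m * t)) * ‖z 0‖ ^ 2 ≤ Real.exp (-(4 * m * s)) * ‖z 0‖ ^ 2 := by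
      gcongr
    have h2 : Real.exp (4 * m * s) * ‖z 1‖ ^ 2 ≤ Real.exp (4 * m * t) * ‖z 1‖ ^ 2 := by
      gcongr
    simp only
    linarith
  apply hF.injective
  simp only [ht]
  linarith [two_mul_y₁ hm z]

theorem contDiff_norm_coord_sq (i : Fin 2) : ContDiff ℝ ∞ fun z : C2 => ‖z i‖ ^ 2 :=
  (contDiff_norm_sq ℝ).comp (coord i).contDiff

/-- Implicit function theorem for the equation `two_mul_y₁`: its derivative in `t` is at least 2
everywhere, so smoothness holds even at the origin. -/
theorem contDiff_y₁ (hm : 0 < m) : ContDiff ℝ ∞ (y₁ m) := by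
  rw [contDiff_iff_contDiffAt]
  intro z₀
  let f : C2 × ℝ → ℝ := fun p =>
    2 * p.2 - Real.exp (-(4 * m * p.2)) * ‖p.1 0‖ ^ 2 + Real.exp (4 * m * p.2) * ‖p.1 1‖ ^ 2
  have h0 := (contDiff_norm_coord_sq 0).comp (contDiff_fst (𝕜 := ℝ) (E := C2) (F := ℝ))
  have h1 := (contDiff_norm_coord_sq 1).comp (contDiff_fst (𝕜 := ℝ) (E := C2) (F := ℝ))
  simp only [Function.comp_def] at h0 h1
  have hf : ContDiff ℝ ∞ f :=
    ((contDiff_const.mul contDiff_snd).sub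
      ((Real.contDiff_exp.comp (contDiff_const.mul contDiff_snd).neg).mul h0)).add
      ((Real.contDiff_exp.comp (contDiff_const.mul contDiff_snd)).mul h1)
  set u : C2 × ℝ := (z₀, y₁ m z₀) with hu
  have cdf : ContDiffAt ℝ ∞ f u := hf.contDiffAt
  have hfu : f u = 0 := by
    simp only [f, hu]
    linarith [two_mul_y₁ hm z₀]
  set L := fderiv ℝ f u ∘L .inr ℝ C2 ℝ with hL
  have hL1 : HasDerivAt (fun t => f (z₀, t)) (L 1) (y₁ m z₀) := by
    have h := (cdf.differentiableAt (by simp)).hasFDerivAt.comp (y₁ m z₀)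
      ((hasFDerivAt_const z₀ (y₁ m z₀)).prodMk (hasFDerivAt_id _))
    have h' := h.hasDerivAt
    simp only [ContinuousLinearMap.comp_apply, ContinuousLinearMap.prod_apply,
      zero_apply, ContinuousLinearMap.id_apply] at h'
    exact h'
  have hL2 : HasDerivAt (fun t => f (z₀, t))
      (2 + 4 * m * Real.exp (-(4 * m * y₁ m z₀)) * ‖z₀ 0‖ ^ 2
        + 4 * m * Real.exp (4 * m * y₁ m z₀) * ‖z₀ 1‖ ^ 2) (y₁ m z₀) := by
    have ha := (hasDerivAt_id (y₁ m z₀)).const_mul (4 * m)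
    have := (((hasDerivAt_id (y₁ m z₀)).const_mul 2).sub (ha.neg.exp.mul_const (‖z₀ 0‖ ^ 2))).add
      (ha.exp.mul_const (‖z₀ 1‖ ^ 2))
    refine this.congr_deriv ?_
    simp
    ring
  have hpos : 0 < L 1 := by
    rw [hL1.unique hL2]
    positivity
  have hinv : L.IsInvertible := by
    refine ⟨ContinuousLinearEquiv.unitsEquivAut ℝ (Units.mk0 (L 1) hpos.ne'), ?_⟩
    ext
    simp
  refine (cdf.contDiffAt_implicitFunction (by simp) hinv).congr_of_eventuallyEq ?_
  filter_upwards [cdf.eventually_apply_implicitFunction (by simp) hinv] with z hz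
  rw [hfu] at hz
  exact (eq_y₁_of_eq hm hz).symm

theorem R_eq (hm : 0 < m) : R m = fun z => (Real.exp (-(4 * m * y₁ m z)) * ‖z 0‖ ^ 2
      + Real.exp (4 * m * y₁ m z) * ‖z 1‖ ^ 2) / 2 := by
  funext z
  linarith [two_mul_R hm z]

theorem contDiff_R (hm : 0 < m) : ContDiff ℝ ∞ (R m) := by
  rw [R_eq hm]
  have h := contDiff_y₁ hm
  exact (((Real.contDiff_exp.comp (contDiff_const.mul h).neg).mul (contDiff_norm_coord_sq 0)).add
    ((Real.contDiff_exp.comp (contDiff_const.mul h)).mul (contDiff_norm_coord_sq 1))).div_const 2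

theorem norm_sq_eq (z : C2) : ‖z‖ ^ 2 = ‖z 0‖ ^ 2 + ‖z 1‖ ^ 2 := by
  rw [EuclideanSpace.norm_sq_eq, Fin.sum_univ_two]

theorem R_pos (hm : 0 < m) {z : C2} (hz : z ≠ 0) : 0 < R m z := by
  have h : 0 < ‖z 0‖ ^ 2 + ‖z 1‖ ^ 2 := by
    rw [← norm_sq_eq]
    positivity
  have h1 := Real.exp_pos (-(4 * m * y₁ m z))
  have h2 := Real.exp_pos (4 * m * y₁ m z)
  have := two_mul_R hm z
  rcases (sq_nonneg ‖z 0‖).eq_or_lt with h0 | h0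
  · have : 0 < ‖z 1‖ ^ 2 := by linarith
    nlinarith [mul_pos h2 this, mul_nonneg h1.le (sq_nonneg ‖z 0‖)]
  · nlinarith [mul_pos h1 h0, mul_nonneg h2.le (sq_nonneg ‖z 1‖)]

theorem exp_neg_mul_norm_sq (hm : 0 < m) (z : C2) :
    Real.exp (-(4 * m * y₁ m z)) * ‖z 0‖ ^ 2 = R m z + y₁ m z := by
  linarith [two_mul_R hm z, two_mul_y₁ hm z]

theorem exp_mul_norm_sq (hm : 0 < m) (z : C2) :
    Real.exp (4 * m * y₁ m z) * ‖z 1‖ ^ 2 = R m z - y₁ m z := by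
  linarith [two_mul_R hm z, two_mul_y₁ hm z]

theorem norm_sq_coord_zero (hm : 0 < m) (z : C2) :
    ‖z 0‖ ^ 2 = Real.exp (4 * m * y₁ m z) * (R m z + y₁ m z) := by
  rw [← exp_neg_mul_norm_sq hm, ← mul_assoc, ← Real.exp_add]
  simp

theorem norm_sq_coord_one (hm : 0 < m) (z : C2) :
    ‖z 1‖ ^ 2 = Real.exp (-(4 * m * y₁ m z)) * (R m z - y₁ m z) := by
  rw [← exp_mul_norm_sq hm, ← mul_assoc, ← Real.exp_add]
  simp

theorem R_nonneg (z : C2) : 0 ≤ R m z := by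
  rw [R]; positivity

theorem abs_y₁_le_R (z : C2) : |y₁ m z| ≤ R m z := by
  rw [abs_le, y₁, R]
  constructor <;> nlinarith [sq_nonneg (uv m z).1, sq_nonneg (uv m z).2]

/-- The exponentials cancel in the product of `|z₁|² = e^{4my₁}(R + y₁)` and `|z₂|² = e^{-4my₁}(R -
y₁)`. It gives both the bound on `|y₂ + iy₃|` and a derivative of `R` free of exponentials. -/
theorem R_sq (hm : 0 < m) (z : C2) : R m z ^ 2 = y₁ m z ^ 2 + ‖yC z‖ ^ 2 := by
  have h : ‖yC z‖ ^ 2 = ‖z 0‖ ^ 2 * ‖z 1‖ ^ 2 := by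
    simp [yC, mul_pow]
  have h1 : Real.exp (4 * m * y₁ m z) * Real.exp (-(4 * m * y₁ m z)) = 1 := by
    rw [← Real.exp_add]; simp
  rw [h, norm_sq_coord_zero hm, norm_sq_coord_one hm]
  linear_combination (-(R m z ^ 2 - y₁ m z ^ 2)) * h1

theorem norm_yC_le_R (hm : 0 < m) (z : C2) : ‖yC z‖ ≤ R m z :=
  abs_le_of_sq_le_sq' (by nlinarith [R_sq hm z, sq_nonneg (y₁ m z)]) (R_nonneg z) |>.2

/-- All comparison between euclidean and Taub-NUT size rests on this: `r²` can be exponentially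
large in `R`, but is never below `2R`, since `y₁ sinh(4my₁) ≥ 0`. -/
theorem norm_sq_eq_cosh_sinh (hm : 0 < m) (z : C2) :
    ‖z‖ ^ 2 = 2 * (R m z * Real.cosh (4 * m * y₁ m z) + y₁ m z * Real.sinh (4 * m * y₁ m z)) := by
  rw [norm_sq_eq, norm_sq_coord_zero hm, norm_sq_coord_one hm, Real.cosh_eq, Real.sinh_eq]
  ring

theorem mul_sinh_nonneg (hm : 0 < m) (t : ℝ) : 0 ≤ t * Real.sinh (4 * m * t) := by
  rcases le_total 0 t with h | h
  · exact mul_nonneg h (Real.sinh_nonneg_iff.2 (by positivity))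
  · exact mul_nonneg_of_nonpos_of_nonpos h (Real.sinh_nonpos_iff.2 (by nlinarith))

theorem two_mul_R_le_norm_sq (hm : 0 < m) (z : C2) : 2 * R m z ≤ ‖z‖ ^ 2 := by
  rw [norm_sq_eq_cosh_sinh hm]
  nlinarith [mul_sinh_nonneg hm (y₁ m z), Real.one_le_cosh (4 * m * y₁ m z),
    R_nonneg (m := m) z]

/-- If `R < 1` then `|y₁| < 1`, and the coordinate formulas confine `z` to a bounded set. -/
theorem eventually_one_le_R (hm : 0 < m) : ∀ᶠ z in cobounded C2, 1 ≤ R m z := by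
  -- `R < 1` forces `r² ≤ 4e^{4m}`, which contradicts `r ≥ 4e^{4m} + 1`.
  have h : ∀ᶠ z in cobounded C2, 4 * Real.exp (4 * m) + 1 ≤ ‖z‖ :=
    tendsto_norm_cobounded_atTop.eventually_ge_atTop _
  filter_upwards [h] with z hz
  by_contra! hR
  have h1 := abs_le.1 ((abs_y₁_le_R (m := m) z).trans hR.le)
  have h2 := abs_le.1 (abs_y₁_le_R (m := m) z)
  have e0 := Real.exp_pos (4 * m)
  have e1 : Real.exp (4 * m * y₁ m z) ≤ Real.exp (4 * m) := Real.exp_le_exp.2 (by nlinarith)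
  have e2 : Real.exp (-(4 * m * y₁ m z)) ≤ Real.exp (4 * m) := Real.exp_le_exp.2 (by nlinarith)
  have h3 : ‖z 0‖ ^ 2 ≤ Real.exp (4 * m) * 2 := by
    rw [norm_sq_coord_zero hm]
    exact mul_le_mul e1 (by linarith) (by linarith) e0.le
  have h4 : ‖z 1‖ ^ 2 ≤ Real.exp (4 * m) * 2 := by
    rw [norm_sq_coord_one hm]
    exact mul_le_mul e2 (by linarith) (by linarith) e0.le
  have h5 := norm_sq_eq z
  nlinarith

theorem eventually_ne_zero : ∀ᶠ z in cobounded C2, z ≠ 0 := by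
  filter_upwards [tendsto_norm_cobounded_atTop.eventually_gt_atTop (0 : ℝ)] with z hz
  exact norm_pos_iff.1 hz

/-! ### The frame and its dual coframe -/

/-- The complex symplectic form `dz₁ ∧ dz₂`. -/
def symp : C2 →L[ℝ] C2 →L[ℝ] ℂ :=
  (ContinuousLinearMap.mul ℝ ℂ).bilinearComp (coord 0) (coord 1)
    - (ContinuousLinearMap.mul ℝ ℂ).bilinearComp (coord 1) (coord 0)

@[simp]
theorem symp_apply (Z W : C2) : symp Z W = Z 0 * W 1 - Z 1 * W 0 := rfl

/-- The linear vector field `(z₁, -z₂)`. -/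
def axial : C2 →L[ℝ] C2 :=
  LinearMap.toContinuousLinearMap
    { toFun := fun z => !₂[z 0, -z 1]
      map_add' := by
        intro x y; ext i; fin_cases i <;> simp; ring
      map_smul' := by
        intro c x; ext i; fin_cases i <;> simp }

@[simp]
theorem axial_zero (z : C2) : axial z 0 = z 0 := rfl

@[simp]
theorem axial_one (z : C2) : axial z 1 = -z 1 := rfl

/-- `z ↦ (i conj z₂, 0)`. -/
def conjSwapFst : C2 →L[ℝ] C2 :=
  LinearMap.toContinuousLinearMap
    { toFun := fun z => !₂[Complex.I * starRingEnd ℂ (z 1), 0]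
      map_add' := by
        intro x y; ext i; fin_cases i <;> simp; ring
      map_smul' := by
        intro c x; ext i; fin_cases i <;> simp; ring }

/-- `z ↦ (0, i conj z₁)`. -/
def conjSwapSnd : C2 →L[ℝ] C2 :=
  LinearMap.toContinuousLinearMap
    { toFun := fun z => !₂[0, Complex.I * starRingEnd ℂ (z 0)]
      map_add' := by
        intro x y; ext i; fin_cases i <;> simp; ring
      map_smul' := by
        intro c x; ext i; fin_cases i <;> simp; ring }

@[simp]
theorem conjSwapFst_zero (z : C2) : conjSwapFst z 0 = Complex.I * starRingEnd ℂ (z 1) := rfl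

@[simp]
theorem conjSwapFst_one (z : C2) : conjSwapFst z 1 = 0 := rfl

@[simp]
theorem conjSwapSnd_zero (z : C2) : conjSwapSnd z 0 = 0 := rfl

@[simp]
theorem conjSwapSnd_one (z : C2) : conjSwapSnd z 1 = Complex.I * starRingEnd ℂ (z 0) := rfl

/-- Multiplication by `i`. -/
theorem stdI_zero_apply (z : C2) : stdI 0 z = Complex.I • z := by
  ext i
  fin_cases i <;> rfl

/-- The horizontal lift `(i / 2R) (e^{4my₁} conj z₂, e^{-4my₁} conj z₁)` of `∂/∂y₂`. -/
def horiz (m : ℝ) (z : C2) : C2 :=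
  (2 * R m z)⁻¹ • (Real.exp (4 * m * y₁ m z) • conjSwapFst z
    + Real.exp (-(4 * m * y₁ m z)) • conjSwapSnd z)

theorem horiz_zero (m : ℝ) (z : C2) :
    horiz m z 0 = (2 * R m z : ℂ)⁻¹ * (Real.exp (4 * m * y₁ m z) *
      (Complex.I * starRingEnd ℂ (z 1))) := by
  simp [horiz]

theorem horiz_one (m : ℝ) (z : C2) :
    horiz m z 1 = (2 * R m z : ℂ)⁻¹ * (Real.exp (-(4 * m * y₁ m z)) *
      (Complex.I * starRingEnd ℂ (z 0))) := by
  simp [horiz]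

/-- The frame `N = (z₁, -z₂)`, `I₁ N`, `X = horiz`, `I₁ X`. -/
def frame (m : ℝ) : Fin 4 → C2 → C2 :=
  ![fun z => axial z, fun z => stdI 0 (axial z), fun z => horiz m z, fun z => stdI 0 (horiz m z)]

/-- The `(1,0)`-form `α = V dy₁ + i η`. -/
def alpha (m : ℝ) (z : C2) : C2 →L[ℝ] ℂ := Complex.I • symp (horiz m z)

/-- The `(1,0)`-form `β = dy₂ + i dy₃`. -/
def beta (z : C2) : C2 →L[ℝ] ℂ := -Complex.I • symp (axial z)

/-- The coframe dual to `frame`. -/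
def coframe (m : ℝ) : Fin 4 → C2 → C2 →L[ℝ] ℝ :=
  ![fun z => Complex.reCLM ∘L alpha m z, fun z => Complex.imCLM ∘L alpha m z,
    fun z => Complex.reCLM ∘L beta z, fun z => Complex.imCLM ∘L beta z]

theorem contDiffAt_inv_two_R (hm : 0 < m) {z : C2} (hz : z ≠ 0) :
    ContDiffAt ℝ ∞ (fun w => (2 * R m w)⁻¹) z :=
  (contDiffAt_const.mul (contDiff_R hm).contDiffAt).inv (by have := R_pos hm hz; positivity)

theorem contDiffAt_horiz (hm : 0 < m) {z : C2} (hz : z ≠ 0) : ContDiffAt ℝ ∞ (horiz m) z := by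
  have h := (contDiff_y₁ hm).contDiffAt (x := z)
  exact (contDiffAt_inv_two_R hm hz).smul
    (((Real.contDiff_exp.contDiffAt.comp z (contDiffAt_const.mul h)).smul
      conjSwapFst.contDiff.contDiffAt).add
    ((Real.contDiff_exp.contDiffAt.comp z (contDiffAt_const.mul h).neg).smul
      conjSwapSnd.contDiff.contDiffAt))

theorem contDiffAt_alpha (hm : 0 < m) {z : C2} (hz : z ≠ 0) : ContDiffAt ℝ ∞ (alpha m) z :=
  (symp.contDiff.contDiffAt.comp z (contDiffAt_horiz hm hz)).const_smul _

theorem contDiff_beta : ContDiff ℝ ∞ beta :=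
  (symp.comp axial).contDiff.const_smul (-Complex.I)

theorem contDiffAt_coframe (hm : 0 < m) {z : C2} (hz : z ≠ 0) (a : Fin 4) :
    ContDiffAt ℝ ∞ (coframe m a) z := by
  fin_cases a
  · exact contDiffAt_const.clm_comp (contDiffAt_alpha hm hz)
  · exact contDiffAt_const.clm_comp (contDiffAt_alpha hm hz)
  · exact contDiffAt_const.clm_comp contDiff_beta.contDiffAt
  · exact contDiffAt_const.clm_comp contDiff_beta.contDiffAt

theorem alpha_apply (m : ℝ) (z Z : C2) :
    alpha m z Z = (2 * R m z : ℂ)⁻¹ * (Real.exp (-(4 * m * y₁ m z)) * (starRingEnd ℂ (z 0) * Z 0)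
      - Real.exp (4 * m * y₁ m z) * (starRingEnd ℂ (z 1) * Z 1)) := by
  have : alpha m z Z = Complex.I * symp (horiz m z) Z := rfl
  rw [this, symp_apply, horiz_zero, horiz_one]
  linear_combination (2 * R m z : ℂ)⁻¹ * (Real.exp (4 * m * y₁ m z) * (starRingEnd ℂ (z 1) * Z 1)
    - Real.exp (-(4 * m * y₁ m z)) * (starRingEnd ℂ (z 0) * Z 0)) * Complex.I_sq

theorem beta_apply (z Z : C2) : beta z Z = -Complex.I * (z 0 * Z 1 + z 1 * Z 0) := by
  have : beta z Z = -Complex.I * symp (axial z) Z := rfl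
  rw [this, symp_apply, axial_zero, axial_one]
  ring

theorem exp_neg_mul_conj (hm : 0 < m) (z : C2) :
    (Real.exp (-(4 * m * y₁ m z)) : ℂ) * (starRingEnd ℂ (z 0) * z 0) = R m z + y₁ m z := by
  rw [← Complex.normSq_eq_conj_mul_self, Complex.normSq_eq_norm_sq]
  exact_mod_cast exp_neg_mul_norm_sq hm z

theorem exp_mul_conj (hm : 0 < m) (z : C2) :
    (Real.exp (4 * m * y₁ m z) : ℂ) * (starRingEnd ℂ (z 1) * z 1) = R m z - y₁ m z := by
  rw [← Complex.normSq_eq_conj_mul_self, Complex.normSq_eq_norm_sq]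
  exact_mod_cast exp_mul_norm_sq hm z

theorem exp_mul_exp_neg (m : ℝ) (z : C2) :
    (Real.exp (4 * m * y₁ m z) : ℂ) * Real.exp (-(4 * m * y₁ m z)) = 1 := by
  rw [← Complex.ofReal_mul, ← Real.exp_add]
  simp

theorem ofReal_R_ne_zero (hm : 0 < m) {z : C2} (hz : z ≠ 0) : (R m z : ℂ) ≠ 0 :=
  Complex.ofReal_ne_zero.2 (R_pos hm hz).ne'

theorem alpha_axial (hm : 0 < m) {z : C2} (hz : z ≠ 0) : alpha m z (axial z) = 1 := by
  have hR := ofReal_R_ne_zero hm hz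
  rw [alpha_apply, axial_zero, axial_one]
  field_simp
  linear_combination exp_neg_mul_conj hm z + exp_mul_conj hm z

theorem alpha_horiz (m : ℝ) (z : C2) : alpha m z (horiz m z) = 0 := by
  have : alpha m z (horiz m z) = Complex.I * symp (horiz m z) (horiz m z) := rfl
  rw [this, symp_apply]
  ring

theorem beta_axial (z : C2) : beta z (axial z) = 0 := by
  rw [beta_apply, axial_zero, axial_one]
  ring

theorem beta_horiz (hm : 0 < m) {z : C2} (hz : z ≠ 0) : beta z (horiz m z) = 1 := by
  have hR := ofReal_R_ne_zero hm hz
  rw [beta_apply, horiz_zero, horiz_one]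
  field_simp
  linear_combination exp_neg_mul_conj hm z + exp_mul_conj hm z -
    ((Real.exp (-(4 * m * y₁ m z)) : ℂ) * (starRingEnd ℂ (z 0) * z 0)
    + (Real.exp (4 * m * y₁ m z) : ℂ) * (starRingEnd ℂ (z 1) * z 1)) * Complex.I_sq

theorem alpha_I (m : ℝ) (z Z : C2) : alpha m z (stdI 0 Z) = Complex.I * alpha m z Z := by
  rw [alpha_apply, alpha_apply, stdI_zero_apply]
  simp only [PiLp.smul_apply, smul_eq_mul]
  ring

theorem beta_I (z Z : C2) : beta z (stdI 0 Z) = Complex.I * beta z Z := by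
  rw [beta_apply, beta_apply, stdI_zero_apply]
  simp only [PiLp.smul_apply, smul_eq_mul]
  ring

theorem alpha_frame (hm : 0 < m) {z : C2} (hz : z ≠ 0) (a : Fin 4) :
    alpha m z (frame m a z) = ![1, Complex.I, 0, 0] a := by
  fin_cases a <;> simp [frame, alpha_I, alpha_axial hm hz, alpha_horiz]

theorem beta_frame (hm : 0 < m) {z : C2} (hz : z ≠ 0) (a : Fin 4) :
    beta z (frame m a z) = ![0, 0, 1, Complex.I] a := by
  fin_cases a <;> simp [frame, beta_I, beta_axial, beta_horiz hm hz]

theorem coframe_frame (hm : 0 < m) {z : C2} (hz : z ≠ 0) (a b : Fin 4) :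
    coframe m a z (frame m b z) = if a = b then 1 else 0 := by
  have h1 := alpha_frame hm hz b
  have h2 := beta_frame hm hz b
  fin_cases a <;> simp only [coframe, Matrix.cons_val_zero, Matrix.cons_val_one, Matrix.cons_val,
    Fin.zero_eta, Fin.mk_one, Fin.reduceFinMk, ContinuousLinearMap.comp_apply, h1, h2] <;>
    fin_cases b <;> simp

/-- Both forms are complex linear, so duality is a statement about one complex basis `N, X` of `ℂ²`;
the real resolution `sum_coframe_smul_frame` follows by splitting coefficients into real and
imaginary parts. -/
theorem alpha_smul_add_beta_smul (hm : 0 < m) {z : C2} (hz : z ≠ 0) (Z : C2) :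
    alpha m z Z • axial z + beta z Z • horiz m z = Z := by
  have hR := ofReal_R_ne_zero hm hz
  have h1 := exp_neg_mul_conj hm z
  have h2 := exp_mul_conj hm z
  ext i
  fin_cases i
  · simp only [PiLp.add_apply, PiLp.smul_apply, smul_eq_mul, Fin.zero_eta, alpha_apply, beta_apply,
      horiz_zero, axial_zero]
    field_simp
    linear_combination Z 0 * (h1 + h2) - (Real.exp (4 * m * y₁ m z) : ℂ) * starRingEnd ℂ (z 1)
      * (z 0 * Z 1 + z 1 * Z 0) * Complex.I_sq
  · simp only [PiLp.add_apply, PiLp.smul_apply, smul_eq_mul, Fin.mk_one, alpha_apply, beta_apply,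
      horiz_one, axial_one]
    field_simp
    linear_combination Z 1 * (h1 + h2) - (Real.exp (-(4 * m * y₁ m z)) : ℂ)
      * starRingEnd ℂ (z 0) * (z 0 * Z 1 + z 1 * Z 0) * Complex.I_sq

theorem sum_coframe_smul_frame (hm : 0 < m) {z : C2} (hz : z ≠ 0) (Z : C2) :
    ∑ a, coframe m a z Z • frame m a z = Z := by
  conv_rhs => rw [← alpha_smul_add_beta_smul hm hz Z]
  have h : ∀ (c : ℂ) (W : C2), c • W = c.re • W + c.im • (Complex.I • W) := by
    intro c W
    ext i
    simp only [PiLp.add_apply, PiLp.smul_apply, smul_eq_mul, Complex.real_smul]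
    conv_lhs => rw [← Complex.re_add_im c]
    ring
  rw [h (alpha m z Z), h (beta z Z)]
  simp only [Fin.sum_univ_four, coframe, frame, Matrix.cons_val_zero, Matrix.cons_val_one,
    Matrix.cons_val, ContinuousLinearMap.comp_apply, Complex.reCLM_apply, Complex.imCLM_apply,
    stdI_zero_apply]
  abel

/-! ### First derivatives -/

theorem hasFDerivAt_norm_coord_sq (i : Fin 2) (z : C2) :
    HasFDerivAt (fun w : C2 => ‖w i‖ ^ 2) (2 • (innerSL ℝ (z i)).comp (coord i)) z :=
  (coord i).hasFDerivAt.norm_sq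

theorem V_eq (hm : 0 < m) {z : C2} (hz : z ≠ 0) : V m z = 2 * m + (R m z)⁻¹ / 2 := by
  have := (R_pos hm hz).ne'
  rw [V]
  field_simp
  ring

theorem V_pos (hm : 0 < m) {z : C2} (hz : z ≠ 0) : 0 < V m z := by
  have := R_pos hm hz
  rw [V]
  positivity

/-- Differentiating the implicit equation puts `dy₁` on both sides. Its collected coefficient is `2
+ 8mR = 4RV`, and the remaining terms are `4R Re α`. -/
theorem fderiv_y₁ (hm : 0 < m) {z : C2} (hz : z ≠ 0) (Z : C2) :
    fderiv ℝ (y₁ m) z Z = (V m z)⁻¹ * (alpha m z Z).re := by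
  have hR := R_pos hm hz
  have hy := ((contDiff_y₁ hm).contDiffAt (x := z)).differentiableAt (by simp) |>.hasFDerivAt
  have ha := hy.const_mul (4 * m)
  have h1 := hy.const_mul 2
  have h2 := (ha.fun_neg.exp.mul (hasFDerivAt_norm_coord_sq 0 z)).sub
    (ha.exp.mul (hasFDerivAt_norm_coord_sq 1 z))
  have h3 : (fun w => 2 * y₁ m w) = fun w => Real.exp (-(4 * m * y₁ m w)) * ‖w 0‖ ^ 2
      - Real.exp (4 * m * y₁ m w) * ‖w 1‖ ^ 2 := funext fun w => two_mul_y₁ hm w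
  rw [h3] at h1
  have h4 := congrArg (fun L : C2 →L[ℝ] ℝ => L Z) (h1.unique h2)
  simp only [smul_apply, smul_eq_mul, sub_apply,
    add_apply, neg_apply, ContinuousLinearMap.comp_apply,
    innerSL_apply_apply, coord_apply, Complex.inner, nsmul_eq_mul, Nat.cast_ofNat] at h4
  have h5 : (alpha m z Z).re = (2 * R m z)⁻¹ * (Real.exp (-(4 * m * y₁ m z)) *
      (starRingEnd ℂ (z 0) * Z 0).re - Real.exp (4 * m * y₁ m z) *
      (starRingEnd ℂ (z 1) * Z 1).re) := by
    rw [alpha_apply]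
    norm_cast
    rw [Complex.re_ofReal_mul, Complex.sub_re, Complex.re_ofReal_mul, Complex.re_ofReal_mul]
  rw [h5, V]
  field_simp
  rw [mul_comm (Z 0), mul_comm (Z 1)] at h4
  linear_combination h4 / 2 + 2 * m * fderiv ℝ (y₁ m) z Z * two_mul_R hm z

theorem hasFDerivAt_yC (z : C2) : HasFDerivAt yC (beta z) z := by
  have h := (((coord 0).hasFDerivAt (x := z)).mul ((coord 1).hasFDerivAt (x := z))).const_mul
    (-Complex.I)
  refine h.congr_fderiv ?_
  ext Z
  rw [beta_apply]
  simp
  ring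

theorem contDiff_yC : ContDiff ℝ ∞ yC :=
  contDiff_const.mul ((coord 0).contDiff.mul (coord 1).contDiff)

/-- Differentiating `R² = y₁² + |y₂ + iy₃|²` rather than the exponential formula expresses `dR`
through the bounded quotients `y₁/R` and `(y₂ + iy₃)/R`. -/
theorem fderiv_R (hm : 0 < m) {z : C2} (hz : z ≠ 0) (Z : C2) :
    fderiv ℝ (R m) z Z = (R m z)⁻¹ * (y₁ m z * fderiv ℝ (y₁ m) z Z
      + (starRingEnd ℂ (yC z) * beta z Z).re) := by
  have hR := R_pos hm hz
  have hy := ((contDiff_y₁ hm).contDiffAt (x := z)).differentiableAt (by simp) |>.hasFDerivAt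
  have hR' := ((contDiff_R hm).contDiffAt (x := z)).differentiableAt (by simp) |>.hasFDerivAt
  have h1 := hR'.pow 2
  have h2 := (hy.pow 2).add (hasFDerivAt_yC z).norm_sq
  have h3 : (fun w => R m w ^ 2) = fun w => y₁ m w ^ 2 + ‖yC w‖ ^ 2 :=
    funext fun w => R_sq hm w
  have h1' : HasFDerivAt (fun w => R m w ^ 2) _ z := h1
  rw [h3] at h1'
  have h4 := congrArg (fun L : C2 →L[ℝ] ℝ => L Z) (h1'.unique h2)
  simp only [smul_apply, smul_eq_mul, add_apply, ContinuousLinearMap.comp_apply,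
    innerSL_apply_apply, Complex.inner, nsmul_eq_mul, Nat.cast_ofNat, Nat.add_one_sub_one,
    pow_one] at h4
  rw [mul_comm (beta z Z)] at h4
  field_simp
  linear_combination h4 / 2

/-- Because `α` is complex linear, `Re α(I₁ ·) = -Im α`. -/
theorem eta_eq (hm : 0 < m) {z : C2} (hz : z ≠ 0) (Z : C2) : eta m z Z = (alpha m z Z).im := by
  have := (V_pos hm hz).ne'
  rw [eta, fderiv_y₁ hm hz, alpha_I]
  simp only [Complex.mul_re, Complex.I_re, Complex.I_im]
  field_simp
  ring

/-- The diagonal entries of the metric in the frame. -/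
def metricDiag (m : ℝ) : Fin 4 → C2 → ℝ :=
  ![fun z => (V m z)⁻¹, fun z => (V m z)⁻¹, V m, V m]

theorem metric_eq_sum (hm : 0 < m) {z : C2} (hz : z ≠ 0) (Z W : C2) :
    metric m z Z W = ∑ a, metricDiag m a z * (coframe m a z Z * coframe m a z W) := by
  have hV := (V_pos hm hz).ne'
  have h1 : ∀ U, fderiv ℝ (y m 1) z U = (beta z U).re := fun U => by
    have h : HasFDerivAt (y m 1) (Complex.reCLM ∘L beta z) z :=
      Complex.reCLM.hasFDerivAt.comp z (hasFDerivAt_yC z)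
    rw [h.fderiv]
    rfl
  have h2 : ∀ U, fderiv ℝ (y m 2) z U = (beta z U).im := fun U => by
    have h : HasFDerivAt (y m 2) (Complex.imCLM ∘L beta z) z :=
      Complex.imCLM.hasFDerivAt.comp z (hasFDerivAt_yC z)
    rw [h.fderiv]
    rfl
  have h0 : ∀ U, fderiv ℝ (y m 0) z U = (V m z)⁻¹ * (alpha m z U).re := fderiv_y₁ hm hz
  rw [metric, Fin.sum_univ_three, Fin.sum_univ_four]
  simp only [h0, h1, h2, eta_eq hm hz, metricDiag, coframe, Matrix.cons_val_zero,
    Matrix.cons_val_one, Matrix.cons_val, ContinuousLinearMap.comp_apply, Complex.reCLM_apply,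
    Complex.imCLM_apply]
  field_simp
  ring

/-- The derivatives of `y₁` along the frame. -/
def dy₁ (m : ℝ) (a : Fin 4) (z : C2) : ℝ := ![(V m z)⁻¹, 0, 0, 0] a

/-- The derivatives of `y₂ + i y₃` along the frame. -/
def dyC (a : Fin 4) : ℂ := ![0, 0, 1, Complex.I] a

/-- `1 / R`. -/
def invR (m : ℝ) (z : C2) : ℝ := (R m z)⁻¹

/-- `y₁ / R`. -/
def dirY (m : ℝ) (z : C2) : ℝ := invR m z * y₁ m z

/-- `(y₂ + i y₃) / R`. -/
def dirC (m : ℝ) (z : C2) : ℂ := invR m z • yC z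

/-- The derivatives of `R` along the frame. -/
def dR (m : ℝ) (a : Fin 4) (z : C2) : ℝ :=
  dirY m z * dy₁ m a z + (starRingEnd ℂ (dirC m z) * dyC a).re

theorem frameDeriv_y₁ (hm : 0 < m) {z : C2} (hz : z ≠ 0) (a : Fin 4) :
    frameDeriv (frame m) a (y₁ m) z = dy₁ m a z := by
  rw [frameDeriv, fderiv_y₁ hm hz, alpha_frame hm hz]
  fin_cases a <;> simp [dy₁]

theorem frameDeriv_yC (hm : 0 < m) {z : C2} (hz : z ≠ 0) (a : Fin 4) :
    frameDeriv (frame m) a yC z = dyC a := by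
  rw [frameDeriv, (hasFDerivAt_yC z).fderiv, beta_frame hm hz]
  rfl

theorem frameDeriv_R (hm : 0 < m) {z : C2} (hz : z ≠ 0) (a : Fin 4) :
    frameDeriv (frame m) a (R m) z = dR m a z := by
  have h1 := frameDeriv_y₁ hm hz a
  rw [frameDeriv] at h1
  rw [frameDeriv, fderiv_R hm hz, h1, beta_frame hm hz, dR, dirY, dirC, Complex.real_smul, map_mul,
    Complex.conj_ofReal, mul_assoc (invR m z : ℂ), Complex.re_ofReal_mul]
  rw [invR, dyC]
  ring

theorem hasFDerivAt_invR (hm : 0 < m) {z : C2} (hz : z ≠ 0) :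
    HasFDerivAt (invR m) (-(invR m z ^ 2) • fderiv ℝ (R m) z) z := by
  have hR := (R_pos hm hz).ne'
  have hR' := ((contDiff_R hm).contDiffAt (x := z)).differentiableAt (by simp) |>.hasFDerivAt
  refine ((hasDerivAt_inv hR).comp_hasFDerivAt z hR').congr_fderiv ?_
  rw [invR, inv_pow]

theorem frameDeriv_invR (hm : 0 < m) {z : C2} (hz : z ≠ 0) (a : Fin 4) :
    frameDeriv (frame m) a (invR m) z = -(invR m z * (invR m z * dR m a z)) := by
  rw [← frameDeriv_R hm hz, frameDeriv, (hasFDerivAt_invR hm hz).fderiv, frameDeriv, smul_apply,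
    smul_eq_mul]
  ring

theorem frameDeriv_dirY (hm : 0 < m) {z : C2} (hz : z ≠ 0) (a : Fin 4) :
    frameDeriv (frame m) a (dirY m) z = invR m z * (dy₁ m a z - dR m a z * dirY m z) := by
  have hy := ((contDiff_y₁ hm).contDiffAt (x := z)).differentiableAt (by simp) |>.hasFDerivAt
  have h : HasFDerivAt (dirY m) _ z := (hasFDerivAt_invR hm hz).mul hy
  rw [← frameDeriv_R hm hz, ← frameDeriv_y₁ hm hz, frameDeriv, h.fderiv, frameDeriv, frameDeriv]
  simp only [smul_apply, smul_eq_mul, add_apply, dirY]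
  ring

theorem frameDeriv_dirC (hm : 0 < m) {z : C2} (hz : z ≠ 0) (a : Fin 4) :
    frameDeriv (frame m) a (dirC m) z = invR m z • (dyC a - dR m a z • dirC m z) := by
  have h : HasFDerivAt (dirC m) _ z := (hasFDerivAt_invR hm hz).smul (hasFDerivAt_yC z)
  rw [← frameDeriv_R hm hz, ← frameDeriv_yC hm hz, frameDeriv, h.fderiv, frameDeriv, frameDeriv,
    (hasFDerivAt_yC z).fderiv]
  simp only [smul_apply, add_apply, dirC, ContinuousLinearMap.smulRight_apply, smul_eq_mul,
    Complex.real_smul]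
  push_cast
  ring

/-! ### Symbols: the coordinate functions -/

theorem smoothAtInfinity_invR (hm : 0 < m) : SmoothAtInfinity (invR m) := by
  filter_upwards [eventually_ne_zero] with z hz
  exact (contDiff_R hm).contDiffAt.inv (R_pos hm hz).ne'

theorem invR_isBigO_one (hm : 0 < m) :
    invR m =O[cobounded C2] (fun _ => (1 : ℝ)) := by
  refine IsBigO.of_bound 1 ?_
  filter_upwards [eventually_one_le_R hm] with z hz
  rw [invR, norm_inv, Real.norm_of_nonneg (by linarith)]
  simpa using inv_le_one_of_one_le₀ hz

theorem dirY_isBigO (hm : 0 < m) : dirY m =O[cobounded C2] (fun _ => (1 : ℝ)) := by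
  refine IsBigO.of_bound 1 ?_
  filter_upwards [eventually_ne_zero] with z hz
  have hR := R_pos hm hz
  have := abs_y₁_le_R (m := m) z
  rw [dirY, invR, norm_mul, norm_inv, Real.norm_of_nonneg hR.le, Real.norm_eq_abs]
  rw [inv_mul_le_iff₀ hR]
  simpa using this

theorem dirC_isBigO (hm : 0 < m) : dirC m =O[cobounded C2] (fun _ => (1 : ℝ)) := by
  refine IsBigO.of_bound 1 ?_
  filter_upwards [eventually_ne_zero] with z hz
  have hR := R_pos hm hz
  have := norm_yC_le_R hm z
  rw [dirC, invR, norm_smul, norm_inv, Real.norm_of_nonneg hR.le]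
  rw [inv_mul_le_iff₀ hR]
  simpa using this

section

variable {n : ℕ}

theorem symbolOrder_V (hm : 0 < m) (h : SymbolOrder (frame m) (invR m) n (invR m)) :
    SymbolOrder (frame m) (fun _ => 1) n (V m) := by
  refine ((SymbolOrder.const (2 * m)).add
    ((h.weight (invR_isBigO_one hm)).const_mul (1 / 2))).congr ?_
  filter_upwards [eventually_ne_zero] with z hz
  rw [V_eq hm hz, invR]
  ring

theorem symbolOrder_invV (hm : 0 < m) (h : SymbolOrder (frame m) (invR m) n (invR m)) :
    SymbolOrder (frame m) (fun _ => 1) n (fun z => (V m z)⁻¹) := by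
  -- The lower bound comes from `V = 2m + 1/(2R)`; here `m > 0` makes the fibre direction stay of
  -- bounded length.
  refine (symbolOrder_V hm h).inv (c := 2 * m) (by positivity) ?_
  filter_upwards [eventually_ne_zero] with z hz
  have := R_pos hm hz
  rw [V_eq hm hz]
  have : 0 < (R m z)⁻¹ / 2 := by positivity
  linarith

theorem symbolOrder_dy₁ (hm : 0 < m) (h : SymbolOrder (frame m) (invR m) n (invR m))
    (a : Fin 4) : SymbolOrder (frame m) (fun _ => 1) n (dy₁ m a) := by
  fin_cases a
  · exact symbolOrder_invV hm h
  · exact SymbolOrder.const 0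
  · exact SymbolOrder.const 0
  · exact SymbolOrder.const 0

theorem symbolOrder_dR (hm : 0 < m) (h : SymbolOrder (frame m) (invR m) n (invR m))
    (hY : SymbolOrder (frame m) (fun _ => 1) n (dirY m))
    (hC : SymbolOrder (frame m) (fun _ => 1) n (dirC m)) (a : Fin 4) :
    SymbolOrder (frame m) (fun _ => 1) n (dR m a) :=
  (hY.mul_left (symbolOrder_dy₁ hm h a)).add
    (((hC.clm_comp Complex.conjCLE.toContinuousLinearMap).mul_left
      (SymbolOrder.const (dyC a))).clm_comp Complex.reCLM)

/-- Simultaneous induction: the frame derivatives of the three functions are polynomials in them and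
in `V⁻¹`, which is itself controlled by `1/R` to the same order. Each derivative carries a factor
`1/R`; only one such factor has to be kept, for the weight of `1/R`. -/
theorem symbolOrder_invR_dirY_dirC (hm : 0 < m) (n : ℕ) :
    SymbolOrder (frame m) (invR m) n (invR m) ∧
    SymbolOrder (frame m) (fun _ => 1) n (dirY m) ∧
    SymbolOrder (frame m) (fun _ => 1) n (dirC m) := by
  have s1 := smoothAtInfinity_invR hm
  have s2 : SmoothAtInfinity (dirY m) :=
    s1.mono fun z hz => hz.mul (contDiff_y₁ hm).contDiffAt
  have s3 : SmoothAtInfinity (dirC m) :=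
    s1.mono fun z hz => hz.smul contDiff_yC.contDiffAt
  have o1 := isBigO_refl (invR m) (cobounded C2)
  induction n with
  | zero => exact ⟨⟨s1, o1⟩, ⟨s2, dirY_isBigO hm⟩, ⟨s3, dirC_isBigO hm⟩⟩
  | succ n ih =>
    obtain ⟨h1, h2, h3⟩ := ih
    have h1' := h1.weight (invR_isBigO_one hm)
    have hd := symbolOrder_dR hm h1 h2 h3
    have hy := symbolOrder_dy₁ hm h1
    refine ⟨SymbolOrder.of_frameDeriv s1 o1
        (fun a => (h1'.mul_left ((hd a).mul_left h1)).neg) fun a => ?_,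
      SymbolOrder.of_frameDeriv s2 (dirY_isBigO hm)
        (fun a => h1'.mul_left ((hy a).sub ((hd a).mul_left h2))) fun a => ?_,
      SymbolOrder.of_frameDeriv s3 (dirC_isBigO hm)
        (fun a => h1'.smul_left ((SymbolOrder.const (dyC a)).sub ((hd a).smul_left h3)))
        fun a => ?_⟩
    · filter_upwards [eventually_ne_zero] with z hz
      rw [frameDeriv_invR hm hz]
      ring
    · filter_upwards [eventually_ne_zero] with z hz
      rw [frameDeriv_dirY hm hz]
    · filter_upwards [eventually_ne_zero] with z hz
      rw [frameDeriv_dirC hm hz]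

end

theorem symbol_invR (hm : 0 < m) : Symbol (frame m) (invR m) (invR m) :=
  fun n => (symbolOrder_invR_dirY_dirC hm n).1

theorem symbol_invR_one (hm : 0 < m) : Symbol (frame m) (fun _ => 1) (invR m) :=
  (symbol_invR hm).weight (invR_isBigO_one hm)

theorem symbol_dirY (hm : 0 < m) : Symbol (frame m) (fun _ => 1) (dirY m) :=
  fun n => (symbolOrder_invR_dirY_dirC hm n).2.1

theorem symbol_dirC (hm : 0 < m) : Symbol (frame m) (fun _ => 1) (dirC m) :=
  fun n => (symbolOrder_invR_dirY_dirC hm n).2.2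

theorem symbol_V (hm : 0 < m) : Symbol (frame m) (fun _ => 1) (V m) :=
  fun n => symbolOrder_V hm (symbol_invR hm n)

theorem symbol_invV (hm : 0 < m) : Symbol (frame m) (fun _ => 1) (fun z => (V m z)⁻¹) :=
  fun n => symbolOrder_invV hm (symbol_invR hm n)

theorem symbol_dy₁ (hm : 0 < m) (a : Fin 4) : Symbol (frame m) (fun _ => 1) (dy₁ m a) :=
  fun n => symbolOrder_dy₁ hm (symbol_invR hm n) a

theorem symbol_dR (hm : 0 < m) (a : Fin 4) : Symbol (frame m) (fun _ => 1) (dR m a) :=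
  fun n => symbolOrder_dR hm (symbol_invR hm n) (symbol_dirY hm n) (symbol_dirC hm n) a

/-! ### Symbols: hyperbolic functions of `y₁` -/

/-- `tanh (4 m y₁)`. -/
def tanhY (m : ℝ) (z : C2) : ℝ := Real.tanh (4 * m * y₁ m z)

/-- `1 / cosh (4 m y₁)`. -/
def sechY (m : ℝ) (z : C2) : ℝ := (Real.cosh (4 * m * y₁ m z))⁻¹

/-- `2 R cosh (4 m y₁) / r²`. -/
def radialQuot (m : ℝ) (z : C2) : ℝ := (1 + dirY m z * tanhY m z)⁻¹

theorem tanhY_sq_add_sechY_sq (m : ℝ) (z : C2) : tanhY m z ^ 2 + sechY m z ^ 2 = 1 := by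
  have h := Real.cosh_sq (4 * m * y₁ m z)
  have h0 := (Real.cosh_pos (4 * m * y₁ m z)).ne'
  rw [tanhY, sechY, Real.tanh_eq_sinh_div_cosh]
  field_simp
  linarith

theorem hasFDerivAt_sechY (hm : 0 < m) (z : C2) :
    HasFDerivAt (sechY m) (-(4 * m * sechY m z * tanhY m z) • fderiv ℝ (y₁ m) z) z := by
  have hy := ((contDiff_y₁ hm).contDiffAt (x := z)).differentiableAt (by simp) |>.hasFDerivAt
  have h0 := (Real.cosh_pos (4 * m * y₁ m z)).ne'
  have h := ((Real.hasDerivAt_cosh (4 * m * y₁ m z)).inv h0).comp_hasFDerivAt z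
    (hy.const_mul (4 * m))
  refine h.congr_fderiv ?_
  rw [smul_smul, sechY, tanhY, Real.tanh_eq_sinh_div_cosh]
  congr 1
  field_simp

theorem tanhY_eq (m : ℝ) (z : C2) :
    tanhY m z = Real.sinh (4 * m * y₁ m z) * sechY m z := by
  rw [tanhY, sechY, Real.tanh_eq_sinh_div_cosh, div_eq_mul_inv]

theorem hasFDerivAt_tanhY (hm : 0 < m) (z : C2) :
    HasFDerivAt (tanhY m) ((4 * m * sechY m z ^ 2) • fderiv ℝ (y₁ m) z) z := by
  have hy := ((contDiff_y₁ hm).contDiffAt (x := z)).differentiableAt (by simp) |>.hasFDerivAt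
  have h0 := (Real.cosh_pos (4 * m * y₁ m z)).ne'
  have h := (hy.const_mul (4 * m)).sinh.mul (hasFDerivAt_sechY hm z)
  have h' : HasFDerivAt (tanhY m) _ z :=
    h.congr_of_eventuallyEq (Eventually.of_forall fun w => tanhY_eq m w)
  refine h'.congr_fderiv ?_
  rw [smul_smul, smul_smul, smul_smul, ← add_smul]
  congr 1
  have h1 := tanhY_sq_add_sechY_sq m z
  have h2 := tanhY_eq m z
  have h3 : sechY m z * Real.cosh (4 * m * y₁ m z) = 1 := inv_mul_cancel₀ h0
  linear_combination (4 * m * tanhY m z) * h2 - 4 * m * h1 + 4 * m * h3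

theorem frameDeriv_sechY (hm : 0 < m) {z : C2} (hz : z ≠ 0) (a : Fin 4) :
    frameDeriv (frame m) a (sechY m) z = -(4 * m * (sechY m z * (tanhY m z * dy₁ m a z))) := by
  rw [← frameDeriv_y₁ hm hz, frameDeriv, (hasFDerivAt_sechY hm z).fderiv, frameDeriv, smul_apply,
    smul_eq_mul]
  ring

theorem frameDeriv_tanhY (hm : 0 < m) {z : C2} (hz : z ≠ 0) (a : Fin 4) :
    frameDeriv (frame m) a (tanhY m) z = 4 * m * (sechY m z * (sechY m z * dy₁ m a z)) := by
  rw [← frameDeriv_y₁ hm hz, frameDeriv, (hasFDerivAt_tanhY hm z).fderiv, frameDeriv, smul_apply,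
    smul_eq_mul]
  ring

theorem contDiff_sechY (hm : 0 < m) : ContDiff ℝ ∞ (sechY m) :=
  (Real.contDiff_cosh.comp (contDiff_const.mul (contDiff_y₁ hm))).inv
    fun _ => (Real.cosh_pos _).ne'

theorem contDiff_tanhY (hm : 0 < m) : ContDiff ℝ ∞ (tanhY m) := by
  rw [show tanhY m = fun z => Real.sinh (4 * m * y₁ m z) * sechY m z from funext (tanhY_eq m)]
  exact (Real.contDiff_sinh.comp (contDiff_const.mul (contDiff_y₁ hm))).mul (contDiff_sechY hm)

/-- The pair satisfies `tanh' = sech²`, `sech' = -sech tanh`, and `dy₁` has symbol components, so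
the system is closed. No decay is gained, since `y₁` can stay bounded while `R` tends to infinity.
-/
theorem symbolOrder_tanhY_sechY (hm : 0 < m) (n : ℕ) :
    SymbolOrder (frame m) (fun _ => 1) n (tanhY m) ∧
    SymbolOrder (frame m) (fun _ => 1) n (sechY m) := by
  have s1 : SmoothAtInfinity (tanhY m) :=
    Eventually.of_forall fun _ => (contDiff_tanhY hm).contDiffAt
  have s2 : SmoothAtInfinity (sechY m) :=
    Eventually.of_forall fun _ => (contDiff_sechY hm).contDiffAt
  have o1 : tanhY m =O[cobounded C2] (fun _ => (1 : ℝ)) := by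
    refine IsBigO.of_bound 1 (Eventually.of_forall fun z => ?_)
    have := tanhY_sq_add_sechY_sq m z
    simpa using abs_le_one_iff_mul_self_le_one.2 (by nlinarith [sq_nonneg (sechY m z)])
  have o2 : sechY m =O[cobounded C2] (fun _ => (1 : ℝ)) := by
    refine IsBigO.of_bound 1 (Eventually.of_forall fun z => ?_)
    have := tanhY_sq_add_sechY_sq m z
    simpa using abs_le_one_iff_mul_self_le_one.2 (by nlinarith [sq_nonneg (tanhY m z)])
  induction n with
  | zero => exact ⟨⟨s1, o1⟩, ⟨s2, o2⟩⟩
  | succ n ih =>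
    obtain ⟨h1, h2⟩ := ih
    have hy := fun a => symbol_dy₁ hm a n
    refine ⟨SymbolOrder.of_frameDeriv s1 o1
        (fun a => (h2.mul_left (h2.mul_left (hy a))).const_mul (4 * m)) fun a => ?_,
      SymbolOrder.of_frameDeriv s2 o2
        (fun a => ((h2.mul_left (h1.mul_left (hy a))).const_mul (4 * m)).neg) fun a => ?_⟩
    · filter_upwards [eventually_ne_zero] with z hz
      rw [frameDeriv_tanhY hm hz]
    · filter_upwards [eventually_ne_zero] with z hz
      rw [frameDeriv_sechY hm hz]

theorem symbol_tanhY (hm : 0 < m) : Symbol (frame m) (fun _ => 1) (tanhY m) :=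
  fun n => (symbolOrder_tanhY_sechY hm n).1

theorem symbol_sechY (hm : 0 < m) : Symbol (frame m) (fun _ => 1) (sechY m) :=
  fun n => (symbolOrder_tanhY_sechY hm n).2

/-- `y₁` and `tanh(4my₁)` have the same sign. This bound is what makes `radialQuot` a symbol. -/
theorem one_le_radial (hm : 0 < m) (z : C2) : 1 ≤ 1 + dirY m z * tanhY m z := by
  have h1 := mul_sinh_nonneg hm (y₁ m z)
  have h2 : 0 ≤ sechY m z := (inv_pos.2 (Real.cosh_pos _)).le
  have h3 : 0 ≤ invR m z := inv_nonneg.2 (R_nonneg z)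
  have h4 : dirY m z * tanhY m z =
      invR m z * (y₁ m z * Real.sinh (4 * m * y₁ m z)) * sechY m z := by
    rw [tanhY_eq, dirY]; ring
  rw [h4]
  have := mul_nonneg (mul_nonneg h3 h1) h2
  linarith

theorem symbol_radialQuot (hm : 0 < m) : Symbol (frame m) (fun _ => 1) (radialQuot m) :=
  ((Symbol.const 1).add ((symbol_dirY hm).mul_left (symbol_tanhY hm))).inv one_pos
    (Eventually.of_forall fun z => one_le_radial hm z)

theorem inv_norm_sq_eq (hm : 0 < m) {z : C2} (hz : z ≠ 0) :
    (‖z‖ ^ 2)⁻¹ = sechY m z * invR m z * radialQuot m z / 2 := by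
  have hR := (R_pos hm hz).ne'
  have h0 := (Real.cosh_pos (4 * m * y₁ m z)).ne'
  have h1 : ‖z‖ ^ 2 = 2 * (R m z * (Real.cosh (4 * m * y₁ m z)
      * (1 + dirY m z * tanhY m z))) := by
    rw [norm_sq_eq_cosh_sinh hm, tanhY_eq, dirY, invR, sechY]
    field_simp
  rw [h1, sechY, invR, radialQuot, mul_inv, mul_inv, mul_inv]
  ring

/-! ### Derivatives of the frame -/

/-- The antilinear map `Z ↦ (i / 2R) (e^{4my₁} conj Z₂, e^{-4my₁} conj Z₁)`. -/
def conjLift (m : ℝ) (z Z : C2) : C2 :=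
  (2 * R m z)⁻¹ • (Real.exp (4 * m * y₁ m z) • conjSwapFst Z
    + Real.exp (-(4 * m * y₁ m z)) • conjSwapSnd Z)

theorem conjLift_zero (m : ℝ) (z Z : C2) :
    conjLift m z Z 0 = (2 * R m z : ℂ)⁻¹ * (Real.exp (4 * m * y₁ m z) *
      (Complex.I * starRingEnd ℂ (Z 1))) := by
  simp [conjLift]

theorem conjLift_one (m : ℝ) (z Z : C2) :
    conjLift m z Z 1 = (2 * R m z : ℂ)⁻¹ * (Real.exp (-(4 * m * y₁ m z)) *
      (Complex.I * starRingEnd ℂ (Z 0))) := by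
  simp [conjLift]

theorem conjLift_I (m : ℝ) (z Z : C2) :
    conjLift m z (stdI 0 Z) = -stdI 0 (conjLift m z Z) := by
  ext i
  fin_cases i
  · simp [stdI_zero_apply, conjLift_zero]
    ring
  · simp [stdI_zero_apply, conjLift_one]
    ring

theorem conjLift_axial (m : ℝ) (z : C2) : conjLift m z (axial z) = -axial (horiz m z) := by
  ext i
  fin_cases i
  · simp [conjLift_zero, horiz_zero]
  · simp [conjLift_one, horiz_one]

/-- Applying the antilinear map twice multiplies the two opposite exponentials together, so only
`z/(4R²)` survives. Thus differentiating the frame leads back to `z` and the frame. -/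
theorem conjLift_horiz (m : ℝ) (z : C2) :
    conjLift m z (horiz m z) = (invR m z * invR m z / 4) • z := by
  have h := exp_mul_exp_neg m z
  ext i
  fin_cases i
  · simp only [Fin.zero_eta, conjLift_zero, horiz_one, PiLp.smul_apply, Complex.real_smul, map_mul,
      Complex.conj_I, Complex.conj_ofReal, Complex.conj_conj, map_inv₀, invR, map_ofNat]
    push_cast at h ⊢
    rw [mul_inv]
    linear_combination ((R m z : ℂ)⁻¹ ^ 2 / 4 * z 0) * h - ((R m z : ℂ)⁻¹ ^ 2 / 4 * z 0) *
      Complex.exp (4 * m * y₁ m z) * Complex.exp (-(4 * m * y₁ m z)) * Complex.I_sq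
  · simp only [Fin.mk_one, conjLift_one, horiz_zero, PiLp.smul_apply, Complex.real_smul, map_mul,
      Complex.conj_I, Complex.conj_ofReal, Complex.conj_conj, map_inv₀, invR, map_ofNat]
    push_cast at h ⊢
    rw [mul_inv]
    linear_combination ((R m z : ℂ)⁻¹ ^ 2 / 4 * z 1) * h - ((R m z : ℂ)⁻¹ ^ 2 / 4 * z 1) *
      Complex.exp (4 * m * y₁ m z) * Complex.exp (-(4 * m * y₁ m z)) * Complex.I_sq

theorem axial_horiz (m : ℝ) (z : C2) :
    axial (horiz m z) = (2 * R m z)⁻¹ • (Real.exp (4 * m * y₁ m z) • conjSwapFst z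
      - Real.exp (-(4 * m * y₁ m z)) • conjSwapSnd z) := by
  ext i
  fin_cases i <;> simp [horiz]

/-- The three terms come from the prefactor `1/(2R)`, from the two exponentials (their opposite
signs produce `axial`), and from the conjugated coordinates. -/
theorem fderiv_horiz (hm : 0 < m) {z : C2} (hz : z ≠ 0) (Z : C2) :
    fderiv ℝ (horiz m) z Z = -(invR m z * fderiv ℝ (R m) z Z) • horiz m z
      + (4 * m * fderiv ℝ (y₁ m) z Z) • axial (horiz m z) + conjLift m z Z := by
  have hy := ((contDiff_y₁ hm).contDiffAt (x := z)).differentiableAt (by simp) |>.hasFDerivAt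
  have ha := hy.const_mul (4 * m)
  have h0 : (fun w => (2 * R m w)⁻¹) = fun w => 1 / 2 * invR m w := by
    funext w
    rw [invR, mul_inv]
    ring
  have hI := (hasFDerivAt_invR hm hz).const_mul (1 / 2)
  rw [← h0] at hI
  have h : HasFDerivAt (horiz m) _ z := hI.smul
    ((ha.exp.smul conjSwapFst.hasFDerivAt).add (ha.fun_neg.exp.smul conjSwapSnd.hasFDerivAt))
  rw [h.fderiv, axial_horiz, conjLift, horiz]
  simp only [smul_apply, add_apply, neg_apply, ContinuousLinearMap.smulRight_apply, smul_eq_mul]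
  have h1 : (2 * R m z)⁻¹ = 1 / 2 * invR m z := congrFun h0 z
  rw [h1]
  module

theorem stdI_stdI (z : C2) : stdI 0 (stdI 0 z) = -z := by
  rw [stdI_zero_apply, stdI_zero_apply, smul_smul, Complex.I_mul_I, neg_one_smul]

/-- The antilinear part of the derivatives of `horiz` along the frame. -/
def conjLiftFrame (m : ℝ) (a : Fin 4) (z : C2) : C2 :=
  ![-axial (horiz m z), stdI 0 (axial (horiz m z)), (invR m z * invR m z / 4) • z,
    -stdI 0 ((invR m z * invR m z / 4) • z)] a

theorem conjLift_frame (m : ℝ) (z : C2) (a : Fin 4) :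
    conjLift m z (frame m a z) = conjLiftFrame m a z := by
  fin_cases a
  · exact conjLift_axial m z
  · exact (conjLift_I m z _).trans (by rw [conjLift_axial]; simp [conjLiftFrame])
  · exact conjLift_horiz m z
  · exact (conjLift_I m z _).trans (by rw [conjLift_horiz]; simp [conjLiftFrame])

theorem frameDeriv_horiz (hm : 0 < m) {z : C2} (hz : z ≠ 0) (a : Fin 4) :
    frameDeriv (frame m) a (horiz m) z = -((invR m z * dR m a z) • horiz m z)
      + (4 * m * dy₁ m a z) • axial (horiz m z) + conjLiftFrame m a z := by
  rw [← frameDeriv_R hm hz, ← frameDeriv_y₁ hm hz, frameDeriv, fderiv_horiz hm hz, conjLift_frame,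
    frameDeriv, frameDeriv, neg_smul]

theorem frameDeriv_id (m : ℝ) (z : C2) (a : Fin 4) :
    frameDeriv (frame m) a (fun z => z) z = frame m a z := by
  simp [frameDeriv]

/-- Here `|X|² = (2R)⁻² · 2(R cosh(4my₁) - y₁ sinh(4my₁))`. Changing the minus sign to plus gives
`r²`, and the changed term is nonnegative. -/
theorem horiz_isBigO (hm : 0 < m) : horiz m =O[cobounded C2] fun z => ‖z‖ := by
  refine IsBigO.of_bound 1 ?_
  filter_upwards [eventually_one_le_R hm] with z hz
  rw [one_mul, norm_norm]
  have hRC : ‖(2 * R m z : ℂ)⁻¹‖ = (2 * R m z)⁻¹ := by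
    rw [norm_inv, norm_mul, Complex.norm_real, Real.norm_of_nonneg (by linarith)]
    simp
  have hinv : (2 * R m z)⁻¹ ≤ 1 / 2 := by
    rw [inv_le_comm₀ (by linarith) (by norm_num)]
    norm_num
    linarith
  have hinv0 : 0 ≤ (2 * R m z)⁻¹ := by positivity
  have e1 := Real.exp_pos (4 * m * y₁ m z)
  have e2 := Real.exp_pos (-(4 * m * y₁ m z))
  have e12 : Real.exp (4 * m * y₁ m z) * Real.exp (-(4 * m * y₁ m z)) = 1 := by
    rw [← Real.exp_add]; simp
  have n0 := norm_sq_coord_zero hm z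
  have n1 := norm_sq_coord_one hm z
  have h0 : ‖horiz m z 0‖ ^ 2
      = (2 * R m z)⁻¹ ^ 2 * (Real.exp (4 * m * y₁ m z) * (R m z - y₁ m z)) := by
    rw [horiz_zero, norm_mul, hRC, norm_mul, Complex.norm_real, Real.norm_of_nonneg e1.le, norm_mul,
      Complex.norm_I, one_mul, RCLike.norm_conj, mul_pow, mul_pow, n1]
    linear_combination ((2 * R m z)⁻¹ ^ 2 * Real.exp (4 * m * y₁ m z) * (R m z - y₁ m z)) * e12
  have h1 : ‖horiz m z 1‖ ^ 2
      = (2 * R m z)⁻¹ ^ 2 * (Real.exp (-(4 * m * y₁ m z)) * (R m z + y₁ m z)) := by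
    rw [horiz_one, norm_mul, hRC, norm_mul, Complex.norm_real, Real.norm_of_nonneg e2.le, norm_mul,
      Complex.norm_I, one_mul, RCLike.norm_conj, mul_pow, mul_pow, n0]
    linear_combination ((2 * R m z)⁻¹ ^ 2 * Real.exp (-(4 * m * y₁ m z)) * (R m z + y₁ m z)) * e12
  have hy := abs_le.1 (abs_y₁_le_R (m := m) z)
  have hN := norm_sq_eq_cosh_sinh hm z
  have hs := mul_sinh_nonneg hm (y₁ m z)
  have hq : (2 * R m z)⁻¹ ^ 2 ≤ 1 := by nlinarith
  have hsum : Real.exp (4 * m * y₁ m z) * (R m z - y₁ m z)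
      + Real.exp (-(4 * m * y₁ m z)) * (R m z + y₁ m z) ≤ ‖z‖ ^ 2 := by
    rw [hN]
    have hc := Real.cosh_eq (4 * m * y₁ m z)
    have hs' := Real.sinh_eq (4 * m * y₁ m z)
    have : Real.exp (4 * m * y₁ m z) * (R m z - y₁ m z)
      + Real.exp (-(4 * m * y₁ m z)) * (R m z + y₁ m z)
      = 2 * (R m z * Real.cosh (4 * m * y₁ m z) - y₁ m z * Real.sinh (4 * m * y₁ m z)) := by
      rw [hc, hs']; ring
    rw [this]
    linarith
  have hpos : 0 ≤ Real.exp (4 * m * y₁ m z) * (R m z - y₁ m z)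
      + Real.exp (-(4 * m * y₁ m z)) * (R m z + y₁ m z) :=
    add_nonneg (mul_nonneg e1.le (by linarith)) (mul_nonneg e2.le (by linarith))
  refine abs_le_of_sq_le_sq' ?_ (norm_nonneg z) |>.2
  rw [norm_sq_eq (horiz m z), h0, h1, ← mul_add]
  calc _ ≤ 1 * _ := mul_le_mul_of_nonneg_right hq hpos
    _ ≤ _ := by rwa [one_mul]

/-- The identity field and `X` must be treated together: derivatives of `z` are frame fields, and
derivatives of `X` are bounded symbol combinations of fixed linear images of `z` and `X`. -/
theorem symbolOrder_id_horiz (hm : 0 < m) (n : ℕ) :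
    SymbolOrder (frame m) (fun z => ‖z‖) n (fun z : C2 => z) ∧
    SymbolOrder (frame m) (fun z => ‖z‖) n (horiz m) := by
  have s1 : SmoothAtInfinity (fun z : C2 => z) := Eventually.of_forall fun _ => contDiffAt_id
  have s2 : SmoothAtInfinity (horiz m) := by
    filter_upwards [eventually_ne_zero] with z hz using contDiffAt_horiz hm hz
  have o1 : (fun z : C2 => z) =O[cobounded C2] fun z => ‖z‖ := (isBigO_refl _ _).norm_right
  induction n with
  | zero => exact ⟨⟨s1, o1⟩, ⟨s2, horiz_isBigO hm⟩⟩
  | succ n ih =>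
    obtain ⟨h1, h2⟩ := ih
    have hA := h2.clm_comp axial
    have hr := symbol_invR_one hm n
    have hrz := (((hr.mul_left hr).mul_left (SymbolOrder.const (1 / 4 : ℝ))).smul_left h1)
    refine ⟨SymbolOrder.of_frameDeriv s1 o1 (g := frame m) (fun a => ?_) fun a => ?_,
      SymbolOrder.of_frameDeriv s2 (horiz_isBigO hm)
        (fun a => (((hr.mul_left (symbol_dR hm a n)).smul_left h2).neg.add
          (((symbol_dy₁ hm a n).const_mul (4 * m)).smul_left hA)).add
          (?_ : SymbolOrder _ _ _ (conjLiftFrame m a))) fun a => ?_⟩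
    · fin_cases a
      · exact h1.clm_comp axial
      · exact (h1.clm_comp axial).clm_comp (stdI 0)
      · exact h2
      · exact h2.clm_comp (stdI 0)
    · exact Eventually.of_forall fun z => (frameDeriv_id m z a).symm
    · have hrz' : SymbolOrder (frame m) (fun z => ‖z‖) n
          (fun z => (invR m z * invR m z / 4) • z) := by
        simpa [div_eq_mul_inv] using hrz
      fin_cases a
      · exact hA.neg
      · exact hA.clm_comp (stdI 0)
      · exact hrz'
      · exact (hrz'.clm_comp (stdI 0)).neg
    · filter_upwards [eventually_ne_zero] with z hz
      rw [frameDeriv_horiz hm hz]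

theorem symbol_horiz (hm : 0 < m) : Symbol (frame m) (fun z => ‖z‖) (horiz m) :=
  fun n => (symbolOrder_id_horiz hm n).2

theorem symbol_axial (hm : 0 < m) : Symbol (frame m) (fun z => ‖z‖) (fun z => axial z) :=
  fun n => (symbolOrder_id_horiz hm n).1.clm_comp axial

theorem symbol_frame (hm : 0 < m) (a : Fin 4) :
    Symbol (frame m) (fun z => ‖z‖) (frame m a) := by
  fin_cases a
  · exact symbol_axial hm
  · exact (symbol_axial hm).clm_comp (stdI 0)
  · exact symbol_horiz hm
  · exact (symbol_horiz hm).clm_comp (stdI 0)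

/-! ### Exterior derivatives of the coframe -/

theorem symp_stdI_left (Z W : C2) : symp (stdI 0 Z) W = Complex.I * symp Z W := by
  simp [stdI_zero_apply]
  ring

theorem symp_stdI_right (Z W : C2) : symp Z (stdI 0 W) = Complex.I * symp Z W := by
  simp [stdI_zero_apply]
  ring

theorem mul_coord_eq (z : C2) : z 0 * z 1 = Complex.I * yC z := by
  rw [yC]
  linear_combination (z 0 * z 1) * Complex.I_sq

theorem symp_self_axial (z : C2) : symp z (axial z) = -(2 * Complex.I * yC z) := by
  simp only [symp_apply, axial_zero, axial_one]
  linear_combination -2 * mul_coord_eq z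

theorem symp_self_horiz (hm : 0 < m) (z : C2) :
    symp z (horiz m z) = Complex.I * dirY m z := by
  simp only [symp_apply, horiz_zero, horiz_one, dirY, invR, mul_inv]
  push_cast
  have h1 := exp_neg_mul_conj hm z
  have h2 := exp_mul_conj hm z
  push_cast at h1 h2
  linear_combination Complex.I * (R m z : ℂ)⁻¹ / 2 * (h1 - h2)

theorem symp_axial_horiz_axial (hm : 0 < m) (z : C2) :
    symp (axial (horiz m z)) (axial z) = Complex.I * dirY m z := by
  simp only [symp_apply, axial_zero, axial_one, horiz_zero, horiz_one, dirY, invR, mul_inv]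
  push_cast
  have h1 := exp_neg_mul_conj hm z
  have h2 := exp_mul_conj hm z
  push_cast at h1 h2
  linear_combination Complex.I * (R m z : ℂ)⁻¹ / 2 * (h1 - h2)

theorem symp_axial_horiz_horiz (m : ℝ) (z : C2) :
    symp (axial (horiz m z)) (horiz m z) =
      Complex.I / 2 * (invR m z * starRingEnd ℂ (dirC m z)) := by
  have h := exp_mul_exp_neg m z
  simp only [symp_apply, axial_zero, axial_one, horiz_zero, horiz_one, dirC, yC, invR, mul_inv,
    Complex.real_smul, map_mul, map_neg, Complex.conj_I, Complex.conj_ofReal]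
  push_cast at h ⊢
  linear_combination ((R m z : ℂ)⁻¹ ^ 2 / 2 * starRingEnd ℂ (z 0) * starRingEnd ℂ (z 1)) *
    Complex.I ^ 2 * h

theorem fderiv_alpha (hm : 0 < m) {z : C2} (hz : z ≠ 0) (Z W : C2) :
    fderiv ℝ (alpha m) z Z W = Complex.I * symp (fderiv ℝ (horiz m) z Z) W := by
  have h := ((contDiffAt_horiz hm hz).differentiableAt (by simp)).hasFDerivAt
  have h' : HasFDerivAt (alpha m) _ z := (symp.hasFDerivAt.comp z h).const_smul Complex.I
  rw [h'.fderiv]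
  rfl

/-- The vectors grow like `r`, but their symplectic pairings lose the exponentials and reduce to
`y₁/R` and `(y₂ - iy₃)/R²`, up to constants. -/
theorem symbol_symp_axial_horiz (hm : 0 < m) (b : Fin 4) :
    Symbol (frame m) (fun _ => 1) (fun z => symp (axial (horiz m z)) (frame m b z)) := by
  have hY : Symbol (frame m) (fun _ => 1) (fun z => Complex.I * (dirY m z : ℂ)) :=
    ((symbol_dirY hm).clm_comp Complex.ofRealCLM).const_mul Complex.I
  have hC : Symbol (frame m) (fun _ => 1)
      (fun z => Complex.I / 2 * ((invR m z : ℂ) * starRingEnd ℂ (dirC m z))) :=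
    (((symbol_invR_one hm).clm_comp Complex.ofRealCLM).mul_left
      ((symbol_dirC hm).clm_comp Complex.conjCLE.toContinuousLinearMap)).const_mul _
  fin_cases b
  · exact hY.congr (Eventually.of_forall fun z => (symp_axial_horiz_axial hm z).symm)
  · refine (hY.const_mul Complex.I).congr (Eventually.of_forall fun z => ?_)
    exact ((symp_stdI_right _ _).trans (by rw [symp_axial_horiz_axial hm])).symm
  · exact hC.congr (Eventually.of_forall fun z => (symp_axial_horiz_horiz m z).symm)
  · refine (hC.const_mul Complex.I).congr (Eventually.of_forall fun z => ?_)
    exact ((symp_stdI_right _ _).trans (by rw [symp_axial_horiz_horiz])).symm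

/-- The pairing of `z` with `N` is `-2i(y₂ + iy₃)`, of size up to `R`; the factor `1/R` is needed to
make it bounded. -/
theorem symbol_invR_smul_symp_self (hm : 0 < m) (b : Fin 4) :
    Symbol (frame m) (fun _ => 1) (fun z => invR m z • symp z (frame m b z)) := by
  have hY : Symbol (frame m) (fun _ => 1)
      (fun z => (invR m z : ℂ) * (Complex.I * (dirY m z : ℂ))) :=
    ((symbol_invR_one hm).clm_comp Complex.ofRealCLM).mul_left
      (((symbol_dirY hm).clm_comp Complex.ofRealCLM).const_mul Complex.I)
  have hC : Symbol (frame m) (fun _ => 1) (fun z => -(2 * Complex.I) * dirC m z) :=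
    (symbol_dirC hm).const_mul _
  fin_cases b
  · refine hC.congr (Eventually.of_forall fun z => ?_)
    refine Eq.trans ?_ (congrArg (invR m z • ·) (symp_self_axial z).symm)
    simp only [dirC, Complex.real_smul]
    ring
  · refine (hC.const_mul Complex.I).congr (Eventually.of_forall fun z => ?_)
    refine Eq.trans ?_ (congrArg (invR m z • ·) ((symp_stdI_right z _).trans
      (by rw [symp_self_axial])).symm)
    simp only [dirC, Complex.real_smul]
    ring
  · refine hY.congr (Eventually.of_forall fun z => ?_)
    refine Eq.trans ?_ (congrArg (invR m z • ·) (symp_self_horiz hm z).symm)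
    simp only [Complex.real_smul]
  · refine (hY.const_mul Complex.I).congr (Eventually.of_forall fun z => ?_)
    refine Eq.trans ?_ (congrArg (invR m z • ·) ((symp_stdI_right z _).trans
      (by rw [symp_self_horiz hm])).symm)
    simp only [Complex.real_smul]
    ring

/-- `fderiv_horiz` turns the derivative of `α` into symplectic pairings, so the euclidean growth of
the fields never enters the estimate. -/
theorem symbol_fderiv_alpha (hm : 0 < m) (a b : Fin 4) :
    Symbol (frame m) (fun _ => 1)
      (fun z => fderiv ℝ (alpha m) z (frame m a z) (frame m b z)) := by
  have hA := symbol_symp_axial_horiz hm b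
  -- The term `z/(4R²)` of `conjLift_horiz` supplies two factors `1/R`: one tames the pairing with
  -- `z`, the other is only used as bounded.
  have hz' := ((symbol_invR_one hm).smul_left (symbol_invR_smul_symp_self hm b)).const_mul (1 / 4)
  have hS : Symbol (frame m) (fun _ => 1)
      (fun z => symp (conjLiftFrame m a z) (frame m b z)) := by
    fin_cases a
    · refine hA.neg.congr (Eventually.of_forall fun z => ?_)
      simp [conjLiftFrame]
    · refine (hA.const_mul Complex.I).congr (Eventually.of_forall fun z => ?_)
      exact (symp_stdI_left _ _).symm
    · refine hz'.congr (Eventually.of_forall fun z => ?_)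
      simp [conjLiftFrame]
      ring
    · refine (hz'.const_mul (-Complex.I)).congr (Eventually.of_forall fun z => ?_)
      simp [conjLiftFrame, stdI_zero_apply]
      ring
  have hα : Symbol (frame m) (fun _ => 1) (fun z => alpha m z (frame m b z)) := by
    refine (Symbol.const (![1, Complex.I, 0, 0] b : ℂ)).congr ?_
    filter_upwards [eventually_ne_zero] with z hz using (alpha_frame hm hz b).symm
  refine ((((symbol_invR_one hm).mul_left (symbol_dR hm a)).smul_left hα).neg.add
    (((((symbol_dy₁ hm a).const_mul (4 * m)).smul_left hA).add hS).const_mul Complex.I)).congr ?_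
  filter_upwards [eventually_ne_zero] with z hz
  have h1 := frameDeriv_horiz hm hz a
  rw [frameDeriv] at h1
  have h2 : alpha m z (frame m b z) = Complex.I * symp (horiz m z) (frame m b z) := rfl
  rw [fderiv_alpha hm hz, h1, h2]
  simp only [map_add, map_neg, map_smul, add_apply, neg_apply, smul_apply, Complex.real_smul]
  ring

theorem fderiv_beta (z Z W : C2) : fderiv ℝ beta z Z W = -Complex.I * symp (axial Z) W := by
  have h' : HasFDerivAt beta _ z := ((symp.comp axial).hasFDerivAt (x := z)).const_smul (-Complex.I)
  rw [h'.fderiv]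
  rfl

/-- This is `dβ = 0`, as `β` is the differential of `y₂ + iy₃`. -/
theorem fderiv_beta_comm (z Z W : C2) : fderiv ℝ beta z Z W = fderiv ℝ beta z W Z := by
  rw [fderiv_beta, fderiv_beta]
  simp only [symp_apply, axial_zero, axial_one]
  ring

/-- The coefficients in the frame of the exterior derivatives of the coframe. -/
def dCoframe (m : ℝ) (c a b : Fin 4) (z : C2) : ℝ :=
  fderiv ℝ (coframe m c) z (frame m a z) (frame m b z)
    - fderiv ℝ (coframe m c) z (frame m b z) (frame m a z)

theorem fderiv_clm_comp (L : ℂ →L[ℝ] ℝ) {f : C2 → C2 →L[ℝ] ℂ} {z : C2}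
    (hf : DifferentiableAt ℝ f z) (Z W : C2) :
    fderiv ℝ (fun w => L ∘L f w) z Z W = L (fderiv ℝ f z Z W) := by
  have h := (hasFDerivAt_const L z).clm_comp hf.hasFDerivAt
  rw [h.fderiv]
  simp

theorem symbol_dCoframe (hm : 0 < m) (c a b : Fin 4) :
    Symbol (frame m) (fun _ => 1) (dCoframe m c a b) := by
  have hα := (symbol_fderiv_alpha hm a b).sub (symbol_fderiv_alpha hm b a)
  have hd : ∀ᶠ z in cobounded C2, DifferentiableAt ℝ (alpha m) z := by
    filter_upwards [eventually_ne_zero] with z hz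
    exact (contDiffAt_alpha hm hz).differentiableAt (by simp)
  have hβ : ∀ z, DifferentiableAt ℝ beta z :=
    fun z => contDiff_beta.contDiffAt.differentiableAt (by simp)
  fin_cases c
  · refine (hα.clm_comp Complex.reCLM).congr ?_
    filter_upwards [hd] with z hz
    rw [map_sub, ← fderiv_clm_comp _ hz, ← fderiv_clm_comp _ hz]
    rfl
  · refine (hα.clm_comp Complex.imCLM).congr ?_
    filter_upwards [hd] with z hz
    rw [map_sub, ← fderiv_clm_comp _ hz, ← fderiv_clm_comp _ hz]
    rfl
  · refine Symbol.zero.congr (Eventually.of_forall fun z => ?_)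
    symm
    refine sub_eq_zero.2 ?_
    refine ((fderiv_clm_comp Complex.reCLM (hβ z) _ _).trans ?_).trans
      (fderiv_clm_comp Complex.reCLM (hβ z) _ _).symm
    rw [fderiv_beta_comm]
  · refine Symbol.zero.congr (Eventually.of_forall fun z => ?_)
    symm
    refine sub_eq_zero.2 ?_
    refine ((fderiv_clm_comp Complex.imCLM (hβ z) _ _).trans ?_).trans
      (fderiv_clm_comp Complex.imCLM (hβ z) _ _).symm
    rw [fderiv_beta_comm]

/-! ### Orthonormal frames and the Levi-Civita connection -/

theorem metricDiag_pos (hm : 0 < m) {z : C2} (hz : z ≠ 0) (a : Fin 4) : 0 < metricDiag m a z := by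
  have := V_pos hm hz
  fin_cases a <;> simp [metricDiag, this]

/-- The normalised explicit frame shows that an orthonormal frame exists, so the arbitrary choice is
meaningful. -/
theorem isOrthonormalFrame_orthoFrame (hm : 0 < m) {z : C2} (hz : z ≠ 0) :
    IsOrthonormalFrame (metric m z) (orthoFrame (metric m z)) := by
  refine Classical.epsilon_spec (p := IsOrthonormalFrame (metric m z))
    ⟨fun a => (Real.sqrt (metricDiag m a z))⁻¹ • frame m a z, fun i j => ?_⟩
  have h : ∀ a, 0 < Real.sqrt (metricDiag m a z) := fun a => Real.sqrt_pos.2 (metricDiag_pos hm hz a)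
  rw [metric_eq_sum hm hz]
  simp only [map_smul, coframe_frame hm hz, smul_eq_mul]
  split_ifs with hij
  · subst hij
    rw [Finset.sum_eq_single i (by intro b _ hb; simp [hb]) (by simp)]
    have h1 := Real.mul_self_sqrt (metricDiag_pos hm hz i).le
    have h2 := (h i).ne'
    simp only [if_true]
    field_simp
    linarith
  · refine Finset.sum_eq_zero fun b _ => ?_
    by_cases hb : b = i
    · have : b ≠ j := fun h => hij (hb.symm.trans h)
      simp [this]
    · simp [hb]

/-- Orthonormality says that a square matrix has a one-sided inverse. Reversing the order of the
product gives the completeness relation, valid for whichever orthonormal frame was chosen. -/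
theorem sum_coframe_orthoFrame (hm : 0 < m) {z : C2} (hz : z ≠ 0) (b c : Fin 4) :
    metricDiag m b z * ∑ a, coframe m b z (orthoFrame (metric m z) a)
      * coframe m c z (orthoFrame (metric m z) a) = if b = c then 1 else 0 := by
  set e := orthoFrame (metric m z)
  have he : IsOrthonormalFrame (metric m z) e := isOrthonormalFrame_orthoFrame hm hz
  let A : Matrix (Fin 4) (Fin 4) ℝ := Matrix.of fun a b => coframe m b z (e a)
  let B : Matrix (Fin 4) (Fin 4) ℝ := Matrix.of fun b a => metricDiag m b z * coframe m b z (e a)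
  have hAB : A * B = 1 := by
    ext i j
    have := he i j
    rw [metric_eq_sum hm hz] at this
    rw [Matrix.mul_apply, Matrix.one_apply, ← this]
    refine Finset.sum_congr rfl fun b _ => ?_
    simp only [A, B, Matrix.of_apply]
    ring
  have hBA := congrArg (fun M : Matrix (Fin 4) (Fin 4) ℝ => M b c) (mul_eq_one_comm.1 hAB)
  rw [Matrix.mul_apply, Matrix.one_apply] at hBA
  rw [← hBA, Finset.mul_sum]
  refine Finset.sum_congr rfl fun a _ => ?_
  simp only [A, B, Matrix.of_apply]
  ring

theorem differentiableAt_metricDiag (hm : 0 < m) {z : C2} (hz : z ≠ 0) (a : Fin 4) :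
    DifferentiableAt ℝ (metricDiag m a) z := by
  have hR := ((contDiff_R hm).contDiffAt (x := z)).differentiableAt (by simp)
  have hRp := (R_pos hm hz).ne'
  have hV : DifferentiableAt ℝ (V m) z := by
    change DifferentiableAt ℝ (fun w => (1 + 4 * m * R m w) / (2 * R m w)) z
    simp only [div_eq_mul_inv]
    exact ((hR.const_mul (4 * m)).const_add 1).mul ((hR.const_mul 2).inv (by simpa using hRp))
  have hV' := hV.inv (V_pos hm hz).ne'
  fin_cases a
  · exact hV'
  · exact hV'
  · exact hV
  · exact hV

theorem differentiableAt_coframe (hm : 0 < m) {z : C2} (hz : z ≠ 0) (a : Fin 4) :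
    DifferentiableAt ℝ (coframe m a) z :=
  (contDiffAt_coframe hm hz a).differentiableAt (by simp)

theorem hasFDerivAt_coframe_apply (hm : 0 < m) {z : C2} (hz : z ≠ 0) (a : Fin 4) (W : C2) :
    HasFDerivAt (fun w => coframe m a w W) ((fderiv ℝ (coframe m a) z).flip W) z := by
  have h := (differentiableAt_coframe hm hz a).hasFDerivAt.clm_apply (hasFDerivAt_const W z)
  refine h.congr_fderiv ?_
  ext U
  simp

theorem fderiv_metric (hm : 0 < m) {z : C2} (hz : z ≠ 0) (U W Z : C2) :
    fderiv ℝ (fun w => metric m w W Z) z U = ∑ e, (fderiv ℝ (metricDiag m e) z U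
        * (coframe m e z W * coframe m e z Z)
      + metricDiag m e z * (fderiv ℝ (coframe m e) z U W * coframe m e z Z
        + coframe m e z W * fderiv ℝ (coframe m e) z U Z)) := by
  have h : HasFDerivAt
      (fun w => ∑ a, metricDiag m a w * (coframe m a w W * coframe m a w Z)) _ z :=
    HasFDerivAt.fun_sum fun e (_ : e ∈ Finset.univ) =>
    (differentiableAt_metricDiag hm hz e).hasFDerivAt.mul
      ((hasFDerivAt_coframe_apply hm hz e W).mul (hasFDerivAt_coframe_apply hm hz e Z))
  have h' := h.congr_of_eventuallyEq (f₁ := fun w => metric m w W Z) (by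
    filter_upwards [isOpen_ne.mem_nhds hz] with w hw using metric_eq_sum hm hw W Z)
  rw [h'.fderiv]
  simp only [sum_apply, add_apply, smul_apply, smul_eq_mul,
    ContinuousLinearMap.flip_apply]
  refine Finset.sum_congr rfl fun e _ => ?_
  ring

/-- The right hand side of the Koszul formula for constant vector fields. -/
def koszul (m : ℝ) (z U W Z : C2) : ℝ :=
  fderiv ℝ (fun w => metric m w W Z) z U + fderiv ℝ (fun w => metric m w U Z) z W
    - fderiv ℝ (fun w => metric m w U W) z Z

theorem koszul_eq_sum (hm : 0 < m) {z : C2} (hz : z ≠ 0) (U W Z : C2) :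
    koszul m z U W Z = ∑ b, coframe m b z Z * koszul m z U W (frame m b z) := by
  have h : IsLinearMap ℝ (koszul m z U W) := by
    constructor
    · intro x y
      simp only [koszul, fderiv_metric hm hz, map_add, add_apply, ← Finset.sum_add_distrib,
        ← Finset.sum_sub_distrib]
      exact Finset.sum_congr rfl fun _ _ => by ring
    · intro c x
      simp only [koszul, fderiv_metric hm hz, map_smul, smul_apply, smul_eq_mul,
        ← Finset.sum_add_distrib, ← Finset.sum_sub_distrib, Finset.mul_sum]
      exact Finset.sum_congr rfl fun _ _ => by ring
  conv_lhs => rw [← sum_coframe_smul_frame hm hz Z]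
  have := map_sum (h.mk' _) (fun a => coframe m a z Z • frame m a z) Finset.univ
  simp only [IsLinearMap.mk'_apply, h.map_smul, smul_eq_mul] at this
  exact this

/-- Completeness eliminates the chosen orthonormal frame, leaving the Koszul expression evaluated on
the explicit frame. -/
theorem coframe_christoffel (hm : 0 < m) {z : C2} (hz : z ≠ 0) (U W : C2) (c : Fin 4) :
    coframe m c z (christoffel (metric m) z U W)
      = (2 * metricDiag m c z)⁻¹ * koszul m z U W (frame m c z) := by
  have h1 : coframe m c z (christoffel (metric m) z U W) =
      ∑ a, koszul m z U W (orthoFrame (metric m z) a) / 2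
        * coframe m c z (orthoFrame (metric m z) a) := by
    rw [christoffel, map_sum]
    simp only [map_smul, smul_eq_mul]
    rfl
  rw [h1]
  simp only [koszul_eq_sum hm hz U W (orthoFrame (metric m z) _)]
  have h2 : ∀ a, (∑ b, coframe m b z (orthoFrame (metric m z) a)
        * koszul m z U W (frame m b z)) / 2 * coframe m c z (orthoFrame (metric m z) a)
      = ∑ b, koszul m z U W (frame m b z) / 2 * (coframe m b z (orthoFrame (metric m z) a)
        * coframe m c z (orthoFrame (metric m z) a)) := by
    intro a
    rw [Finset.sum_div, Finset.sum_mul]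
    exact Finset.sum_congr rfl fun _ _ => by ring
  simp only [h2]
  rw [Finset.sum_comm]
  simp only [← Finset.mul_sum]
  rw [Finset.sum_eq_single c]
  · have h3 := sum_coframe_orthoFrame hm hz c c
    have h4 := (metricDiag_pos hm hz c).ne'
    rw [if_pos rfl] at h3
    rw [eq_div_of_mul_eq h4 ((mul_comm _ _).trans h3)]
    field_simp
  · intro b _ hb
    have h3 := sum_coframe_orthoFrame hm hz b c
    rw [if_neg hb] at h3
    rw [(mul_eq_zero.1 h3).resolve_left (metricDiag_pos hm hz b).ne', mul_zero]
  · simp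

/-- The covariant derivative of the coframe, as a bilinear form. -/
def nablaCoframe (m : ℝ) (c : Fin 4) (z U W : C2) : ℝ :=
  (fderiv ℝ (coframe m c) z U W - fderiv ℝ (coframe m c) z W U) / 2
    - (2 * metricDiag m c z)⁻¹ * (fderiv ℝ (metricDiag m c) z U * coframe m c z W
      + fderiv ℝ (metricDiag m c) z W * coframe m c z U
      + ∑ e, (metricDiag m e z * (coframe m e z W * (fderiv ℝ (coframe m e) z U (frame m c z)
          - fderiv ℝ (coframe m e) z (frame m c z) U)
        + coframe m e z U * (fderiv ℝ (coframe m e) z W (frame m c z)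
          - fderiv ℝ (coframe m e) z (frame m c z) W))
        - fderiv ℝ (metricDiag m e) z (frame m c z) * (coframe m e z U * coframe m e z W)))

/-- The symmetric part of the euclidean derivative of the coframe cancels against the Christoffel
term. What survives involves that derivative only through exterior derivatives of the coframe, whose
coefficients are symbols. -/
theorem fderiv_sub_coframe_christoffel (hm : 0 < m) {z : C2} (hz : z ≠ 0) (U W : C2)
    (c : Fin 4) :
    fderiv ℝ (coframe m c) z U W - coframe m c z (christoffel (metric m) z U W)
      = nablaCoframe m c z U W := by
  have hg := (metricDiag_pos hm hz c).ne'
  rw [coframe_christoffel hm hz, koszul, fderiv_metric hm hz, fderiv_metric hm hz,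
    fderiv_metric hm hz, nablaCoframe]
  simp only [coframe_frame hm hz]
  have hs : ∀ f : Fin 4 → ℝ, ∑ e, f e * (if e = c then (1 : ℝ) else 0) = f c := by
    intro f
    simp
  have e1 : ∀ (U W : C2), ∑ e, (fderiv ℝ (metricDiag m e) z U
        * (coframe m e z W * (if e = c then (1 : ℝ) else 0))
      + metricDiag m e z * (fderiv ℝ (coframe m e) z U W * (if e = c then (1 : ℝ) else 0)
        + coframe m e z W * fderiv ℝ (coframe m e) z U (frame m c z)))
      = fderiv ℝ (metricDiag m c) z U * coframe m c z W
        + metricDiag m c z * fderiv ℝ (coframe m c) z U W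
        + ∑ e, metricDiag m e z * (coframe m e z W * fderiv ℝ (coframe m e) z U (frame m c z)) := by
    intro U W
    rw [← hs (fun e => fderiv ℝ (metricDiag m e) z U * coframe m e z W),
      ← hs (fun e => metricDiag m e z * fderiv ℝ (coframe m e) z U W), ← Finset.sum_add_distrib,
      ← Finset.sum_add_distrib]
    exact Finset.sum_congr rfl fun _ _ => by ring
  rw [e1, e1]
  have e2 : ∀ (p q r s : Fin 4 → ℝ), (∀ e, p e + q e - r e = s e) →
      ∑ e, s e = ∑ e, p e + ∑ e, q e - ∑ e, r e := by
    intro p q r s h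
    rw [← Finset.sum_add_distrib, ← Finset.sum_sub_distrib]
    exact Finset.sum_congr rfl fun e _ => (h e).symm
  rw [e2 (fun e => metricDiag m e z * (coframe m e z W
      * fderiv ℝ (coframe m e) z U (frame m c z)))
    (fun e => metricDiag m e z * (coframe m e z U * fderiv ℝ (coframe m e) z W (frame m c z)))
    (fun e => fderiv ℝ (metricDiag m e) z (frame m c z) * (coframe m e z U * coframe m e z W)
      + metricDiag m e z * (fderiv ℝ (coframe m e) z (frame m c z) U * coframe m e z W
        + coframe m e z U * fderiv ℝ (coframe m e) z (frame m c z) W))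
    (fun e => metricDiag m e z * (coframe m e z W * (fderiv ℝ (coframe m e) z U (frame m c z)
          - fderiv ℝ (coframe m e) z (frame m c z) U)
        + coframe m e z U * (fderiv ℝ (coframe m e) z W (frame m c z)
          - fderiv ℝ (coframe m e) z (frame m c z) W))
        - fderiv ℝ (metricDiag m e) z (frame m c z) * (coframe m e z U * coframe m e z W))
    (fun e => by ring)]
  field_simp
  ring

theorem nablaCoframe_eq_sum (hm : 0 < m) {z : C2} (hz : z ≠ 0) (c : Fin 4) (U W : C2) :
    nablaCoframe m c z U W = ∑ a, ∑ b, coframe m a z U * coframe m b z W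
      * nablaCoframe m c z (frame m a z) (frame m b z) := by
  let L : C2 →ₗ[ℝ] C2 →ₗ[ℝ] ℝ := LinearMap.mk₂ ℝ (nablaCoframe m c z)
    (by
      intro x y W
      simp only [nablaCoframe, map_add, add_apply, Fin.sum_univ_four]
      ring)
    (by
      intro t x W
      simp only [nablaCoframe, map_smul, smul_apply, smul_eq_mul, Fin.sum_univ_four]
      ring)
    (by
      intro U x y
      simp only [nablaCoframe, map_add, add_apply, Fin.sum_univ_four]
      ring)
    (by
      intro t U x
      simp only [nablaCoframe, map_smul, smul_apply, smul_eq_mul, Fin.sum_univ_four]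
      ring)
  have h : L U W = ∑ a, ∑ b, coframe m a z U * coframe m b z W
      * L (frame m a z) (frame m b z) := by
    conv_lhs => rw [← sum_coframe_smul_frame hm hz U, ← sum_coframe_smul_frame hm hz W]
    simp only [map_sum, map_smul, LinearMap.sum_apply, LinearMap.smul_apply, smul_eq_mul,
      Finset.mul_sum]
    rw [Finset.sum_comm]
    exact Finset.sum_congr rfl fun a _ => Finset.sum_congr rfl fun b _ => by ring
  exact h

theorem symbol_metricDiag (hm : 0 < m) (a : Fin 4) :
    Symbol (frame m) (fun _ => 1) (metricDiag m a) := by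
  fin_cases a
  · exact symbol_invV hm
  · exact symbol_invV hm
  · exact symbol_V hm
  · exact symbol_V hm

theorem symbol_inv_metricDiag (hm : 0 < m) (a : Fin 4) :
    Symbol (frame m) (fun _ => 1) (fun z => (metricDiag m a z)⁻¹) := by
  fin_cases a
  · simpa [metricDiag] using symbol_V hm
  · simpa [metricDiag] using symbol_V hm
  · exact symbol_invV hm
  · exact symbol_invV hm

theorem symbol_coframe_frame (hm : 0 < m) (a b : Fin 4) :
    Symbol (frame m) (fun _ => 1) (fun z => coframe m a z (frame m b z)) := by
  refine (Symbol.const (if a = b then (1 : ℝ) else 0)).congr ?_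
  filter_upwards [eventually_ne_zero] with z hz using (coframe_frame hm hz a b).symm

theorem symbol_nablaCoframe (hm : 0 < m) (c a b : Fin 4) :
    Symbol (frame m) (fun _ => 1)
      (fun z => nablaCoframe m c z (frame m a z) (frame m b z)) := by
  have hθ := symbol_coframe_frame hm
  have hg := symbol_metricDiag hm
  have hd := symbol_dCoframe hm
  have h1 := ((hd c a b).const_mul (1 / 2)).sub
    (((symbol_inv_metricDiag hm c).const_mul (1 / 2)).mul_left
      (((((hg c).frameDeriv a).mul_left (hθ c b)).add (((hg c).frameDeriv b).mul_left (hθ c a))).add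
        (Symbol.sum Finset.univ fun e _ =>
          ((hg e).mul_left (((hθ e b).mul_left (hd e a c)).add ((hθ e a).mul_left (hd e b c)))).sub
            (((hg e).frameDeriv c).mul_left ((hθ e a).mul_left (hθ e b))))))
  refine h1.congr (Eventually.of_forall fun z => ?_)
  simp only [nablaCoframe, frameDeriv, dCoframe, mul_inv]
  ring

/-! ### Symbol classes of tensors -/

/-- The tensor fields spanned, near infinity, by the products of the coframe with coefficients in
the symbol class of weight `w`. -/
inductive TensorSymbol (m : ℝ) (w : C2 → ℝ) : (k : ℕ) → CTensor k → Prop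
  | elem {k : ℕ} (f : C2 → ℂ) (hf : Symbol (frame m) w f) (i : Fin k → Fin 4) :
      TensorSymbol m w k (fun z Z => (∏ j, coframe m (i j) z (Z j)) • f z)
  | add {k : ℕ} {S T : CTensor k} : TensorSymbol m w k S → TensorSymbol m w k T →
      TensorSymbol m w k (fun z Z => S z Z + T z Z)
  | congr {k : ℕ} {S T : CTensor k} : TensorSymbol m w k S →
      (∀ᶠ z in cobounded C2, S z = T z) → TensorSymbol m w k T

namespace TensorSymbol

variable {w : C2 → ℝ} {k : ℕ}

theorem sum {κ : Type*} (s : Finset κ) {T : κ → CTensor k}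
    (h : ∀ a ∈ s, TensorSymbol m w k (T a)) :
    TensorSymbol m w k (fun z Z => ∑ a ∈ s, T a z Z) := by
  classical
  induction s using Finset.induction_on with
  | empty =>
    refine (elem _ Symbol.zero fun _ => 0).congr (Eventually.of_forall fun z => ?_)
    funext Z
    simp
  | insert a s ha ih =>
    simp only [Finset.sum_insert ha]
    exact (h a (Finset.mem_insert_self _ _)).add
      (ih fun b hb => h b (Finset.mem_insert_of_mem hb))

theorem differentiableAt (hm : 0 < m) {T : CTensor k} (h : TensorSymbol m w k T) :
    ∀ᶠ z in cobounded C2, ∀ Z, DifferentiableAt ℝ (fun x => T x Z) z := by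
  induction h with
  | elem f hf i =>
    filter_upwards [hf.smooth.differentiableAt, eventually_ne_zero] with z h1 h2 Z
    refine DifferentiableAt.fun_smul ?_ h1
    exact (HasFDerivAt.finsetProd (u := Finset.univ)
      (g := fun j x => coframe m (i j) x (Z j)) fun j _ =>
      hasFDerivAt_coframe_apply hm h2 (i j) (Z j)).differentiableAt
  | add _ _ h1 h2 =>
    filter_upwards [h1, h2] with z h1 h2 Z using (h1 Z).fun_add (h2 Z)
  | congr _ h ih =>
    filter_upwards [ih, eventually_cobounded_eventually_nhds h] with z h1 h2 Z
    exact (h1 Z).congr_of_eventuallyEq (h2.mono fun x hx => (congrFun hx Z).symm)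

/-- By Leibniz the derivative falls on the coefficient, giving frame derivatives of `f`, or on one
coframe factor, giving its covariant derivative; the latter expands in the coframe with symbol
coefficients. -/
theorem covDeriv_elem (hm : 0 < m) {f : C2 → ℂ} (hf : Symbol (frame m) w f) (i : Fin k → Fin 4) :
    TensorSymbol m w (k + 1)
      (covDeriv (metric m) fun z Z => (∏ j, coframe m (i j) z (Z j)) • f z) := by
  have h1 : TensorSymbol m w (k + 1) (fun z Z => ∑ a,
      (∏ j, coframe m ((Fin.cons a i : Fin (k + 1) → Fin 4) j) z (Z j))
        • frameDeriv (frame m) a f z) :=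
    sum _ fun a _ => elem _ (hf.frameDeriv a) _
  have h2 : TensorSymbol m w (k + 1) (fun z Z => ∑ j, ∑ a, ∑ b,
      (∏ l, coframe m ((Fin.cons a (Function.update i j b) : Fin (k + 1) → Fin 4) l) z (Z l))
        • (nablaCoframe m (i j) z (frame m a z) (frame m b z) • f z)) :=
    sum _ fun j _ => sum _ fun a _ => sum _ fun b _ =>
      elem _ ((symbol_nablaCoframe hm (i j) a b).smul_left hf) _
  refine (h1.add h2).congr ?_
  filter_upwards [eventually_ne_zero, hf.smooth.differentiableAt] with z hz hfz
  funext Z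
  have hd : HasFDerivAt (fun x => (∏ j, coframe m (i j) x (Fin.tail Z j)) • f x) _ z :=
    (HasFDerivAt.finsetProd (g := fun j x => coframe m (i j) x (Fin.tail Z j))
      fun j (_ : j ∈ Finset.univ) =>
      hasFDerivAt_coframe_apply hm hz (i j) (Fin.tail Z j)).smul hfz.hasFDerivAt
  rw [covDeriv, hd.fderiv]
  have hU : ∀ (j : Fin k) (U : C2),
      ∏ l, coframe m (i l) z (Function.update (Fin.tail Z) j U l)
        = (∏ l ∈ Finset.univ.erase j, coframe m (i l) z (Fin.tail Z l)) * coframe m (i j) z U := by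
    intro j U
    rw [← Finset.prod_erase_mul _ _ (Finset.mem_univ j), Function.update_self]
    congr 1
    refine Finset.prod_congr rfl fun l hl => ?_
    rw [Function.update_of_ne (Finset.ne_of_mem_erase hl)]
  have hI : ∀ (j : Fin k) (b : Fin 4),
      ∏ l, coframe m (Function.update i j b l) z (Fin.tail Z l)
        = (∏ l ∈ Finset.univ.erase j, coframe m (i l) z (Fin.tail Z l))
          * coframe m b z (Fin.tail Z j) := by
    intro j b
    rw [← Finset.prod_erase_mul _ _ (Finset.mem_univ j), Function.update_self]
    congr 1
    refine Finset.prod_congr rfl fun l hl => ?_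
    rw [Function.update_of_ne (Finset.ne_of_mem_erase hl)]
  have hc : ∀ (a : Fin 4) (i' : Fin k → Fin 4),
      ∏ l, coframe m ((Fin.cons a i' : Fin (k + 1) → Fin 4) l) z (Z l)
        = coframe m a z (Z 0) * ∏ l, coframe m (i' l) z (Fin.tail Z l) := by
    intro a i'
    rw [Fin.prod_univ_succ]
    rfl
  have hfd : fderiv ℝ f z (Z 0) = ∑ a, coframe m a z (Z 0) • frameDeriv (frame m) a f z := by
    conv_lhs => rw [← sum_coframe_smul_frame hm hz (Z 0)]
    simp only [map_sum, map_smul, frameDeriv]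
  have hn : ∀ j : Fin k, ∑ a, ∑ b,
      (∏ l, coframe m ((Fin.cons a (Function.update i j b) : Fin (k + 1) → Fin 4) l) z (Z l))
        • (nablaCoframe m (i j) z (frame m a z) (frame m b z) • f z)
      = ((∏ l ∈ Finset.univ.erase j, coframe m (i l) z (Fin.tail Z l))
        * (fderiv ℝ (coframe m (i j)) z (Z 0) (Fin.tail Z j)
          - coframe m (i j) z (christoffel (metric m) z (Z 0) (Fin.tail Z j)))) • f z := by
    intro j
    rw [fderiv_sub_coframe_christoffel hm hz, nablaCoframe_eq_sum hm hz]
    simp only [hc, hI, Finset.mul_sum, Finset.sum_smul]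
    refine Finset.sum_congr rfl fun a _ => Finset.sum_congr rfl fun b _ => ?_
    rw [smul_smul]
    congr 1
    ring
  simp only [hn]
  simp only [hc, hU]
  simp only [add_apply, smul_apply, ContinuousLinearMap.smulRight_apply,
    sum_apply, ContinuousLinearMap.flip_apply, hfd, smul_eq_mul]
  rw [Finset.smul_sum, Finset.sum_smul, add_sub_assoc, ← Finset.sum_sub_distrib]
  congr 1
  · refine Finset.sum_congr rfl fun a _ => ?_
    rw [smul_smul, mul_comm]
  · refine Finset.sum_congr rfl fun j _ => ?_
    rw [← sub_smul, mul_sub]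
    rfl

theorem covDeriv_tensor (hm : 0 < m) {T : CTensor k} (h : TensorSymbol m w k T) :
    TensorSymbol m w (k + 1) (covDeriv (metric m) T) := by
  induction h with
  | elem f hf i => exact covDeriv_elem hm hf i
  | add hS hT h1 h2 =>
    refine (h1.add h2).congr ?_
    filter_upwards [hS.differentiableAt hm, hT.differentiableAt hm] with z d1 d2
    funext Z
    simp only [covDeriv]
    rw [fderiv_fun_add (d1 _) (d2 _), add_apply, Finset.sum_add_distrib]
    abel
  | congr _ h ih =>
    refine ih.congr ?_
    filter_upwards [eventually_cobounded_eventually_nhds h] with z hz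
    funext Z
    have h0 := hz.self_of_nhds
    have h1 := EventuallyEq.fderiv_eq (𝕜 := ℝ)
      (hz.mono fun x hx => (congrFun hx (Fin.tail Z)))
    simp only [covDeriv, h0]
    rw [h1]

theorem iterCovDeriv_tensor (hm : 0 < m) {T : CTensor k} (h : TensorSymbol m w k T) (l : ℕ) :
    TensorSymbol m w (k + l) (iterCovDeriv (metric m) l T) := by
  induction l with
  | zero => exact h
  | succ l ih => exact ih.covDeriv_tensor hm

theorem norm_apply_le {T : CTensor k} (h : TensorSymbol m w k T) (B : ℝ) :
    ∃ C : ℝ, 0 ≤ C ∧ ∀ᶠ z in cobounded C2, ∀ Z : Fin k → C2,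
      (∀ j a, |coframe m a z (Z j)| ≤ B) → ‖T z Z‖ ≤ C * ‖w z‖ := by
  induction h with
  | elem f hf i =>
    obtain ⟨C, hC, hC'⟩ := hf.isBigO.exists_nonneg
    refine ⟨|B| ^ k * C, by positivity, ?_⟩
    filter_upwards [hC'.bound] with z hz Z hZ
    rw [norm_smul, mul_assoc]
    refine mul_le_mul ?_ hz (norm_nonneg _) (by positivity)
    rw [norm_prod]
    refine (Finset.prod_le_prod (fun _ _ => norm_nonneg _)
      fun j _ => (hZ j (i j)).trans (le_abs_self B)).trans ?_
    simp
  | add _ _ h1 h2 =>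
    obtain ⟨C₁, p1, h1⟩ := h1
    obtain ⟨C₂, p2, h2⟩ := h2
    refine ⟨C₁ + C₂, by positivity, ?_⟩
    filter_upwards [h1, h2] with z h1 h2 Z hZ
    rw [add_mul]
    exact (norm_add_le _ _).trans (add_le_add (h1 Z hZ) (h2 Z hZ))
  | congr _ h ih =>
    obtain ⟨C, p, ih⟩ := ih
    refine ⟨C, p, ?_⟩
    filter_upwards [h, ih] with z h ih
    rwa [← h]

/-- A unit vector has squared coframe components at most the inverse metric coefficients, which are
bounded near infinity. So orthonormal arguments are admissible in `norm_apply_le` with one constant.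
-/
theorem tensorNorm_isBigO (hm : 0 < m) {T : CTensor k} (h : TensorSymbol m w k T) :
    tensorNorm (metric m) T =O[cobounded C2] w := by
  have hg : ∀ a, ∃ c : ℝ, ∀ᶠ z in cobounded C2, (metricDiag m a z)⁻¹ ≤ c := fun a => by
    obtain ⟨c, hc⟩ := (symbol_inv_metricDiag hm a).isBigO.bound
    refine ⟨c, hc.mono fun z hz => ?_⟩
    simpa using (le_abs_self _).trans hz
  choose c hc using hg
  set c₀ := ∑ a, |c a| with hc₀
  have hco : ∀ᶠ z in cobounded C2, ∀ (j a : Fin 4),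
      |coframe m a z (orthoFrame (metric m z) j)| ≤ Real.sqrt c₀ := by
    filter_upwards [eventually_ne_zero, eventually_all.2 hc] with z hz hcz j a
    have h1 := isOrthonormalFrame_orthoFrame hm hz j j
    rw [metric_eq_sum hm hz, if_pos rfl] at h1
    have hp := metricDiag_pos hm hz
    have h2 : metricDiag m a z * (coframe m a z (orthoFrame (metric m z) j)
        * coframe m a z (orthoFrame (metric m z) j)) ≤ 1 := by
      rw [← h1]
      exact Finset.single_le_sum (f := fun a => metricDiag m a z *
        (coframe m a z (orthoFrame (metric m z) j) * coframe m a z (orthoFrame (metric m z) j)))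
        (fun b _ => mul_nonneg (hp b).le (mul_self_nonneg _)) (Finset.mem_univ a)
    have h3 : c a ≤ c₀ := (le_abs_self _).trans
      (Finset.single_le_sum (f := fun a => |c a|) (fun _ _ => abs_nonneg _) (Finset.mem_univ a))
    refine Real.abs_le_sqrt ?_
    rw [sq]
    refine le_trans ?_ ((hcz a).trans h3)
    rwa [← one_div, le_div_iff₀' (hp a)]
  obtain ⟨C, hC, hT⟩ := h.norm_apply_le (Real.sqrt c₀)
  refine IsBigO.of_bound (Real.sqrt (Fintype.card (Fin k → Fin 4)) * C) ?_
  filter_upwards [hco, hT] with z h1 h2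
  rw [tensorNorm, Real.norm_of_nonneg (Real.sqrt_nonneg _)]
  have h3 : ∑ i : Fin k → Fin 4, ‖T z (fun a => orthoFrame (metric m z) (i a))‖ ^ 2
      ≤ Fintype.card (Fin k → Fin 4) * (C * ‖w z‖) ^ 2 := by
    refine (Finset.sum_le_card_nsmul _ _ ((C * ‖w z‖) ^ 2) fun i _ => ?_).trans ?_
    · exact pow_le_pow_left₀ (norm_nonneg _) (h2 _ fun j a => h1 (i j) a) 2
    · simp
  refine (Real.sqrt_le_sqrt h3).trans ?_
  rw [Real.sqrt_mul (by positivity), Real.sqrt_sq (by positivity), mul_assoc]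

/-- The exterior derivative of a 1-form whose components in the frame are symbols. -/
theorem of_extDeriv (hm : 0 < m) {γ : C2 → C2 →L[ℝ] ℂ}
    (h : ∀ a, Symbol (frame m) w (fun z => γ z (frame m a z))) :
    TensorSymbol m w 2 (fun z Z => fderiv ℝ (fun x => γ x (Z 1)) z (Z 0)
      - fderiv ℝ (fun x => γ x (Z 0)) z (Z 1)) := by
  have h1 : TensorSymbol m w 2 (fun z Z => ∑ a : Fin 4, ∑ b : Fin 4,
      (∏ j, coframe m ((![a, b] : Fin 2 → Fin 4) j) z (Z j))
        • (frameDeriv (frame m) a (fun z => γ z (frame m b z)) z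
          - frameDeriv (frame m) b (fun z => γ z (frame m a z)) z
          + ∑ c, dCoframe m c a b z • γ z (frame m c z))) :=
    sum _ fun a _ => sum _ fun b _ => elem _
      ((((h b).frameDeriv a).sub ((h a).frameDeriv b)).add
        (Symbol.sum _ fun c _ => (symbol_dCoframe hm c a b).smul_left (h c))) _
  refine h1.congr ?_
  filter_upwards [eventually_ne_zero,
    eventually_all.2 fun a => (h a).smooth.differentiableAt] with z hz hd
  funext Z
  -- Only the components of `γ` in the frame are controlled, so `γ` is differentiated after
  -- expansion in the coframe; antisymmetrising then leaves just `dCoframe`.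
  have hγ : ∀ U W, fderiv ℝ (fun x => γ x W) z U
      = ∑ c, (coframe m c z W • fderiv ℝ (fun x => γ x (frame m c x)) z U
        + fderiv ℝ (coframe m c) z U W • γ z (frame m c z)) := by
    intro U W
    have hs : HasFDerivAt (fun x => ∑ c, coframe m c x W • γ x (frame m c x)) _ z :=
      HasFDerivAt.fun_sum fun c (_ : c ∈ Finset.univ) =>
        (hasFDerivAt_coframe_apply hm hz c W).smul (hd c).hasFDerivAt
    have hs' := hs.congr_of_eventuallyEq (f₁ := fun x => γ x W) (by
      filter_upwards [isOpen_ne.mem_nhds hz] with x hx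
      conv_lhs => rw [← sum_coframe_smul_frame hm hx W]
      simp only [map_sum, map_smul])
    rw [hs'.fderiv]
    simp only [sum_apply, add_apply, smul_apply,
      ContinuousLinearMap.smulRight_apply, ContinuousLinearMap.flip_apply]
  rw [hγ, hγ]
  have e1 : ∀ (L : C2 →L[ℝ] ℂ) (U : C2), L U = ∑ a, coframe m a z U • L (frame m a z) := by
    intro L U
    conv_lhs => rw [← sum_coframe_smul_frame hm hz U]
    simp only [map_sum, map_smul]
  have e2 : ∀ c, fderiv ℝ (coframe m c) z (Z 0) (Z 1) - fderiv ℝ (coframe m c) z (Z 1) (Z 0)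
      = ∑ a, ∑ b, coframe m a z (Z 0) * coframe m b z (Z 1) * dCoframe m c a b z := by
    intro c
    have : ∀ U W, fderiv ℝ (coframe m c) z U W = ∑ a, ∑ b, coframe m a z U * coframe m b z W
        * fderiv ℝ (coframe m c) z (frame m a z) (frame m b z) := by
      intro U W
      conv_lhs => rw [← sum_coframe_smul_frame hm hz U, ← sum_coframe_smul_frame hm hz W]
      simp only [map_sum, map_smul, sum_apply, smul_apply, smul_eq_mul,
        Finset.mul_sum]
      rw [Finset.sum_comm]
      exact Finset.sum_congr rfl fun a _ => Finset.sum_congr rfl fun b _ => by ring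
    rw [this, this (Z 1), Finset.sum_comm (f := fun a b => coframe m a z (Z 1)
      * coframe m b z (Z 0) * _), ← Finset.sum_sub_distrib]
    refine Finset.sum_congr rfl fun a _ => ?_
    rw [← Finset.sum_sub_distrib]
    refine Finset.sum_congr rfl fun b _ => ?_
    rw [dCoframe]
    ring
  simp only [Fin.prod_univ_two, Matrix.cons_val_zero, Matrix.cons_val_one, frameDeriv, smul_add,
    smul_sub, Finset.sum_add_distrib, Finset.sum_sub_distrib]
  rw [add_sub_add_comm, ← Finset.sum_sub_distrib (fun c => fderiv ℝ (coframe m c) z (Z 0) (Z 1) • _)]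
  simp only [← sub_smul, e2]
  congr 1
  · congr 1
    · rw [Finset.sum_comm]
      refine Finset.sum_congr rfl fun b _ => ?_
      rw [e1 _ (Z 0), Finset.smul_sum]
      refine Finset.sum_congr rfl fun a _ => ?_
      rw [smul_smul, mul_comm]
    · refine Finset.sum_congr rfl fun a _ => ?_
      rw [e1 _ (Z 1), Finset.smul_sum]
      refine Finset.sum_congr rfl fun b _ => ?_
      rw [smul_smul]
  · simp only [Finset.smul_sum, Finset.sum_smul, smul_smul]
    symm
    rw [Finset.sum_comm]
    refine Finset.sum_congr rfl fun a _ => ?_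
    rw [Finset.sum_comm]

end TensorSymbol

/-! ### The function `ψ_c` -/

/-- The factor `cosh(4my₁)` in `r²` turns the unbounded `sinh` into `tanh`, exhibiting `ψ_c` as a
product of bounded symbols and `1/R`. -/
theorem psiC_eq (hm : 0 < m) {z : C2} (hz : z ≠ 0) :
    psiC m z = (-(1 / 8) * (tanhY m z * radialQuot m z)) • (invR m z • dirC m z) := by
  have hR := ofReal_R_ne_zero hm hz
  have h1 : ((‖z‖ ^ 2 * R m z : ℝ) : ℂ)⁻¹
      = ((sechY m z * invR m z * radialQuot m z / 2 * invR m z : ℝ) : ℂ) := by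
    rw [← inv_norm_sq_eq hm hz, invR, ← mul_inv]
    push_cast
    rfl
  rw [psiC, div_eq_mul_inv, h1, dirC, tanhY_eq]
  simp only [Complex.real_smul]
  push_cast
  ring

theorem symbol_invR_smul_dirC (hm : 0 < m) :
    Symbol (frame m) (invR m) (fun z => invR m z • dirC m z) := by
  simpa using (symbol_invR hm).smul (symbol_dirC hm)

theorem symbol_psiC (hm : 0 < m) : Symbol (frame m) (invR m) (psiC m) := by
  refine ((((symbol_tanhY hm).mul_left (symbol_radialQuot hm)).const_mul (-(1 / 8))).smul_left
    (symbol_invR_smul_dirC hm)).congr ?_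
  filter_upwards [eventually_ne_zero] with z hz using (psiC_eq hm hz).symm

theorem symbol_frameDeriv_dirY (hm : 0 < m) (a : Fin 4) :
    Symbol (frame m) (invR m) (frameDeriv (frame m) a (dirY m)) := by
  have h := (symbol_invR hm).mul
    ((symbol_dy₁ hm a).sub ((symbol_dR hm a).mul_left (symbol_dirY hm)))
  simp only [mul_one] at h
  refine h.congr ?_
  filter_upwards [eventually_ne_zero] with z hz using (frameDeriv_dirY hm hz a).symm

theorem frameDeriv_invR_smul_dirC (hm : 0 < m) {z : C2} (hz : z ≠ 0) (a : Fin 4) :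
    frameDeriv (frame m) a (fun z => invR m z • dirC m z) z =
      (invR m z * invR m z) • (dyC a - (2 * dR m a z) • dirC m z) := by
  have h1 := (hasFDerivAt_invR hm hz).differentiableAt
  have h2 : DifferentiableAt ℝ (dirC m) z := h1.smul (hasFDerivAt_yC z).differentiableAt
  have h3 := frameDeriv_invR hm hz a
  have h4 := frameDeriv_dirC hm hz a
  rw [frameDeriv] at h3 h4
  rw [frameDeriv, fderiv_fun_smul h1 h2, add_apply, smul_apply,
    ContinuousLinearMap.smulRight_apply, h3, h4]
  module

theorem symbol_frameDeriv_invR_smul_dirC (hm : 0 < m) (a : Fin 4) :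
    Symbol (frame m) (fun z => invR m z * invR m z)
      (frameDeriv (frame m) a (fun z => invR m z • dirC m z)) := by
  have h := ((symbol_invR hm).mul (symbol_invR hm)).smul ((Symbol.const (dyC a)).sub
    (((symbol_dR hm a).const_mul 2).smul_left (symbol_dirC hm)))
  simp only [mul_one] at h
  refine h.congr ?_
  filter_upwards [eventually_ne_zero] with z hz using (frameDeriv_invR_smul_dirC hm hz a).symm

/-- The part of the derivative of `ψ_c` along the frame which is `O(R⁻²)`. -/
def psiRemainder (m : ℝ) (a : Fin 4) (z : C2) : ℂ :=
  (1 / 8 * (tanhY m z * (tanhY m z * (radialQuot m z * radialQuot m z)))) •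
      (frameDeriv (frame m) a (dirY m) z • (invR m z • dirC m z))
    - (1 / 8 * (tanhY m z * radialQuot m z)) •
      frameDeriv (frame m) a (fun z => invR m z • dirC m z) z

theorem symbol_psiRemainder (hm : 0 < m) (a : Fin 4) :
    Symbol (frame m) (fun z => invR m z * invR m z) (psiRemainder m a) := by
  have hT := symbol_tanhY hm
  have hq := symbol_radialQuot hm
  exact (((hT.mul_left (hT.mul_left (hq.mul_left hq))).const_mul (1 / 8)).smul_left
      ((symbol_frameDeriv_dirY hm a).smul (symbol_invR_smul_dirC hm))).sub
    (((hT.mul_left hq).const_mul (1 / 8)).smul_left (symbol_frameDeriv_invR_smul_dirC hm a))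

theorem frameDeriv_radialQuot (hm : 0 < m) {z : C2} (hz : z ≠ 0) (a : Fin 4) :
    frameDeriv (frame m) a (radialQuot m) z = -(radialQuot m z * radialQuot m z) *
      (dirY m z * frameDeriv (frame m) a (tanhY m) z
        + tanhY m z * frameDeriv (frame m) a (dirY m) z) := by
  have h0 : 1 + dirY m z * tanhY m z ≠ 0 := (one_pos.trans_le (one_le_radial hm z)).ne'
  have h1 : DifferentiableAt ℝ (dirY m) z :=
    (hasFDerivAt_invR hm hz).differentiableAt.mul
      (((contDiff_y₁ hm).contDiffAt (x := z)).differentiableAt (by simp))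
  have h2 := (hasFDerivAt_tanhY hm z).differentiableAt
  have h : HasFDerivAt (radialQuot m) _ z := (hasDerivAt_inv h0).comp_hasFDerivAt z
    ((h1.hasFDerivAt.mul h2.hasFDerivAt).const_add 1)
  rw [frameDeriv, h.fderiv]
  simp only [smul_apply, add_apply, smul_eq_mul, frameDeriv, radialQuot, ← inv_pow]
  ring

/-- The derivative of `tanh(4my₁)` also enters through `radialQuot`. The two contributions merge by
`q(1 + (y₁/R) tanh(4my₁)) = 1`, leaving a single term with `q² sech²`, proportional to `r⁻⁴(y₂ +
iy₃)`. -/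
theorem frameDeriv_psiC (hm : 0 < m) {z : C2} (hz : z ≠ 0) (a : Fin 4) :
    frameDeriv (frame m) a (psiC m) z = psiRemainder m a z
      - (1 / 8 * (radialQuot m z ^ 2 * (4 * m * (sechY m z ^ 2 * dy₁ m a z)))) •
        (invR m z • dirC m z) := by
  have hI := (hasFDerivAt_invR hm hz).differentiableAt
  have hC : DifferentiableAt ℝ (dirC m) z := hI.smul (hasFDerivAt_yC z).differentiableAt
  have hT := (hasFDerivAt_tanhY hm z).differentiableAt
  have h1 : DifferentiableAt ℝ (dirY m) z :=
    hI.mul (((contDiff_y₁ hm).contDiffAt (x := z)).differentiableAt (by simp))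
  have h0 : 1 + dirY m z * tanhY m z ≠ 0 := (one_pos.trans_le (one_le_radial hm z)).ne'
  have hq : DifferentiableAt ℝ (radialQuot m) z := ((h1.mul hT).const_add 1).inv h0
  have h := (((hT.hasFDerivAt.mul hq.hasFDerivAt).const_mul (-(1 / 8))).smul
    (hI.smul hC).hasFDerivAt)
  have h' : HasFDerivAt (psiC m) _ z := h.congr_of_eventuallyEq (by
    filter_upwards [isOpen_ne.mem_nhds hz] with w hw using psiC_eq hm hw)
  have e1 := frameDeriv_radialQuot hm hz a
  have e2 := frameDeriv_tanhY hm hz a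
  have e3 : radialQuot m z * (1 + dirY m z * tanhY m z) = 1 := inv_mul_cancel₀ h0
  rw [e2] at e1
  rw [psiRemainder]
  simp only [frameDeriv] at e1 e2 ⊢
  rw [h'.fderiv]
  simp only [add_apply, smul_apply, ContinuousLinearMap.smulRight_apply, e1, e2, smul_eq_mul,
    Complex.real_smul, Pi.smul_apply', Pi.mul_apply]
  have e3' : (radialQuot m z : ℂ) * (1 + dirY m z * tanhY m z) = 1 := by exact_mod_cast e3
  push_cast
  linear_combination (1 / 2 * (m : ℂ) * sechY m z ^ 2 * dy₁ m a z * radialQuot m z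
    * (invR m z * dirC m z)) * e3'

theorem inv_norm_sq_sq_smul_yC (hm : 0 < m) {z : C2} (hz : z ≠ 0) :
    ((‖z‖ ^ 2)⁻¹ ^ 2) • yC z
      = (1 / 4 * (radialQuot m z ^ 2 * sechY m z ^ 2)) • (invR m z • dirC m z) := by
  rw [inv_norm_sq_eq hm hz, dirC, smul_smul, smul_smul]
  congr 1
  ring

/-- On `N` the derivative of `y₁` is `V⁻¹`, and `4m/V = 2 - 1/(RV)`. The constant 2 reproduces
`-r⁻⁴(y₂ + iy₃)` exactly; the correction has an extra `1/R`. -/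
theorem symbol_frameDeriv_psiC_zero_add (hm : 0 < m) :
    Symbol (frame m) (fun z => invR m z * invR m z)
      (fun z => frameDeriv (frame m) 0 (psiC m) z + ((‖z‖ ^ 2)⁻¹ ^ 2) • yC z) := by
  have hq := symbol_radialQuot hm
  have hs := symbol_sechY hm
  have hρ : Symbol (frame m) (fun z => invR m z * invR m z)
      (fun z => invR m z • (invR m z • dirC m z)) :=
    (symbol_invR hm).smul (symbol_invR_smul_dirC hm)
  have h1 := ((((hq.mul_left hq).mul_left (hs.mul_left hs)).mul_left (symbol_invV hm)).const_mul
    (1 / 8)).smul_left hρ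
  refine ((symbol_psiRemainder hm 0).add h1).congr ?_
  filter_upwards [eventually_ne_zero] with z hz
  have hV := (V_pos hm hz).ne'
  have h2 : 4 * m * (V m z)⁻¹ = 2 - invR m z * (V m z)⁻¹ := by
    have := V_eq hm hz
    rw [← invR] at this
    field_simp
    linarith
  rw [frameDeriv_psiC hm hz, inv_norm_sq_sq_smul_yC hm hz, sub_add, ← sub_smul, sub_eq_add_neg,
    ← neg_smul, smul_smul]
  congr 2
  simp only [dy₁, Matrix.cons_val_zero]
  linear_combination (1 / 8 * radialQuot m z ^ 2 * sechY m z ^ 2) * h2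

theorem symbol_frameDeriv_psiC (hm : 0 < m) {a : Fin 4} (ha : a ≠ 0) :
    Symbol (frame m) (fun z => invR m z * invR m z) (frameDeriv (frame m) a (psiC m)) := by
  refine (symbol_psiRemainder hm a).congr ?_
  filter_upwards [eventually_ne_zero] with z hz
  have h : dy₁ m a z = 0 := by
    fin_cases a
    · exact absurd rfl ha
    · rfl
    · rfl
    · rfl
  rw [frameDeriv_psiC hm hz, h]
  simp

theorem symbol_inv_norm_sq_sq_mul_dirY (hm : 0 < m) :
    Symbol (frame m) (fun z => invR m z * invR m z)
      (fun z => (((‖z‖ ^ 2)⁻¹ ^ 2 * dirY m z : ℝ) : ℂ)) := by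
  have hq := symbol_radialQuot hm
  have hs := symbol_sechY hm
  have h1 := ((((hq.mul_left hq).mul_left (hs.mul_left hs)).mul_left (symbol_dirY hm)).const_mul
    (1 / 4)).mul_left ((symbol_invR hm).mul (symbol_invR hm))
  refine (h1.clm_comp Complex.ofRealCLM).congr ?_
  filter_upwards [eventually_ne_zero] with z hz
  rw [inv_norm_sq_eq hm hz, Complex.ofRealCLM_apply]
  congr 1
  ring

/-! ### The complex Hessian of `ψ_c` -/

/-- The 1-form `-½ r⁻⁴ (z₁ dz₂ - z₂ dz₁)`, a primitive of `θ₂ + i θ₃`. -/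
def thetaPrimitive (z : C2) : C2 →L[ℝ] ℂ := (-(1 / 2) * (‖z‖ ^ 2)⁻¹ ^ 2) • symp z

theorem contDiffAt_inv_norm_sq {z : C2} (hz : z ≠ 0) :
    ContDiffAt ℝ ∞ (fun w : C2 => (‖w‖ ^ 2)⁻¹) z :=
  (contDiff_norm_sq ℝ).contDiffAt.inv (by simpa using hz)

theorem contDiffAt_thetaPrimitive {z : C2} (hz : z ≠ 0) : ContDiffAt ℝ ∞ thetaPrimitive z :=
  (contDiffAt_const.mul ((contDiffAt_inv_norm_sq hz).pow 2)).smul symp.contDiff.contDiffAt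

theorem fderiv_inv_norm_sq {z : C2} (hz : z ≠ 0) (Z : C2) :
    fderiv ℝ (fun w : C2 => (((‖w‖ ^ 2)⁻¹ : ℝ) : ℂ)) z Z =
      ((-2 * (‖z‖ ^ 2)⁻¹ ^ 2 * ((starRingEnd ℂ (z 0) * Z 0).re
        + (starRingEnd ℂ (z 1) * Z 1).re) : ℝ) : ℂ) := by
  have h1 := (hasFDerivAt_norm_coord_sq 0 z).add (hasFDerivAt_norm_coord_sq 1 z)
  have h2 : HasFDerivAt (fun w : C2 => ‖w‖ ^ 2) _ z :=
    h1.congr_of_eventuallyEq (Eventually.of_forall norm_sq_eq)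
  have h0 : ‖z‖ ^ 2 ≠ 0 := by simpa using hz
  have h3 := Complex.ofRealCLM.hasFDerivAt.comp z ((hasDerivAt_inv h0).comp_hasFDerivAt z h2)
  have h4 : HasFDerivAt (fun w : C2 => (((‖w‖ ^ 2)⁻¹ : ℝ) : ℂ)) _ z := h3
  rw [h4.fderiv]
  simp only [ContinuousLinearMap.comp_apply, smul_apply, add_apply, innerSL_apply_apply,
    coord_apply, Complex.inner, Complex.ofRealCLM_apply, smul_eq_mul, nsmul_eq_mul,
    Nat.cast_ofNat, mul_comm (Z _)]
  congr 1
  field_simp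

/-- In the combination `I₂ + iI₃` applied to `d(r⁻²)/4`, the parts antilinear in `Z` cancel, leaving
a complex-linear form. -/
theorem thetaPrimitive_eq {z : C2} (hz : z ≠ 0) (Z : C2) :
    thetaPrimitive z Z =
      1 / 4 * -(fderiv ℝ (fun w : C2 => (((‖w‖ ^ 2)⁻¹ : ℝ) : ℂ)) z (stdI 1 Z))
      + Complex.I * (1 / 4 * -(fderiv ℝ (fun w : C2 => (((‖w‖ ^ 2)⁻¹ : ℝ) : ℂ)) z (stdI 2 Z))) := by
  have e1 : (stdI 1 Z) 0 = -(starRingEnd ℂ (Z 1)) := rfl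
  have e2 : (stdI 1 Z) 1 = starRingEnd ℂ (Z 0) := rfl
  have e3 : (stdI 2 Z) 0 = Complex.I * -(starRingEnd ℂ (Z 1)) := rfl
  have e4 : (stdI 2 Z) 1 = Complex.I * starRingEnd ℂ (Z 0) := rfl
  have e5 : thetaPrimitive z Z
      = ((-(1 / 2) * (‖z‖ ^ 2)⁻¹ ^ 2 : ℝ) : ℂ) * (z 0 * Z 1 - z 1 * Z 0) := rfl
  rw [fderiv_inv_norm_sq hz, fderiv_inv_norm_sq hz, e1, e2, e3, e4, e5]
  generalize (‖z‖ ^ 2)⁻¹ ^ 2 = t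
  apply Complex.ext
  · simp
    ring
  · simp
    ring

theorem thetaC_eq {z : C2} (hz : z ≠ 0) (Z : Fin 2 → C2) :
    thetaC z Z = fderiv ℝ (fun w => thetaPrimitive w (Z 1)) z (Z 0)
      - fderiv ℝ (fun w => thetaPrimitive w (Z 0)) z (Z 1) := by
  have hs : ContDiffAt ℝ ∞ (fun w : C2 => (((‖w‖ ^ 2)⁻¹ : ℝ) : ℂ)) z :=
    Complex.ofRealCLM.contDiff.contDiffAt.comp z (contDiffAt_inv_norm_sq hz)
  have hd : ∀ W : C2, DifferentiableAt ℝ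
      (fun w => -(fderiv ℝ (fun w : C2 => (((‖w‖ ^ 2)⁻¹ : ℝ) : ℂ)) w W)) z := fun W =>
    (((hs.fderiv_right (m := ∞) (by simp)).differentiableAt (by simp)).clm_apply
      (differentiableAt_const W)).fun_neg
  have h : ∀ U W : C2, fderiv ℝ (fun w => thetaPrimitive w W) z U =
      1 / 4 * fderiv ℝ (fun w => -(fderiv ℝ (fun w : C2 => (((‖w‖ ^ 2)⁻¹ : ℝ) : ℂ)) w
        (stdI 1 W))) z U
      + Complex.I * (1 / 4 * fderiv ℝ (fun w => -(fderiv ℝ (fun w : C2 =>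
        (((‖w‖ ^ 2)⁻¹ : ℝ) : ℂ)) w (stdI 2 W))) z U) := by
    intro U W
    have h1 := ((hd (stdI 1 W)).hasFDerivAt.const_mul (1 / 4)).fun_add
      (((hd (stdI 2 W)).hasFDerivAt.const_mul (1 / 4)).const_mul Complex.I)
    have h2 := h1.congr_of_eventuallyEq (f₁ := fun w => thetaPrimitive w W) (by
      filter_upwards [isOpen_ne.mem_nhds hz] with w hw using thetaPrimitive_eq hw W)
    rw [h2.fderiv]
    rfl
  rw [h, h, thetaC, theta, theta, ddc, ddc]
  ring

/-- The complex Hessian of `ψ_c` for an almost complex structure `J` which is asymptotic to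
`I₁`. -/
theorem tensorSymbol_ddc_sub_thetaC (hm : 0 < m) {J : C2 → C2 →L[ℝ] C2}
    (hJ : SmoothAtInfinity J)
    (hE : ∀ a, Symbol (frame m) (fun z => invR m z * invR m z)
      (fun z => fderiv ℝ (psiC m) z ((J z - stdI 0) (frame m a z)))) :
    TensorSymbol m (fun z => invR m z * invR m z) 2 (ddc J (psiC m) - thetaC) := by
  -- Subtracting the exact form `i dψ_c` does not affect the exterior derivative, but without it `J
  -- dψ_c` and the primitive of `θ₂ + iθ₃` differ along `N` by a term of the size of `r⁻⁴(y₂ +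
  -- iy₃)`.
  let γ : C2 → C2 →L[ℝ] ℂ := fun z => -(fderiv ℝ (psiC m) z ∘L J z)
    - Complex.I • fderiv ℝ (psiC m) z - thetaPrimitive z
  have hγ : ∀ a, Symbol (frame m) (fun z => invR m z * invR m z)
      (fun z => γ z (frame m a z)) := by
    intro a
    -- This is the contribution of the constant structure `I₁`: the `r⁻⁴(y₂ + iy₃)` terms cancel on
    -- `N` and `I₁N`, while on `X` and `I₁X` each term is `O(R⁻²)` by itself. The deviation of `J`
    -- enters only through `hE`.
    have h0 : Symbol (frame m) (fun z => invR m z * invR m z) (fun z =>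
        -(fderiv ℝ (psiC m) z (stdI 0 (frame m a z)))
        - Complex.I * fderiv ℝ (psiC m) z (frame m a z)
        + (1 / 2 * (‖z‖ ^ 2)⁻¹ ^ 2 : ℝ) * symp z (frame m a z)) := by
      have d0 := symbol_frameDeriv_psiC_zero_add hm
      have d1 := symbol_frameDeriv_psiC hm (a := 1) (by decide)
      have d2 := symbol_frameDeriv_psiC hm (a := 2) (by decide)
      have d3 := symbol_frameDeriv_psiC hm (a := 3) (by decide)
      have d4 := symbol_inv_norm_sq_sq_mul_dirY hm
      fin_cases a
      · refine (d1.neg.sub (d0.const_mul Complex.I)).congr (Eventually.of_forall fun z => ?_)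
        have e := symp_self_axial z
        simp only [frameDeriv, frame, Matrix.cons_val_zero, Matrix.cons_val_one, Fin.zero_eta,
          Complex.real_smul] at e ⊢
        rw [e]
        push_cast
        ring
      · refine (d0.sub (d1.const_mul Complex.I)).congr (Eventually.of_forall fun z => ?_)
        have e := symp_self_axial z
        simp only [frameDeriv, frame, Matrix.cons_val_zero, Matrix.cons_val_one, Fin.mk_one,
          Complex.real_smul, stdI_stdI, symp_stdI_right] at e ⊢
        rw [e, map_neg]
        push_cast
        linear_combination (‖z‖ ^ 2 : ℂ)⁻¹ ^ 2 * yC z * Complex.I_sq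
      · refine ((d3.neg.sub (d2.const_mul Complex.I)).add
          (d4.const_mul (Complex.I / 2))).congr (Eventually.of_forall fun z => ?_)
        have e := symp_self_horiz hm z
        simp only [frameDeriv, frame, Matrix.cons_val, Fin.reduceFinMk] at e ⊢
        rw [e]
        push_cast
        ring
      · refine ((d2.sub (d3.const_mul Complex.I)).add
          (d4.const_mul (-1 / 2))).congr (Eventually.of_forall fun z => ?_)
        have e := symp_self_horiz hm z
        simp only [frameDeriv, frame, Matrix.cons_val, Fin.reduceFinMk, stdI_stdI,
          symp_stdI_right] at e ⊢
        rw [e, map_neg]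
        push_cast
        linear_combination (-1 / 2 * (‖z‖ ^ 2 : ℂ)⁻¹ ^ 2 * dirY m z) * Complex.I_sq
    refine (h0.sub (hE a)).congr (Eventually.of_forall fun z => ?_)
    simp only [γ, thetaPrimitive, sub_apply, neg_apply, smul_apply, smul_eq_mul,
      ContinuousLinearMap.comp_apply, map_sub, Complex.real_smul]
    push_cast
    ring
  refine (TensorSymbol.of_extDeriv hm hγ).congr ?_
  have hψ := (symbol_psiC hm).smooth
  filter_upwards [eventually_ne_zero, hψ, hJ] with z hz hψz hJz
  funext Z
  have hdψ : DifferentiableAt ℝ (fderiv ℝ (psiC m)) z :=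
    (hψz.fderiv_right (m := ∞) (by simp)).differentiableAt (by simp)
  have hdJ : DifferentiableAt ℝ J z := hJz.differentiableAt (by simp)
  have hγd : ∀ U W : C2, fderiv ℝ (fun w => γ w W) z U =
      fderiv ℝ (fun w => -(fderiv ℝ (psiC m) w (J w W))) z U
      - Complex.I * fderiv ℝ (fderiv ℝ (psiC m)) z U W
      - fderiv ℝ (fun w => thetaPrimitive w W) z U := by
    intro U W
    have h1 : DifferentiableAt ℝ (fun w => -(fderiv ℝ (psiC m) w (J w W))) z :=
      (hdψ.clm_apply (hdJ.clm_apply (differentiableAt_const W))).fun_neg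
    have h2 := hdψ.hasFDerivAt.clm_apply (hasFDerivAt_const W z)
    have h3 : DifferentiableAt ℝ (fun w => thetaPrimitive w W) z :=
      ((contDiffAt_thetaPrimitive hz).differentiableAt (by simp)).clm_apply
        (differentiableAt_const W)
    have h4 : HasFDerivAt (fun w => γ w W) _ z :=
      (h1.hasFDerivAt.fun_sub (h2.const_mul Complex.I)).fun_sub h3.hasFDerivAt
    rw [h4.fderiv]
    simp
  -- Symmetry of the second derivative is the closedness of `i dψ_c`.
  have hsymm := (hψz.isSymmSndFDerivAt (by
    simp only [minSmoothness_of_isRCLikeNormedField]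
    exact WithTop.coe_le_coe.2 le_top)) (Z 0) (Z 1)
  rw [hγd, hγd, Pi.sub_apply, Pi.sub_apply, thetaC_eq hz, ddc, hsymm]
  ring

/-! ### Smoothness of the transported complex structures -/

/-- Read in the trivialisation at `q z₀`, both `dq` and `J ∘ q` are smooth, and inversion is smooth
at an invertible map. The trivialisation cancels from `(dq)⁻¹ ∘ J ∘ dq`, so the local expression is
the field itself. -/
theorem contDiffAt_pullEnd {Y : Type*} [TopologicalSpace Y] [ChartedSpace C2 Y]
    [IsManifold 𝓘(ℝ, C2) ∞ Y]
    {J : (p : Y) → TangentSpace 𝓘(ℝ, C2) p →L[ℝ] TangentSpace 𝓘(ℝ, C2) p}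
    (hJ : ContMDiff 𝓘(ℝ, C2) (𝓘(ℝ, C2).prod 𝓘(ℝ, C2 →L[ℝ] C2)) ∞
      (fun p : Y => Bundle.TotalSpace.mk' (C2 →L[ℝ] C2)
        (E := fun p : Y => TangentSpace 𝓘(ℝ, C2) p →L[ℝ] TangentSpace 𝓘(ℝ, C2) p) p (J p)))
    {q : C2 → Y} {z₀ : C2}
    (hq : ∀ᶠ z in 𝓝 z₀, IsLocalDiffeomorphAt 𝓘(ℝ, C2) 𝓘(ℝ, C2) ∞ q z) :
    ContDiffAt ℝ ∞ (pullEnd q J) z₀ := by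
  have hq₀ := hq.self_of_nhds
  have hqs : ContMDiffAt 𝓘(ℝ, C2) 𝓘(ℝ, C2) ∞ q z₀ := hq₀.contMDiffAt
  let D : C2 → C2 →L[ℝ] C2 := inTangentCoordinates 𝓘(ℝ, C2) 𝓘(ℝ, C2) id q
    (fun z => mfderiv 𝓘(ℝ, C2) 𝓘(ℝ, C2) q z) z₀
  have hD : ContDiffAt ℝ ∞ D z₀ :=
    (hqs.mfderiv_const (m := ∞) (by simp)).contDiffAt
  let K : C2 → C2 →L[ℝ] C2 := fun z => ContinuousLinearMap.inCoordinates C2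
    (TangentSpace 𝓘(ℝ, C2) (M := Y)) C2 (TangentSpace 𝓘(ℝ, C2) (M := Y)) (q z₀) (q z) (q z₀) (q z)
    (J (q z))
  have hK : ContDiffAt ℝ ∞ K z₀ :=
    (((contMDiffAt_hom_bundle _).1 (hJ (q z₀))).2.comp z₀ hqs).contDiffAt
  have hbase : ∀ᶠ z in 𝓝 z₀,
      q z ∈ (trivializationAt C2 (TangentSpace 𝓘(ℝ, C2) (M := Y)) (q z₀)).baseSet :=
    hqs.continuousAt.preimage_mem_nhds
      ((trivializationAt C2 (TangentSpace 𝓘(ℝ, C2) (M := Y)) (q z₀)).open_baseSet.mem_nhds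
        (FiberBundle.mem_baseSet_trivializationAt' _))
  have hDeq : ∀ z (hz : q z ∈ (trivializationAt C2 (TangentSpace 𝓘(ℝ, C2) (M := Y))
      (q z₀)).baseSet), D z = ((trivializationAt C2 (TangentSpace 𝓘(ℝ, C2) (M := Y))
        (q z₀)).continuousLinearEquivAt ℝ (q z) hz : TangentSpace 𝓘(ℝ, C2) (q z) →L[ℝ] C2) ∘L
        (mfderiv 𝓘(ℝ, C2) 𝓘(ℝ, C2) q z) := by
    intro z hz
    have hz' : z ∈ (trivializationAt C2 (TangentSpace 𝓘(ℝ, C2) (M := C2)) z₀).baseSet := by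
      simp [chartAt_self_eq]
    have h1 := ContinuousLinearMap.inCoordinates_eq (F := C2)
      (E := TangentSpace 𝓘(ℝ, C2) (M := C2)) (F' := C2) (E' := TangentSpace 𝓘(ℝ, C2) (M := Y))
      (ϕ := mfderiv 𝓘(ℝ, C2) 𝓘(ℝ, C2) q z) hz' hz
    refine Eq.trans h1 ?_
    have h2 : ∀ v : C2, ((trivializationAt C2 (TangentSpace 𝓘(ℝ, C2) (M := C2))
        z₀).continuousLinearEquivAt ℝ z hz').symm v = v := fun v => by
      have h3 := congrArg (fun L : C2 →L[ℝ] C2 => L v)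
        (TangentBundle.symmL_model_space (𝕜 := ℝ) z₀ z)
      exact (congrFun (Bundle.Trivialization.symm_continuousLinearEquivAt_eq _ hz') v).trans h3
    ext1 v
    change (trivializationAt C2 (TangentSpace 𝓘(ℝ, C2) (M := Y)) (q z₀)).continuousLinearEquivAt ℝ
      (q z) hz (mfderiv 𝓘(ℝ, C2) 𝓘(ℝ, C2) q z (((trivializationAt C2
        (TangentSpace 𝓘(ℝ, C2) (M := C2)) z₀).continuousLinearEquivAt ℝ z hz').symm v)) = _
    rw [h2]
    rfl
  have hinv : (D z₀).IsInvertible := by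
    rw [hDeq z₀ hbase.self_of_nhds]
    exact ContinuousLinearMap.isInvertible_equiv.comp
      ⟨hq₀.mfderivToContinuousLinearEquiv (by simp), rfl⟩
  have hDi : ContDiffAt ℝ ∞ (fun z => (D z).inverse) z₀ :=
    hinv.contDiffAt_map_inverse.comp z₀ hD
  refine ((hDi.clm_comp hK).clm_comp hD).congr_of_eventuallyEq ?_
  filter_upwards [hbase, hq] with z hz hqz
  set C := (trivializationAt C2 (TangentSpace 𝓘(ℝ, C2) (M := Y))
    (q z₀)).continuousLinearEquivAt ℝ (q z) hz with hC
  set L := hqz.mfderivToContinuousLinearEquiv (by simp) with hL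
  have hL' : (L : TangentSpace 𝓘(ℝ, C2) z →L[ℝ] TangentSpace 𝓘(ℝ, C2) (q z))
      = mfderiv 𝓘(ℝ, C2) 𝓘(ℝ, C2) q z := rfl
  have hK' : K z = (C : TangentSpace 𝓘(ℝ, C2) (q z) →L[ℝ] C2) ∘L ((J (q z)) ∘L
      (C.symm : C2 →L[ℝ] TangentSpace 𝓘(ℝ, C2) (q z))) :=
    ContinuousLinearMap.inCoordinates_eq hz hz
  have hDz : D z = ((L.trans C : TangentSpace 𝓘(ℝ, C2) z ≃L[ℝ] C2) :
      TangentSpace 𝓘(ℝ, C2) z →L[ℝ] C2) := by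
    rw [hDeq z hz, ← hL']
    rfl
  have hP : pullEnd q J z = ((L.symm : TangentSpace 𝓘(ℝ, C2) (q z) →L[ℝ]
      TangentSpace 𝓘(ℝ, C2) z) ∘L (J (q z))) ∘L
      (L : TangentSpace 𝓘(ℝ, C2) z →L[ℝ] TangentSpace 𝓘(ℝ, C2) (q z)) := by
    rw [← ContinuousLinearMap.inverse_equiv L]
    rfl
  have hDi' : (D z).inverse = ((L.trans C).symm : C2 →L[ℝ] TangentSpace 𝓘(ℝ, C2) z) := by
    rw [hDz]
    exact ContinuousLinearMap.inverse_equiv _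
  rw [hP, hK', hDi', hDz]
  ext1 v
  change L.symm (J (q z) (L v)) = L.symm (C.symm (C (J (q z) (C.symm (C (L v))))))
  rw [C.symm_apply_apply, C.symm_apply_apply]

theorem smoothAtInfinity_pullEnd {Y : Type*} [TopologicalSpace Y] [ChartedSpace C2 Y]
    [IsManifold 𝓘(ℝ, C2) ∞ Y] {k : ℕ} {S : Hyperkahler Y} (Φ : ALEEnd k S) (j : Fin 3) :
    SmoothAtInfinity (pullEnd Φ.q (S.cs j)) := by
  filter_upwards [tendsto_norm_cobounded_atTop.eventually_gt_atTop Φ.ρ] with z hz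
  refine contDiffAt_pullEnd (S.cs_smooth j) ?_
  filter_upwards [(isOpen_lt continuous_const continuous_norm).mem_nhds hz] with w hw
  exact Φ.localDiffeo ⟨w, hw⟩

/-! ### Perturbation of the complex structure. -/

/-- The difference of two almost complex structures which agree to order `r⁻⁴` contributes
`O(R⁻²)` to the complex Hessian of `ψ_c`. -/
theorem symbol_fderiv_psiC_comp (hm : 0 < m) {A : C2 → C2 →L[ℝ] C2} (hs : SmoothAtInfinity A)
    (hA : ∀ l : ℕ, (fun z => ‖iteratedFDeriv ℝ l A z‖) =O[cobounded C2]
      fun z => (‖z‖ ^ (4 + l))⁻¹) (a : Fin 4) :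
    Symbol (frame m) (fun z => invR m z * invR m z)
      (fun z => fderiv ℝ (psiC m) z (A z (frame m a z))) := by
  have h1 := (Symbol.of_iteratedFDeriv (symbol_frame hm) 4 hs hA).bilin
    (ContinuousLinearMap.id ℝ (C2 →L[ℝ] C2)) (symbol_frame hm a)
  have hα := (((symbol_horiz hm).bilin symp h1).const_mul Complex.I)
  have hβ := (((symbol_axial hm).bilin symp h1).const_mul (-Complex.I))
  -- The coframe is built from `symp` applied to `X` and `N`, of size `O(r)`; with the frame vector,
  -- also `O(r)`, and the endomorphism, `O(r⁻⁴)`, the components are `O(r⁻²)`.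
  have hθ : ∀ b, Symbol (frame m) (fun z => ‖z‖ * ((‖z‖ ^ 4)⁻¹ * ‖z‖))
      (fun z => coframe m b z (A z (frame m a z))) := by
    intro b
    fin_cases b
    · exact hα.clm_comp Complex.reCLM
    · exact hα.clm_comp Complex.imCLM
    · exact hβ.clm_comp Complex.reCLM
    · exact hβ.clm_comp Complex.imCLM
  have h2 := Symbol.sum Finset.univ fun b _ => (hθ b).smul ((symbol_psiC hm).frameDeriv b)
  refine (h2.congr ?_).weight ?_
  · filter_upwards [eventually_ne_zero] with z hz
    conv_rhs => rw [← sum_coframe_smul_frame hm hz (A z (frame m a z))]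
    simp only [map_sum, map_smul, frameDeriv]
  -- Since `2R ≤ r²`, the weight `r⁻²` of the endomorphism is at most `1/R`; the other `1/R` is that
  -- of `dψ_c`.
  · refine IsBigO.mul (IsBigO.of_bound 1 ?_) (isBigO_refl _ _)
    filter_upwards [eventually_ne_zero] with z hz
    have hR := R_pos hm hz
    have hn : ‖z‖ ≠ 0 := norm_ne_zero_iff.2 hz
    have h3 := two_mul_R_le_norm_sq hm z
    have h4 : ‖z‖ * ((‖z‖ ^ 4)⁻¹ * ‖z‖) = (‖z‖ ^ 2)⁻¹ := by
      field_simp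
    rw [h4, one_mul, invR, Real.norm_of_nonneg (by positivity), Real.norm_of_nonneg (by positivity)]
    exact inv_anti₀ hR (by linarith)

theorem tensorSymbol_scalar_psiC (hm : 0 < m) :
    TensorSymbol m (invR m) 0 (scalar (psiC m)) := by
  refine (TensorSymbol.elem _ (symbol_psiC hm) Fin.elim0).congr (Eventually.of_forall fun z => ?_)
  funext Z
  simp [scalar]

end TaubNUT

end

/-! ### The three estimates. -/

open TaubNUT Asymptotics in
theorem lemma1p8 (m : ℝ) (hm : 0 < m) :
    (∀ ℓ ≤ 4,
      (tensorNorm (metric m) (iterCovDeriv (metric m) ℓ (scalar (psiC m))))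
        =O[Bornology.cobounded C2] fun z => (R m z)⁻¹) ∧
    (∀ ℓ ≤ 2,
      (tensorNorm (metric m) (iterCovDeriv (metric m) ℓ
          (ddc (fun _ => stdI 0) (psiC m) - thetaC)))
        =O[Bornology.cobounded C2] fun z => (R m z ^ 2)⁻¹) ∧
    (∀ (k : ℕ), 2 ≤ k →
      ∀ (Y : Type*) [TopologicalSpace Y] [T2Space Y] [SecondCountableTopology Y]
        [ConnectedSpace Y] [ChartedSpace C2 Y] [IsManifold 𝓘(ℝ, C2) ∞ Y]
        (S : Hyperkahler Y) (Φ : ALEEnd k S), ∀ ℓ ≤ 2,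
      (tensorNorm (metric m) (iterCovDeriv (metric m) ℓ
          (ddc (pullEnd Φ.q (S.cs 0)) (psiC m) - thetaC)))
        =O[Bornology.cobounded C2] fun z => (R m z ^ 2)⁻¹) := by
  have hw : (fun z => (R m z ^ 2)⁻¹) = fun z => invR m z * invR m z := by
    funext z
    rw [invR, sq, mul_inv]
  rw [hw]
  refine ⟨fun ℓ _ => ((tensorSymbol_scalar_psiC hm).iterCovDeriv_tensor hm ℓ).tensorNorm_isBigO hm,
    fun ℓ _ => ?_, fun k _ Y _ _ _ _ _ _ S Φ ℓ _ => ?_⟩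
  · refine ((tensorSymbol_ddc_sub_thetaC hm ?_ fun a => ?_).iterCovDeriv_tensor hm
      ℓ).tensorNorm_isBigO hm
    · exact Filter.Eventually.of_forall fun _ => contDiffAt_const
    · simpa using Symbol.zero
  · have hs := smoothAtInfinity_pullEnd Φ 0
    refine ((tensorSymbol_ddc_sub_thetaC hm hs fun a => ?_).iterCovDeriv_tensor hm
      ℓ).tensorNorm_isBigO hm
    exact symbol_fderiv_psiC_comp hm (hs.mono fun _ hz => hz.sub contDiffAt_const)
      (Φ.cs_decay 0) a
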